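/- Let $a>0$, $\gamma>1$, $L>0$, $P>0$, and let $\underline\rho>0$, $\underline u$ be constants with $\underline u>\underline c:=\sqrt{a\gamma}\,\underline\rho^{\frac{\gamma-1}{2}}$. Let $\alpha\in C^2(\mathbb R)$ be $P$-periodic with $\int_0^t\alpha(s)\,ds\ge 0$ for all $t\ge 0$ and $\int_0^P\alpha(s)\,ds=0$. Consider on $[0,\infty)\times[0,L]$ the problem $$ \begin{cases} \rho_t+(\rho u)_x=0,\\ (\rho u)_t+(\rho u^2+a\rho^\gamma)_x=\alpha(t)\rho u,\\ \rho(0,x)=\underline\rho,\quad u(0,x)=\underline u, & x\in[0,L],\\ \rho(t,0)=\rho_l(t),\quad u(t,0)=u_l(t), & t\ge 0, \end{cases} \qquad \rho\ge 0 . $$ There are positive constants $\varepsilon_0,T_0,C_0$, depending only on $a,\gamma,L,P,\alpha,\underline\rho,\underline u$, such that the following holds for every $0\le\varepsilon\le\varepsilon_0$. Let $\rho_l,u_l\in C^1(\mathbb R)$ be $P$-periodic and satisfy the compatibility conditions $$\rho_l(0)=\underline\rho,\quad u_l(0)=\underline u,\quad \rho_l'(0)=0,\quad u_l'(0)=\alpha(0)\underline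 u,$$ and $$\|\rho_l-\underline\rho\|_{H^2(0,P)}+\big\|u_l-e^{\int_0^t\alpha(s)ds}\underline u\big\|_{H^2(0,P)}\le\varepsilon .$$ Then the problem has a unique solution $(\rho,u)\in C^1([0,\infty)\times[0,L])$, and it satisfies $$\rho(t+P,x)=\rho(t,x),\quad u(t+P,x)=u(t,x)\qquad\text{for all } t>T_0,\ x\in[0,L],$$ $$\|\rho-\underline\rho\|_{C^1([0,\infty)\times[0,L])}+\big\|u-e^{\int_0^t\alpha(s)ds}\underline u\big\|_{C^1([0,\infty)\times[0,L])}\le C_0\varepsilon ,$$ where $\|f\|_{C^1}=\sup|f|+\sup|f_t|+\sup|f_x|$. -/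

import Mathlib

open MeasureTheory Set
open scoped ENNReal ContDiff

noncomputable section

namespace EulerSource

/-- `g` is the weak (distributional) derivative of `f` on the open set `I` of the line. -/
def IsWeakDeriv (I : Set ℝ) (f g : ℝ → ℝ) : Prop :=
  LocallyIntegrableOn f I ∧ LocallyIntegrableOn g I ∧
    ∀ φ : ℝ → ℝ, ContDiff ℝ ∞ φ → HasCompactSupport φ → tsupport φ ⊆ I →
      ∫ t in I, f t * deriv φ t = -∫ t in I, g t * φ t

/-- The norm of the Sobolev space `H²` of the open interval `(0, P)`,
`(‖f‖² + ‖f'‖² + ‖f''‖²)^(1/2)` with weak derivatives and `L²` norms. Weak derivatives are unique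
almost everywhere, so the infimum runs over copies of one number; it is `⊤` if `f` has no weak
derivatives of order one and two, or if one of the `L²` norms is infinite. -/
def h2Norm (P : ℝ) (f : ℝ → ℝ) : ℝ≥0∞ :=
  ⨅ (g : ℝ → ℝ) (h : ℝ → ℝ) (_ : IsWeakDeriv (Ioo 0 P) f g) (_ : IsWeakDeriv (Ioo 0 P) g h),
    (eLpNorm f 2 (volume.restrict (Ioo 0 P)) ^ (2 : ℝ)
      + eLpNorm g 2 (volume.restrict (Ioo 0 P)) ^ (2 : ℝ)
      + eLpNorm h 2 (volume.restrict (Ioo 0 P)) ^ (2 : ℝ)) ^ (1 / 2 : ℝ)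

/-- The space-time domain `[0, ∞) × [0, L]`; points are `(t, x)`. -/
def domain (L : ℝ) : Set (ℝ × ℝ) := Ici 0 ×ˢ Icc 0 L

/-- The partial derivative in time, one-sided at `t = 0`. -/
def dt (f : ℝ × ℝ → ℝ) (z : ℝ × ℝ) : ℝ :=
  derivWithin (fun t => f (t, z.2)) (Ici 0) z.1

/-- The partial derivative in space, one-sided at `x = 0` and `x = L`. -/
def dx (L : ℝ) (f : ℝ × ℝ → ℝ) (z : ℝ × ℝ) : ℝ :=
  derivWithin (fun x => f (z.1, x)) (Icc 0 L) z.2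

/-- The `C¹` norm on `[0, ∞) × [0, L]`, `sup |f| + sup |f_t| + sup |f_x|`, with values in
`[0, ∞]`. -/
def c1Norm (L : ℝ) (f : ℝ × ℝ → ℝ) : ℝ≥0∞ :=
  (⨆ z ∈ domain L, ‖f z‖ₑ) + (⨆ z ∈ domain L, ‖dt f z‖ₑ) + (⨆ z ∈ domain L, ‖dx L f z‖ₑ)

/-- The velocity `e^{∫₀ᵗ α} u₀` of the background flow. -/
def backgroundVelocity (α : ℝ → ℝ) (u₀ : ℝ) (t : ℝ) : ℝ :=
  Real.exp (∫ s in (0 : ℝ)..t, α s) * u₀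

/-- `(ρ, u)` is a `C¹` solution on `[0, ∞) × [0, L]` of the inflow problem for the isentropic Euler
system with pressure `p = a ρ^γ` and source `α ρ u`, with constant initial data `(ρ₀, u₀)` and
boundary data `(ρl, ul)` at `x = 0`. -/
structure IsSolution (a γ L : ℝ) (α : ℝ → ℝ) (ρ₀ u₀ : ℝ) (ρl ul : ℝ → ℝ)
    (ρ u : ℝ × ℝ → ℝ) : Prop where
  density_contDiffOn : ContDiffOn ℝ 1 ρ (domain L)
  velocity_contDiffOn : ContDiffOn ℝ 1 u (domain L)
  density_nonneg : ∀ z ∈ domain L, 0 ≤ ρ z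
  mass : ∀ z ∈ domain L, dt ρ z + dx L (fun w => ρ w * u w) z = 0
  momentum : ∀ z ∈ domain L,
    dt (fun w => ρ w * u w) z + dx L (fun w => ρ w * u w ^ 2 + a * ρ w ^ γ) z
      = α z.1 * ρ z * u z
  initial : ∀ x ∈ Icc 0 L, ρ (0, x) = ρ₀ ∧ u (0, x) = u₀
  boundary : ∀ t ∈ Ici (0 : ℝ), ρ (t, 0) = ρl t ∧ u (t, 0) = ul t

end EulerSource

end

noncomputable section
namespace EulerSource
open Filter Topology

/-! ### Backward Gronwall estimate and scalar characteristics -/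

/-! Supersonic flow has both characteristic speeds `u - c` and `u + c` positive, so `x` can serve as
the evolution variable and the boundary data at `x = 0` as Cauchy data. Write the Riemann invariants
`u ∓ 2c/(γ - 1)` as background values plus perturbations `v`. Then `∂ₓ v + μ(t, v) ∂ₜ v = f(t, v)`,
where the slownesses `μ` are `1/(u ∓ c)` and `f` is `μ α` times the velocity perturbation. The
evolution runs over the finite length `L`, so small data give a small solution at all times at once,
with no decay in `t`. The two conditions on the integral of `α` make the background velocity
periodic and at least `u₀`, so the supersonic gap never closes.

The boundary perturbations are continued by zero to `t ≤ 0`; the compatibility conditions make this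
continuation `C¹`. As slownesses are nonnegative, characteristics followed back to `x = 0` go back
in time, so the perturbation vanishes for `t ≤ 0`, which is the initial condition. As slownesses are
at most `C`, a characteristic from `(t, x)` with `t > C x` reaches `x = 0` at a positive time, where
the data are periodic. This gives periodicity after time `C L`.

Existence is by iteration: `step` integrates along characteristics frozen at the previous iterate.
In the weight `e^{Λx}` every integral in `x` gains a factor `1/Λ`, so a large `Λ` makes the step
preserve the bounds (`IsProfile.step`) and contract (`IsProfile.step_contraction`). For `C¹`
regularity, an `H²` function of one variable has a Hölder-`1/2` derivative
(`abs_deriv_sub_deriv_le_of_h2Norm`). A Hölder bound on difference quotients is preserved by the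
step (`IsProfile.step_quot`) and by pointwise limits, and it forces the limit to be `C¹`
(`IsProfile.isClassicalSolution`). Its constant `M` enters neither `Λ` nor the size of the solution,
so the final estimate stays linear in `ε`.

Uniqueness holds against every `C¹` solution with `ρ ≥ 0`, supersonic or not. The difference of
Riemann invariants is transported with the speeds of the constructed solution, and a maximum
principle (`eq_zero_of_transport_inequality`) makes it vanish; positivity of the other density is
continued in time (`IsSolution.eq_of_supersonic`). -/

theorem abs_le_of_backward_gronwall {δ δ' : ℝ → ℝ} {x A B Λ : ℝ}
    (hA : 0 ≤ A) (hB : 0 ≤ B) (hΛ : 0 < Λ)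
    (hδ : ∀ s ∈ Icc 0 x, HasDerivWithinAt δ (δ' s) (Icc 0 x) s)
    (hbd : ∀ s ∈ Icc 0 x, |δ' s| ≤ A * |δ s| + B * Real.exp (Λ * s)) :
    ∀ s ∈ Icc 0 x, |δ s| ≤ Real.exp (A * x) * (|δ x| + B / Λ * Real.exp (Λ * x)) := by
  intro s hs
  have hx0 : 0 ≤ x := hs.1.trans hs.2
  have hmaps : MapsTo (fun r => x - r) (Icc 0 x) (Icc 0 x) := fun r hr =>
    ⟨by linarith [hr.2], by linarith [hr.1]⟩
  have hderiv : ∀ r ∈ Icc 0 x,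
      HasDerivWithinAt (fun r => δ (x - r)) (-δ' (x - r)) (Icc 0 x) r := by
    intro r hr
    have h1 : HasDerivWithinAt (fun r : ℝ => x - r) (-1) (Icc 0 x) r := by
      simpa using (hasDerivWithinAt_id r (Icc 0 x)).const_sub x
    have := (hδ (x - r) (hmaps hr)).comp r h1 hmaps
    simpa [Function.comp_def] using this
  -- The interval is reversed by `r = x - s`. The comparison theorem needs a strict derivative
  -- inequality at contact; the term `η e^r` supplies it and is then sent to zero.
  have main : ∀ η > 0, |δ s| ≤ Real.exp (A * (x - s)) *
      (|δ x| + B * Real.exp (Λ * x) / Λ * (1 - Real.exp (-Λ * (x - s))) + η * Real.exp (x - s)) := by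
    intro η hη
    have key := image_norm_le_of_norm_deriv_right_lt_deriv_boundary
      (f := fun r => δ (x - r)) (f' := fun r => -δ' (x - r)) (a := 0) (b := x)
      (B := fun r => Real.exp (A * r) * (|δ x| + B * Real.exp (Λ * x) / Λ *
        (1 - Real.exp (-Λ * r)) + η * Real.exp r))
      (B' := fun r => Real.exp (A * r) * A * (|δ x| + B * Real.exp (Λ * x) / Λ *
        (1 - Real.exp (-Λ * r)) + η * Real.exp r) + Real.exp (A * r) *
        (B * Real.exp (Λ * x) * Real.exp (-Λ * r) + η * Real.exp r))
      (fun r hr => (hderiv r hr).continuousWithinAt)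
      (fun r hr => ((hderiv r ⟨hr.1, hr.2.le⟩).mono_of_mem_nhdsWithin
        (Icc_mem_nhdsGE_of_mem hr)))
      (by simp; positivity)
      (by
        intro r
        have e1 : HasDerivAt (fun r => Real.exp (A * r)) (Real.exp (A * r) * A) r := by
          simpa using ((hasDerivAt_id r).const_mul A).exp
        have e2 : HasDerivAt (fun r => Real.exp (-Λ * r)) (Real.exp (-Λ * r) * (-Λ)) r := by
          simpa using ((hasDerivAt_id r).const_mul (-Λ)).exp
        have e3 := ((e2.const_sub 1).const_mul (B * Real.exp (Λ * x) / Λ)).const_add (|δ x|)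
        have e4 := e1.mul (e3.add ((Real.hasDerivAt_exp r).const_mul η))
        refine e4.congr_deriv ?_
        simp only [Pi.add_apply]
        field_simp)
      (by
        intro r hr heq
        have h1 := hbd (x - r) (hmaps ⟨hr.1, hr.2.le⟩)
        simp only [Real.norm_eq_abs] at heq ⊢
        rw [abs_neg]
        refine h1.trans_lt ?_
        rw [heq]
        have e1 : Real.exp (Λ * (x - r)) = Real.exp (Λ * x) * Real.exp (-Λ * r) := by
          rw [← Real.exp_add]; ring_nf
        rw [e1]
        have e2 : 1 ≤ Real.exp (A * r) := Real.one_le_exp (mul_nonneg hA hr.1)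
        have e3 : 0 ≤ B * (Real.exp (Λ * x) * Real.exp (-Λ * r)) := by positivity
        have e4 : 0 < η * Real.exp r := by positivity
        nlinarith)
      (x := x - s) (hmaps hs)
    simpa using key
  have hlim : |δ s| ≤ Real.exp (A * (x - s)) *
      (|δ x| + B * Real.exp (Λ * x) / Λ * (1 - Real.exp (-Λ * (x - s)))) := by
    refine le_of_forall_pos_le_add fun e he => ?_
    have hp : 0 < Real.exp (A * (x - s)) * Real.exp (x - s) := by positivity
    have := main (e / (Real.exp (A * (x - s)) * Real.exp (x - s))) (by positivity)
    refine this.trans (le_of_eq ?_)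
    field_simp
  refine hlim.trans ?_
  have h1 : Real.exp (A * (x - s)) ≤ Real.exp (A * x) :=
    Real.exp_le_exp.2 (mul_le_mul_of_nonneg_left (by linarith [hs.1]) hA)
  have h2 : B * Real.exp (Λ * x) / Λ * (1 - Real.exp (-Λ * (x - s)))
      ≤ B / Λ * Real.exp (Λ * x) := by
    have h3 : 0 ≤ B * Real.exp (Λ * x) / Λ := by positivity
    have h4 : B / Λ * Real.exp (Λ * x) = B * Real.exp (Λ * x) / Λ * 1 := by ring
    rw [h4]
    exact mul_le_mul_of_nonneg_left (by linarith [Real.exp_pos (-Λ * (x - s))]) h3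
  refine (mul_le_mul_of_nonneg_left (add_le_add_right h2 _) (Real.exp_pos _).le).trans ?_
  exact mul_le_mul_of_nonneg_right h1 (by positivity)

/-- `τ` solves the characteristic equation `τ' = m (τ, s)` on `[0, x]`. -/
def IsChar (m : ℝ → ℝ → ℝ) (x : ℝ) (τ : ℝ → ℝ) : Prop :=
  ∀ s ∈ Icc 0 x, HasDerivWithinAt τ (m (τ s) s) (Icc 0 x) s

theorem IsChar.mono {m : ℝ → ℝ → ℝ} {x y : ℝ} {τ : ℝ → ℝ} (h : IsChar m y τ) (hxy : x ≤ y) :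
    IsChar m x τ := fun s hs =>
  (h s ⟨hs.1, hs.2.trans hxy⟩).mono (Icc_subset_Icc_right hxy)

theorem IsChar.continuousOn {m : ℝ → ℝ → ℝ} {x : ℝ} {τ : ℝ → ℝ} (h : IsChar m x τ) :
    ContinuousOn τ (Icc 0 x) := fun s hs => (h s hs).continuousWithinAt

theorem exists_isChar {m : ℝ → ℝ → ℝ} {L C A : ℝ} (hC : 0 ≤ C) (hA : 0 ≤ A)
    (hbd : ∀ t, ∀ s ∈ Icc 0 L, |m t s| ≤ C)
    (hlip : ∀ t t', ∀ s ∈ Icc 0 L, |m t s - m t' s| ≤ A * |t - t'|)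
    (hcont : ∀ t, ContinuousOn (m t) (Icc 0 L)) {x : ℝ} (hx : x ∈ Icc 0 L) (t : ℝ) :
    ∃ τ : ℝ → ℝ, τ x = t ∧ IsChar m L τ := by
  have hL : 0 ≤ L := hx.1.trans hx.2
  have hPL : IsPicardLindelof (fun s y => m y s) (tmin := 0) (tmax := L) ⟨x, hx⟩ t
      (Real.toNNReal (C * L)) 0 (Real.toNNReal C) (Real.toNNReal A) := by
    constructor
    · intro s hs
      refine LipschitzOnWith.of_dist_le_mul fun y _ z _ => ?_
      simpa [Real.dist_eq, Real.coe_toNNReal _ hA] using hlip y z s hs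
    · intro y _
      exact hcont y
    · intro s hs y _
      simpa [Real.coe_toNNReal _ hC] using hbd y s hs
    · simp only [Real.coe_toNNReal _ hC, Real.coe_toNNReal _ (mul_nonneg hC hL)]
      simp only [NNReal.coe_zero, sub_zero]
      exact mul_le_mul_of_nonneg_left (max_le (by linarith [hx.1]) (by linarith [hx.2])) hC
  obtain ⟨τ, h1, h2⟩ := hPL.exists_eq_forall_mem_Icc_hasDerivWithinAt₀
  exact ⟨τ, h1, h2⟩

/-- Compares characteristics of two different fields. The perturbation `B e^{Λs}` contributes only
`B/Λ`, the source of smallness in the contraction estimate. -/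
theorem IsChar.dist_le_of_perturb {m n : ℝ → ℝ → ℝ} {x A B Λ : ℝ} {τ σ : ℝ → ℝ}
    (hτ : IsChar m x τ) (hσ : IsChar n x σ) (hA : 0 ≤ A) (hB : 0 ≤ B) (hΛ : 0 < Λ)
    (hlip : ∀ s ∈ Icc 0 x,
      |m (τ s) s - n (σ s) s| ≤ A * |τ s - σ s| + B * Real.exp (Λ * s)) :
    ∀ s ∈ Icc 0 x, |τ s - σ s| ≤
      Real.exp (A * x) * (|τ x - σ x| + B / Λ * Real.exp (Λ * x)) :=
  abs_le_of_backward_gronwall (δ := fun s => τ s - σ s)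
    (δ' := fun s => m (τ s) s - n (σ s) s) hA hB hΛ
    (fun s hs => (hτ s hs).sub (hσ s hs)) hlip

theorem IsChar.dist_le {m : ℝ → ℝ → ℝ} {x A : ℝ} {τ σ : ℝ → ℝ}
    (hτ : IsChar m x τ) (hσ : IsChar m x σ) (hA : 0 ≤ A)
    (hlip : ∀ t t', ∀ s ∈ Icc 0 x, |m t s - m t' s| ≤ A * |t - t'|) :
    ∀ s ∈ Icc 0 x, |τ s - σ s| ≤ Real.exp (A * x) * |τ x - σ x| := by
  intro s hs
  have := hτ.dist_le_of_perturb hσ hA le_rfl one_pos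
    (fun s hs => by simpa using hlip (τ s) (σ s) s hs) s hs
  simpa using this

theorem IsChar.eqOn {m : ℝ → ℝ → ℝ} {x A : ℝ} {τ σ : ℝ → ℝ}
    (hτ : IsChar m x τ) (hσ : IsChar m x σ) (hA : 0 ≤ A)
    (hlip : ∀ t t', ∀ s ∈ Icc 0 x, |m t s - m t' s| ≤ A * |t - t'|) (h : τ x = σ x) :
    EqOn τ σ (Icc 0 x) := by
  intro s hs
  have := hτ.dist_le hσ hA hlip s hs
  rw [h, sub_self, abs_zero, mul_zero] at this
  exact sub_eq_zero.1 (abs_nonpos_iff.1 this)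

/-- If the curves met at `s`, uniqueness to the right of `s` would make them agree at `x`. This
licenses division by `τ s - σ s` below. -/
theorem IsChar.ne {m : ℝ → ℝ → ℝ} {x A : ℝ} {τ σ : ℝ → ℝ}
    (hτ : IsChar m x τ) (hσ : IsChar m x σ) (hA : 0 ≤ A)
    (hlip : ∀ t t', ∀ s ∈ Icc 0 x, |m t s - m t' s| ≤ A * |t - t'|) (h : τ x ≠ σ x)
    {s : ℝ} (hs : s ∈ Icc 0 x) : τ s ≠ σ s := by
  intro heq
  refine h ?_
  have hsub : Icc s x ⊆ Icc 0 x := Icc_subset_Icc_left hs.1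
  refine ODE_solution_unique_of_mem_Icc_right (v := fun r y => m y r) (s := fun _ => univ)
    (K := Real.toNNReal A) (a := s) (b := x) ?_ (hτ.continuousOn.mono hsub) ?_ (fun _ _ => trivial)
    (hσ.continuousOn.mono hsub) ?_ (fun _ _ => trivial) heq (right_mem_Icc.2 hs.2)
  · intro r hr
    refine LipschitzOnWith.of_dist_le_mul fun y _ z _ => ?_
    simpa [Real.dist_eq, Real.coe_toNNReal _ hA] using hlip y z r (hsub ⟨hr.1, hr.2.le⟩)
  · intro r hr
    exact (hτ r (hsub ⟨hr.1, hr.2.le⟩)).mono_of_mem_nhdsWithin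
      (Icc_mem_nhdsGE_of_mem ⟨hs.1.trans hr.1, hr.2⟩)
  · intro r hr
    exact (hσ r (hsub ⟨hr.1, hr.2.le⟩)).mono_of_mem_nhdsWithin
      (Icc_mem_nhdsGE_of_mem ⟨hs.1.trans hr.1, hr.2⟩)

/-- A discrete variational equation: the gap at `s` divided by the gap at `x` solves `D' = Q D`,
where `Q` is the difference quotient of the field. Two such `D` agree at `s = x`, so Gronwall bounds
their difference by that of the `Q`. No derivative of the field is needed. -/
theorem IsChar.quotient_dist_le {m : ℝ → ℝ → ℝ} {x A B Λ : ℝ} {τa τb τc τd : ℝ → ℝ}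
    (ha : IsChar m x τa) (hb : IsChar m x τb) (hc : IsChar m x τc) (hd : IsChar m x τd)
    (hA : 0 ≤ A) (hB : 0 ≤ B) (hΛ : 0 < Λ)
    (hlip : ∀ t t', ∀ s ∈ Icc 0 x, |m t s - m t' s| ≤ A * |t - t'|)
    (hab : τa x ≠ τb x) (hcd : τc x ≠ τd x)
    (hq : ∀ s ∈ Icc 0 x, |(m (τa s) s - m (τb s) s) / (τa s - τb s)
      - (m (τc s) s - m (τd s) s) / (τc s - τd s)| ≤ B * Real.exp (Λ * s)) :
    ∀ s ∈ Icc 0 x, |(τa s - τb s) / (τa x - τb x) - (τc s - τd s) / (τc x - τd x)|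
      ≤ Real.exp (A * x) * (B * Real.exp (A * x) / Λ * Real.exp (Λ * x)) := by
  intro s hs
  have hE : 0 ≤ B * Real.exp (A * x) := by positivity
  have hab' : τa x - τb x ≠ 0 := sub_ne_zero.2 hab
  have hcd' : τc x - τd x ≠ 0 := sub_ne_zero.2 hcd
  have key := abs_le_of_backward_gronwall
    (δ := fun s => (τa s - τb s) / (τa x - τb x) - (τc s - τd s) / (τc x - τd x))
    (δ' := fun s => (m (τa s) s - m (τb s) s) / (τa x - τb x)
      - (m (τc s) s - m (τd s) s) / (τc x - τd x)) (x := x) hA hE hΛ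
    (fun s hs => (((ha s hs).sub (hb s hs)).div_const _).sub
      (((hc s hs).sub (hd s hs)).div_const _)) ?_ s hs
  · simpa [div_self hab', div_self hcd'] using key
  · intro r hr
    have h1 : τa r - τb r ≠ 0 := sub_ne_zero.2 (ha.ne hb hA hlip hab hr)
    have h2 : τc r - τd r ≠ 0 := sub_ne_zero.2 (hc.ne hd hA hlip hcd hr)
    set Q := (m (τa r) r - m (τb r) r) / (τa r - τb r) with hQ
    set Q' := (m (τc r) r - m (τd r) r) / (τc r - τd r) with hQ'
    set D := (τa r - τb r) / (τa x - τb x)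
    set D' := (τc r - τd r) / (τc x - τd x) with hD'
    have e1 : (m (τa r) r - m (τb r) r) / (τa x - τb x) = Q * D := by
      simp only [Q, D]; field_simp
    have e2 : (m (τc r) r - m (τd r) r) / (τc x - τd x) = Q' * D' := by
      simp only [Q', D']; field_simp
    have e3 : |Q| ≤ A := by
      rw [hQ, abs_div, div_le_iff₀ (abs_pos.2 h1)]
      exact hlip _ _ r hr
    have e4 : |D'| ≤ Real.exp (A * x) := by
      rw [hD', abs_div, div_le_iff₀ (abs_pos.2 hcd')]
      exact hc.dist_le hd hA hlip r hr
    have e5 : |Q - Q'| ≤ B * Real.exp (Λ * r) := hq r hr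
    have e6 : Q * D - Q' * D' = Q * (D - D') + (Q - Q') * D' := by ring
    rw [e1, e2, e6]
    refine (abs_add_le _ _).trans ?_
    rw [abs_mul, abs_mul]
    have e7 : |Q - Q'| * |D'| ≤ B * Real.exp (Λ * r) * Real.exp (A * x) :=
      mul_le_mul e5 e4 (abs_nonneg _) (by positivity)
    have e8 : |Q| * |D - D'| ≤ A * |D - D'| := mul_le_mul_of_nonneg_right e3 (abs_nonneg _)
    linarith

theorem IsChar.le_of_nonneg {m : ℝ → ℝ → ℝ} {x : ℝ} {τ : ℝ → ℝ} (hτ : IsChar m x τ)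
    (hm : ∀ s ∈ Icc 0 x, 0 ≤ m (τ s) s) {s : ℝ} (hs : s ∈ Icc 0 x) : τ s ≤ τ x := by
  have hmono : MonotoneOn τ (Icc 0 x) := by
    refine monotoneOn_of_hasDerivWithinAt_nonneg (f' := fun s => m (τ s) s) (convex_Icc 0 x)
      hτ.continuousOn (fun s hs => ?_) (fun s hs => hm s (interior_subset hs))
    exact (hτ s (interior_subset hs)).mono interior_subset
  exact hmono hs (right_mem_Icc.2 (hs.1.trans hs.2)) hs.2

theorem IsChar.lipschitz {m : ℝ → ℝ → ℝ} {x C : ℝ} {τ : ℝ → ℝ} (hτ : IsChar m x τ)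
    (hm : ∀ s ∈ Icc 0 x, |m (τ s) s| ≤ C) {s r : ℝ} (hs : s ∈ Icc 0 x) (hr : r ∈ Icc 0 x) :
    |τ s - τ r| ≤ C * |s - r| := by
  simpa using (convex_Icc 0 x).norm_image_sub_le_of_norm_hasDerivWithin_le
    (f := τ) (f' := fun s => m (τ s) s) hτ (fun s hs => by simpa using hm s hs) hr hs

end EulerSource
end

noncomputable section
namespace EulerSource
open Filter Topology

/-! ### First order systems with positive slownesses -/

variable {ι : Type*}

/-- Hölder-`1/2` control of the difference quotients of `t ↦ G t (y t)` by those of `y`. -/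
def QuotientHolder (R C : ℝ) (G : ℝ → (ι → ℝ) → ℝ) : Prop :=
  ∀ (a b c d : ℝ) (ya yb yc yd : ι → ℝ) (w : ℝ), a ≠ b → c ≠ d → 0 ≤ w →
    (∀ j, |ya j| ≤ R) → (∀ j, |yb j| ≤ R) → (∀ j, |yc j| ≤ R) → (∀ j, |yd j| ≤ R) →
    |a - c| ≤ w ^ 2 → |b - d| ≤ w ^ 2 → (∀ j, |ya j - yc j| ≤ w) → (∀ j, |yb j - yd j| ≤ w) →
    (∀ j, |ya j - yb j| ≤ |a - b|) → (∀ j, |yc j - yd j| ≤ |c - d|) →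
    (∀ j, |(ya j - yb j) / (a - b) - (yc j - yd j) / (c - d)| ≤ w) →
    |(G a ya - G b yb) / (a - b) - (G c yc - G d yd) / (c - d)| ≤ C * w

/-- Lipschitz continuity on the ball of radius `R`. -/
def LipBall (R C : ℝ) (G : ℝ → (ι → ℝ) → ℝ) : Prop :=
  ∀ (t t' : ℝ) (y y' : ι → ℝ) (w : ℝ), (∀ j, |y j| ≤ R) → (∀ j, |y' j| ≤ R) → 0 ≤ w →
    (∀ j, |y j - y' j| ≤ w) → |G t y - G t' y'| ≤ C * (|t - t'| + w)

/-- Structural assumptions on the system `∂ₓ v + μ(t, v) ∂ₜ v = f(t, v)`. -/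
structure IsSystem (R C P : ℝ) (μ f : ι → ℝ → (ι → ℝ) → ℝ) : Prop where
  slowness_nonneg : ∀ i t y, (∀ j, |y j| ≤ R) → 0 ≤ μ i t y
  slowness_le : ∀ i t y, (∀ j, |y j| ≤ R) → μ i t y ≤ C
  slowness_lip : ∀ i, LipBall R C (μ i)
  slowness_quot : ∀ i, QuotientHolder R C (μ i)
  slowness_periodic : ∀ i t y, μ i (t + P) y = μ i t y
  source_le : ∀ i t y w, (∀ j, |y j| ≤ R) → 0 ≤ w → (∀ j, |y j| ≤ w) → |f i t y| ≤ C * w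
  source_lip : ∀ i t t' y y' b w, (∀ j, |y j| ≤ R) → (∀ j, |y' j| ≤ R) → (∀ j, |y j| ≤ b) →
    (∀ j, |y' j| ≤ b) → 0 ≤ b → 0 ≤ w → (∀ j, |y j - y' j| ≤ w) →
    |f i t y - f i t' y'| ≤ C * (b * |t - t'| + w)
  source_quot : ∀ i, QuotientHolder R C (f i)
  source_periodic : ∀ i t y, f i (t + P) y = f i t y

/-- Compatibility of the radius `R`, the bound `C`, the size `κ` and the growth rate `Λ`. -/
structure Admissible (L R C κ Λ : ℝ) : Prop where
  L_nonneg : 0 ≤ L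
  R_le : R ≤ 1
  one_le_C : 1 ≤ C
  κ_nonneg : 0 ≤ κ
  κ_le : κ * Real.exp (Λ * L) ≤ R
  Λ_lip : 4 * C * Real.exp (2 * C * L) ≤ Λ
  Λ_contr : 2 * (Real.exp (2 * C * L) * C + 2 * C * C * Real.exp (2 * C * L) * L + C) ≤ Λ
  Λ_quot : 2 * (C * Real.exp (2 * C * L) ^ 3 * (1 + 2 * C * L)
    + C * Real.exp (2 * C * L) ^ 2) ≤ Λ

/-- Boundary data at `x = 0`: small, with Hölder continuous difference quotients, vanishing for
`t ≤ 0` and periodic for `t > 0`. -/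
structure IsDatum (P κ₀ M₀ : ℝ) (g : ι → ℝ → ℝ) : Prop where
  bound : ∀ i t, |g i t| ≤ κ₀
  lip : ∀ i t t', |g i t - g i t'| ≤ κ₀ * |t - t'|
  quot : ∀ i a b c d r, a ≠ b → c ≠ d → |a - c| ≤ r → |b - d| ≤ r →
    |(g i a - g i b) / (a - b) - (g i c - g i d) / (c - d)| ≤ M₀ * √r
  rest : ∀ i t, t ≤ 0 → g i t = 0
  periodic : ∀ i t, 0 < t → g i (t + P) = g i t

/-- The class of functions on `ℝ × [0, L]` preserved by the iteration. -/
structure IsProfile (L P C κ Λ M : ℝ) (v : ι → ℝ → ℝ → ℝ) : Prop where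
  bound : ∀ i t, ∀ x ∈ Icc 0 L, |v i t x| ≤ κ * Real.exp (Λ * x)
  lip_time : ∀ i t t', ∀ x ∈ Icc 0 L, |v i t x - v i t' x| ≤ κ * Real.exp (Λ * x) * |t - t'|
  lip_space : ∀ i t, ∀ x ∈ Icc 0 L, ∀ x' ∈ Icc 0 L, |v i t x - v i t x'| ≤ 2 * C * |x - x'|
  quot : ∀ i, ∀ x ∈ Icc 0 L, ∀ a b c d r, a ≠ b → c ≠ d → |a - c| ≤ r → |b - d| ≤ r →
    |(v i a x - v i b x) / (a - b) - (v i c x - v i d x) / (c - d)| ≤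
      M * Real.exp (Λ * x) * √r
  rest : ∀ i t, ∀ x ∈ Icc 0 L, t ≤ 0 → v i t x = 0
  periodic : ∀ i t, ∀ x ∈ Icc 0 L, C * x < t → v i (t + P) x = v i t x

/-- The speed field frozen along `v`. -/
def field (μ : ι → ℝ → (ι → ℝ) → ℝ) (v : ι → ℝ → ℝ → ℝ) (i : ι) (t s : ℝ) : ℝ :=
  μ i t (fun j => v j t s)

/-- Integrating `e^{Λs}` gains `1/Λ`; the constant part `K₂` gains nothing and must already carry
such a factor where it is used. -/
theorem abs_integral_le_exp {h : ℝ → ℝ} {x K₁ K₂ Λ : ℝ} (hx : 0 ≤ x) (hK₁ : 0 ≤ K₁) (hΛ : 0 < Λ)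
    (hh : ∀ s ∈ Icc 0 x, |h s| ≤ K₁ * Real.exp (Λ * s) + K₂) :
    |∫ s in (0 : ℝ)..x, h s| ≤ K₁ / Λ * Real.exp (Λ * x) + K₂ * x := by
  have hd : ∀ s ∈ uIcc 0 x, HasDerivAt (fun s => K₁ / Λ * Real.exp (Λ * s) + K₂ * s)
      (K₁ * Real.exp (Λ * s) + K₂) s := by
    intro s _
    have e2 : HasDerivAt (fun r => Real.exp (Λ * r)) (Real.exp (Λ * s) * Λ) s := by
      simpa using ((hasDerivAt_id s).const_mul Λ).exp
    refine ((e2.const_mul (K₁ / Λ)).add ((hasDerivAt_id s).const_mul K₂)).congr_deriv ?_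
    field_simp
  have hint : IntervalIntegrable (fun s => K₁ * Real.exp (Λ * s) + K₂) volume 0 x :=
    Continuous.intervalIntegrable (by fun_prop) _ _
  have h1 := intervalIntegral.norm_integral_le_of_norm_le (f := h) (μ := volume)
    (g := fun s => K₁ * Real.exp (Λ * s) + K₂) hx
    (Eventually.of_forall fun s hs => hh s ⟨hs.1.le, hs.2⟩) hint
  rw [intervalIntegral.integral_eq_sub_of_hasDerivAt hd hint] at h1
  simp only [Real.norm_eq_abs, mul_zero, Real.exp_zero, mul_one, add_zero] at h1
  have : 0 ≤ K₁ / Λ := by positivity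
  linarith

theorem abs_mul_sub_mul_le {X X' Y Y' p q r u : ℝ} (h1 : |X - X'| ≤ p) (h2 : |Y| ≤ q)
    (h3 : |X'| ≤ r) (h4 : |Y - Y'| ≤ u) : |X * Y - X' * Y'| ≤ p * q + r * u := by
  have e : X * Y - X' * Y' = (X - X') * Y + X' * (Y - Y') := by ring
  rw [e]
  refine (abs_add_le _ _).trans ?_
  rw [abs_mul, abs_mul]
  exact add_le_add (mul_le_mul h1 h2 (abs_nonneg _) ((abs_nonneg _).trans h1))
    (mul_le_mul h3 h4 (abs_nonneg _) ((abs_nonneg _).trans h3))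

namespace Admissible

variable {L R C κ Λ : ℝ}

theorem C_pos (h : Admissible L R C κ Λ) : 0 < C := by linarith [h.one_le_C]

theorem one_le_exp (h : Admissible L R C κ Λ) : 1 ≤ Real.exp (2 * C * L) :=
  Real.one_le_exp (mul_nonneg (by linarith [h.one_le_C]) h.L_nonneg)

theorem Λ_pos (h : Admissible L R C κ Λ) : 0 < Λ :=
  lt_of_lt_of_le (by have := h.C_pos; positivity) h.Λ_lip

theorem exp_le (h : Admissible L R C κ Λ) {x : ℝ} (hx : x ∈ Icc 0 L) :
    Real.exp (2 * C * x) ≤ Real.exp (2 * C * L) :=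
  Real.exp_le_exp.2 (mul_le_mul_of_nonneg_left hx.2 (by linarith [h.one_le_C]))

theorem weight_le (h : Admissible L R C κ Λ) {x : ℝ} (hx : x ∈ Icc 0 L) :
    κ * Real.exp (Λ * x) ≤ R :=
  (mul_le_mul_of_nonneg_left (Real.exp_le_exp.2
    (mul_le_mul_of_nonneg_left hx.2 h.Λ_pos.le)) h.κ_nonneg).trans h.κ_le

end Admissible

/-! ### Fields and sources frozen along a profile -/

section

variable {L R C P κ Λ M κ₀ M₀ : ℝ} {μ f : ι → ℝ → (ι → ℝ) → ℝ} {g : ι → ℝ → ℝ}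
  {v v' : ι → ℝ → ℝ → ℝ}

theorem IsProfile.mem_ball (hv : IsProfile L P C κ Λ M v) (hA : Admissible L R C κ Λ)
    {x : ℝ} (hx : x ∈ Icc 0 L) (t : ℝ) (j : ι) : |v j t x| ≤ R :=
  (hv.bound j t x hx).trans (hA.weight_le hx)

/-- The normalization `R ≤ 1` turns the small Lipschitz constant into `1`, as `QuotientHolder`
requires of its arguments. -/
theorem IsProfile.lip_time_one (hv : IsProfile L P C κ Λ M v) (hA : Admissible L R C κ Λ)
    {x : ℝ} (hx : x ∈ Icc 0 L) (t t' : ℝ) (j : ι) : |v j t x - v j t' x| ≤ |t - t'| := by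
  refine (hv.lip_time j t t' x hx).trans ?_
  have := (hA.weight_le hx).trans hA.R_le
  nlinarith [abs_nonneg (t - t')]

theorem IsProfile.comp_lip (hv : IsProfile L P C κ Λ M v) (hA : Admissible L R C κ Λ)
    {G : ℝ → (ι → ℝ) → ℝ} (hG : LipBall R C G) {s s' : ℝ} (hs : s ∈ Icc 0 L)
    (hs' : s' ∈ Icc 0 L) (t t' : ℝ) :
    |G t (fun j => v j t s) - G t' (fun j => v j t' s')|
      ≤ 2 * C * |t - t'| + 2 * C * C * |s - s'| := by
  have hC := hA.C_pos
  refine (hG t t' _ _ (|t - t'| + 2 * C * |s - s'|) (hv.mem_ball hA hs t)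
    (hv.mem_ball hA hs' t') (by positivity) fun j => ?_).trans (le_of_eq (by ring))
  have h1 := hv.lip_time_one hA hs t t' j
  have h2 := hv.lip_space j t' s hs s' hs'
  exact (abs_sub_le _ (v j t' s) _).trans (add_le_add h1 h2)

theorem IsSystem.source_lipBall (hS : IsSystem R C P μ f) (hA : Admissible L R C κ Λ) (i : ι) :
    LipBall R C (f i) := by
  intro t t' y y' w hy hy' hw hyy'
  have hC := hA.C_pos
  have hR : 0 ≤ R := (mul_nonneg hA.κ_nonneg (Real.exp_pos _).le).trans hA.κ_le
  refine (hS.source_lip i t t' y y' R w hy hy' hy hy' hR hw hyy').trans ?_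
  have : R * |t - t'| ≤ 1 * |t - t'| := mul_le_mul_of_nonneg_right hA.R_le (abs_nonneg _)
  nlinarith

theorem IsProfile.field_lip (hv : IsProfile L P C κ Λ M v) (hA : Admissible L R C κ Λ)
    (hS : IsSystem R C P μ f) (i : ι) (t t' : ℝ) {s : ℝ} (hs : s ∈ Icc 0 L) :
    |field μ v i t s - field μ v i t' s| ≤ 2 * C * |t - t'| := by
  simpa [field] using hv.comp_lip hA (hS.slowness_lip i) hs hs t t'

theorem IsProfile.field_nonneg (hv : IsProfile L P C κ Λ M v) (hA : Admissible L R C κ Λ)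
    (hS : IsSystem R C P μ f) (i : ι) (t : ℝ) {s : ℝ} (hs : s ∈ Icc 0 L) :
    0 ≤ field μ v i t s := hS.slowness_nonneg i t _ (hv.mem_ball hA hs t)

theorem IsProfile.field_le (hv : IsProfile L P C κ Λ M v) (hA : Admissible L R C κ Λ)
    (hS : IsSystem R C P μ f) (i : ι) (t : ℝ) {s : ℝ} (hs : s ∈ Icc 0 L) :
    |field μ v i t s| ≤ C := by
  rw [abs_of_nonneg (hv.field_nonneg hA hS i t hs)]
  exact hS.slowness_le i t _ (hv.mem_ball hA hs t)

theorem IsProfile.exists_char (hv : IsProfile L P C κ Λ M v) (hA : Admissible L R C κ Λ)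
    (hS : IsSystem R C P μ f) (i : ι) (t : ℝ) {x : ℝ} (hx : x ∈ Icc 0 L) :
    ∃ τ : ℝ → ℝ, τ x = t ∧ IsChar (field μ v i) L τ := by
  have hC := hA.C_pos
  refine exists_isChar (C := C) (A := 2 * C) hC.le (by positivity)
    (fun t s hs => hv.field_le hA hS i t hs) (fun t t' s hs => hv.field_lip hA hS i t t' hs)
    (fun t => ?_) hx t
  refine LipschitzOnWith.continuousOn (K := Real.toNNReal (2 * C * C))
    (LipschitzOnWith.of_dist_le_mul fun s hs s' hs' => ?_)
  have := hv.comp_lip hA (hS.slowness_lip i) hs hs' t t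
  rw [Real.dist_eq, Real.dist_eq, Real.coe_toNNReal _ (by positivity)]
  simpa [field] using this

/-- A source evaluated along a characteristic is continuous. -/
theorem IsProfile.continuousOn_source (hv : IsProfile L P C κ Λ M v) (hA : Admissible L R C κ Λ)
    {G : ℝ → (ι → ℝ) → ℝ} (hG : LipBall R C G) {x : ℝ} (hx : x ∈ Icc 0 L) {τ : ℝ → ℝ}
    (hτ : ContinuousOn τ (Icc 0 x)) :
    ContinuousOn (fun s => G (τ s) (fun j => v j (τ s) s)) (Icc 0 x) := by
  have hC := hA.C_pos
  intro s hs
  have hsub : Icc 0 x ⊆ Icc 0 L := Icc_subset_Icc_right hx.2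
  rw [ContinuousWithinAt, tendsto_iff_dist_tendsto_zero]
  have h1 : Tendsto (fun r => 2 * C * |τ r - τ s| + 2 * C * C * |r - s|) (𝓝[Icc 0 x] s) (𝓝 0) := by
    have e1 : Tendsto (fun r => |τ r - τ s|) (𝓝[Icc 0 x] s) (𝓝 0) :=
      tendsto_iff_dist_tendsto_zero.1 (hτ s hs)
    have e2 : Tendsto (fun r => |r - s|) (𝓝[Icc 0 x] s) (𝓝 0) :=
      tendsto_iff_dist_tendsto_zero.1 (continuousWithinAt_id (s := Icc 0 x) (x := s))
    simpa using (e1.const_mul (2 * C)).add (e2.const_mul (2 * C * C))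
  refine squeeze_zero' (Eventually.of_forall fun _ => dist_nonneg) ?_ h1
  filter_upwards [self_mem_nhdsWithin] with r hr
  exact hv.comp_lip hA hG (hsub hr) (hsub hs) (τ r) (τ s)

open Classical in
/-- One step of the iteration: solve the linear transport equations with speeds and sources
frozen along `v`. -/
def step (L : ℝ) (μ f : ι → ℝ → (ι → ℝ) → ℝ) (g : ι → ℝ → ℝ) (v : ι → ℝ → ℝ → ℝ) :
    ι → ℝ → ℝ → ℝ := fun i t x =>
  if h : ∃ τ : ℝ → ℝ, τ x = t ∧ IsChar (field μ v i) L τ then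
    g i (h.choose 0) + ∫ s in (0 : ℝ)..x, f i (h.choose s) (fun j => v j (h.choose s) s)
  -- Never reached for a profile and `x` in `[0, L]`, by `IsProfile.exists_char`.
  else 0

/-- Characteristics are unique, so the chosen one may be replaced by any other, and a curve defined
only on `[0, x]` suffices. -/
theorem IsProfile.step_eq (hv : IsProfile L P C κ Λ M v) (hA : Admissible L R C κ Λ)
    (hS : IsSystem R C P μ f) (i : ι) {x : ℝ} (hx : x ∈ Icc 0 L) {τ : ℝ → ℝ}
    (hτ : IsChar (field μ v i) x τ) :
    step L μ f g v i (τ x) x =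
      g i (τ 0) + ∫ s in (0 : ℝ)..x, f i (τ s) (fun j => v j (τ s) s) := by
  have h := hv.exists_char hA hS i (τ x) hx
  have hC := hA.C_pos
  have hsub : Icc 0 x ⊆ Icc 0 L := Icc_subset_Icc_right hx.2
  have heq : EqOn h.choose τ (Icc 0 x) :=
    (h.choose_spec.2.mono hx.2).eqOn hτ (A := 2 * C) (by positivity)
      (fun t t' s hs => hv.field_lip hA hS i t t' (hsub hs)) h.choose_spec.1
  rw [step, dif_pos h, heq ⟨le_rfl, hx.1⟩]
  congr 1
  refine intervalIntegral.integral_congr fun s hs => ?_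
  rw [uIcc_of_le hx.1] at hs
  simp only [heq hs]

end

end EulerSource
end

noncomputable section
namespace EulerSource
open Filter Topology

variable {ι : Type*}

section

variable {L R C P κ Λ M κ₀ M₀ : ℝ} {μ f : ι → ℝ → (ι → ℝ) → ℝ} {g : ι → ℝ → ℝ}
  {v v' : ι → ℝ → ℝ → ℝ}

/-! ### Invariance and contraction of one iteration step -/

theorem IsProfile.source_le (hv : IsProfile L P C κ Λ M v) (hA : Admissible L R C κ Λ)
    (hS : IsSystem R C P μ f) (i : ι) (t : ℝ) {s : ℝ} (hs : s ∈ Icc 0 L) :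
    |f i t (fun j => v j t s)| ≤ C * κ * Real.exp (Λ * s) := by
  rw [mul_assoc]
  exact hS.source_le i t _ _ (hv.mem_ball hA hs t)
    (mul_nonneg hA.κ_nonneg (Real.exp_pos _).le) (fun j => hv.bound j t s hs)

/-- The factor `κ` survives because the explicit time dependence of the source is weighted by the
size of its argument in `source_lip`. This keeps the time Lipschitz constant of the iterates linear
in the data. -/
theorem IsProfile.source_dist_le (hv : IsProfile L P C κ Λ M v) (hA : Admissible L R C κ Λ)
    (hS : IsSystem R C P μ f) (i : ι) (t t' : ℝ) {s : ℝ} (hs : s ∈ Icc 0 L) :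
    |f i t (fun j => v j t s) - f i t' (fun j => v j t' s)|
      ≤ 2 * C * κ * Real.exp (Λ * s) * |t - t'| := by
  have h0 : 0 ≤ κ * Real.exp (Λ * s) := mul_nonneg hA.κ_nonneg (Real.exp_pos _).le
  refine (hS.source_lip i t t' _ _ (κ * Real.exp (Λ * s)) (κ * Real.exp (Λ * s) * |t - t'|)
    (hv.mem_ball hA hs t) (hv.mem_ball hA hs t') (fun j => hv.bound j t s hs)
    (fun j => hv.bound j t' s hs) h0 (mul_nonneg h0 (abs_nonneg _))
    (fun j => hv.lip_time j t t' s hs)).trans (le_of_eq (by ring))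

theorem IsProfile.char_dist_le (hv : IsProfile L P C κ Λ M v) (hA : Admissible L R C κ Λ)
    (hS : IsSystem R C P μ f) {i : ι} {x : ℝ} (hx : x ∈ Icc 0 L) {τ σ : ℝ → ℝ}
    (hτ : IsChar (field μ v i) x τ) (hσ : IsChar (field μ v i) x σ) {s : ℝ} (hs : s ∈ Icc 0 x) :
    |τ s - σ s| ≤ Real.exp (2 * C * L) * |τ x - σ x| := by
  have hC := hA.C_pos
  refine (hτ.dist_le hσ (A := 2 * C) (by positivity) (fun t t' s hs =>
    hv.field_lip hA hS i t t' ⟨hs.1, hs.2.trans hx.2⟩) s hs).trans ?_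
  exact mul_le_mul_of_nonneg_right (hA.exp_le hx) (abs_nonneg _)

theorem IsProfile.intervalIntegrable_source (hv : IsProfile L P C κ Λ M v)
    (hA : Admissible L R C κ Λ) (hS : IsSystem R C P μ f) (i : ι) {x : ℝ} (hx : x ∈ Icc 0 L)
    {τ : ℝ → ℝ} (hτ : ContinuousOn τ (Icc 0 x)) :
    IntervalIntegrable (fun s => f i (τ s) (fun j => v j (τ s) s)) volume 0 x := by
  refine ContinuousOn.intervalIntegrable ?_
  rw [uIcc_of_le hx.1]
  exact hv.continuousOn_source hA (hS.source_lipBall hA i) hx hτ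

theorem IsProfile.step_bound (hv : IsProfile L P C κ Λ M v) (hA : Admissible L R C κ Λ)
    (hS : IsSystem R C P μ f) (hg : IsDatum P κ₀ M₀ g)
    (hκ : 2 * Real.exp (2 * C * L) * κ₀ ≤ κ) (i : ι) (t : ℝ) {x : ℝ} (hx : x ∈ Icc 0 L) :
    |step L μ f g v i t x| ≤ κ * Real.exp (Λ * x) := by
  obtain ⟨τ, rfl, hτ⟩ := hv.exists_char hA hS i t hx
  have hC := hA.C_pos
  have hΛ := hA.Λ_pos
  have hκ0 := hA.κ_nonneg
  rw [hv.step_eq hA hS i hx (hτ.mono hx.2)]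
  have h1 := abs_integral_le_exp (K₁ := C * κ) (K₂ := 0) (Λ := Λ) hx.1 (by positivity) hΛ
    (fun s hs => by
      simpa using hv.source_le hA hS i (τ s) (Icc_subset_Icc_right hx.2 hs))
  have h2 := hg.bound i (τ 0)
  have hE := hA.one_le_exp
  have h3 : 1 ≤ Real.exp (Λ * x) := Real.one_le_exp (mul_nonneg hΛ.le hx.1)
  -- The budget `κ` is split in halves: one for the source, by the size of `Λ`, and one for the
  -- datum.
  have h4 : C * κ / Λ ≤ κ / 2 := by
    rw [div_le_div_iff₀ hΛ two_pos]
    have : 4 * C ≤ Λ := le_trans (by nlinarith) hA.Λ_lip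
    nlinarith
  have h5 : κ₀ ≤ κ / 2 := by
    have : 0 ≤ κ₀ := (abs_nonneg _).trans h2
    nlinarith
  have h6 : C * κ / Λ * Real.exp (Λ * x) ≤ κ / 2 * Real.exp (Λ * x) :=
    mul_le_mul_of_nonneg_right h4 (by positivity)
  refine (abs_add_le _ _).trans ?_
  nlinarith

/-- Two characteristics of the same field spread by at most `E = e^{2CL}`. The datum then costs `κ₀
E ≤ κ/2` and the source `2CκE/Λ ≤ κ/2`, which is what `Λ_lip` is for. -/
theorem IsProfile.step_lip_time (hv : IsProfile L P C κ Λ M v) (hA : Admissible L R C κ Λ)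
    (hS : IsSystem R C P μ f) (hg : IsDatum P κ₀ M₀ g)
    (hκ : 2 * Real.exp (2 * C * L) * κ₀ ≤ κ) (i : ι) (t t' : ℝ) {x : ℝ} (hx : x ∈ Icc 0 L) :
    |step L μ f g v i t x - step L μ f g v i t' x| ≤ κ * Real.exp (Λ * x) * |t - t'| := by
  obtain ⟨τ, rfl, hτ⟩ := hv.exists_char hA hS i t hx
  obtain ⟨σ, rfl, hσ⟩ := hv.exists_char hA hS i t' hx
  replace hτ := hτ.mono hx.2
  replace hσ := hσ.mono hx.2
  have hC := hA.C_pos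
  have hΛ := hA.Λ_pos
  have hκ0 := hA.κ_nonneg
  have hE := hA.one_le_exp
  set E := Real.exp (2 * C * L) with hEdef
  rw [hv.step_eq hA hS i hx hτ, hv.step_eq hA hS i hx hσ, add_sub_add_comm,
    ← intervalIntegral.integral_sub (hv.intervalIntegrable_source hA hS i hx hτ.continuousOn)
      (hv.intervalIntegrable_source hA hS i hx hσ.continuousOn)]
  have h1 := abs_integral_le_exp (K₁ := 2 * C * κ * E * |τ x - σ x|) (K₂ := 0) (Λ := Λ)
    (h := fun s => f i (τ s) (fun j => v j (τ s) s) - f i (σ s) (fun j => v j (σ s) s))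
    hx.1 (by positivity) hΛ
    (fun s hs => by
      refine (hv.source_dist_le hA hS i (τ s) (σ s) (Icc_subset_Icc_right hx.2 hs)).trans ?_
      have := mul_le_mul_of_nonneg_left (hv.char_dist_le hA hS hx hτ hσ hs)
        (show 0 ≤ 2 * C * κ * Real.exp (Λ * s) by positivity)
      refine this.trans (le_of_eq ?_)
      ring)
  have h2 := hg.lip i (τ 0) (σ 0)
  have hκ₀ : 0 ≤ κ₀ := (abs_nonneg _).trans (hg.bound i 0)
  have h2' : κ₀ * |τ 0 - σ 0| ≤ κ₀ * (E * |τ x - σ x|) :=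
    mul_le_mul_of_nonneg_left (hv.char_dist_le hA hS hx hτ hσ ⟨le_rfl, hx.1⟩) hκ₀
  have h3 : 1 ≤ Real.exp (Λ * x) := Real.one_le_exp (mul_nonneg hΛ.le hx.1)
  have h4 : 2 * C * κ * E * |τ x - σ x| / Λ ≤ κ / 2 * |τ x - σ x| := by
    rw [div_le_iff₀ hΛ]
    have h0 : 0 ≤ κ * |τ x - σ x| := by positivity
    have : 4 * C * E * (κ * |τ x - σ x|) ≤ Λ * (κ * |τ x - σ x|) :=
      mul_le_mul_of_nonneg_right hA.Λ_lip h0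
    linarith
  have h5 : κ₀ * (E * |τ x - σ x|) ≤ κ / 2 * |τ x - σ x| * Real.exp (Λ * x) := by
    have e1 : κ₀ * E ≤ κ / 2 := by linarith
    have e2 := mul_le_mul_of_nonneg_right e1 (abs_nonneg (τ x - σ x))
    have e3 : κ / 2 * |τ x - σ x| ≤ κ / 2 * |τ x - σ x| * Real.exp (Λ * x) :=
      le_mul_of_one_le_right (by positivity) h3
    linarith
  have h6 := mul_le_mul_of_nonneg_right h4 (Real.exp_pos (Λ * x)).le
  refine (abs_add_le _ _).trans ?_
  linarith

/-- Go from `(t, x')` along its characteristic to abscissa `x`, then move in time at fixed `x`. Each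
leg costs `C |x - x'|`: the first by the bound on the source, the second by the bound on the
slowness. -/
theorem IsProfile.step_lip_space (hv : IsProfile L P C κ Λ M v) (hA : Admissible L R C κ Λ)
    (hS : IsSystem R C P μ f) (hg : IsDatum P κ₀ M₀ g)
    (hκ : 2 * Real.exp (2 * C * L) * κ₀ ≤ κ) (i : ι) (t : ℝ) {x x' : ℝ} (hx : x ∈ Icc 0 L)
    (hx' : x' ∈ Icc 0 L) :
    |step L μ f g v i t x - step L μ f g v i t x'| ≤ 2 * C * |x - x'| := by
  obtain ⟨τ, rfl, hτ⟩ := hv.exists_char hA hS i t hx'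
  have hC := hA.C_pos
  have hL : L ∈ Icc 0 L := ⟨hA.L_nonneg, le_rfl⟩
  have h1 : |step L μ f g v i (τ x') x - step L μ f g v i (τ x) x| ≤ C * |x - x'| := by
    refine (hv.step_lip_time hA hS hg hκ i (τ x') (τ x) hx).trans ?_
    have e1 := hτ.lipschitz (fun s hs => hv.field_le hA hS i (τ s) hs) hx' hx
    have e2 := (hA.weight_le hx).trans hA.R_le
    rw [abs_sub_comm x' x] at e1
    nlinarith [abs_nonneg (τ x' - τ x)]
  have hii := hv.intervalIntegrable_source hA hS i hL hτ.continuousOn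
  have hsub : ∀ y ∈ Icc 0 L, uIcc 0 y ⊆ uIcc 0 L := fun y hy => by
    rw [uIcc_of_le hy.1, uIcc_of_le hA.L_nonneg]; exact Icc_subset_Icc_right hy.2
  have h2 : |step L μ f g v i (τ x) x - step L μ f g v i (τ x') x'| ≤ C * |x - x'| := by
    rw [hv.step_eq hA hS i hx (hτ.mono hx.2), hv.step_eq hA hS i hx' (hτ.mono hx'.2),
      add_sub_add_left_eq_sub, intervalIntegral.integral_interval_sub_left
        (hii.mono_set (hsub x hx)) (hii.mono_set (hsub x' hx'))]
    rw [← Real.norm_eq_abs]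
    refine intervalIntegral.norm_integral_le_of_norm_le_const fun s hs => ?_
    have hs' : s ∈ Icc 0 L := by
      have h3 := uIoc_subset_uIcc hs
      exact ((convex_Icc 0 L).ordConnected.uIcc_subset hx' hx) h3
    refine (hv.source_le hA hS i (τ s) hs').trans ?_
    have := (hA.weight_le hs').trans hA.R_le
    nlinarith
  have h3 := abs_sub_le (step L μ f g v i (τ x') x) (step L μ f g v i (τ x) x)
    (step L μ f g v i (τ x') x')
  linarith

/-- Nonnegative slowness keeps the backward characteristic in `t ≤ 0`, where datum and source
vanish. -/
theorem IsProfile.step_rest (hv : IsProfile L P C κ Λ M v) (hA : Admissible L R C κ Λ)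
    (hS : IsSystem R C P μ f) (hg : IsDatum P κ₀ M₀ g) (i : ι) {t : ℝ} {x : ℝ}
    (hx : x ∈ Icc 0 L) (ht : t ≤ 0) : step L μ f g v i t x = 0 := by
  obtain ⟨τ, rfl, hτ⟩ := hv.exists_char hA hS i t hx
  replace hτ := hτ.mono hx.2
  have hle : ∀ s ∈ Icc 0 x, τ s ≤ 0 := fun s hs =>
    (hτ.le_of_nonneg (fun s hs => hv.field_nonneg hA hS i (τ s)
      (Icc_subset_Icc_right hx.2 hs)) hs).trans ht
  rw [hv.step_eq hA hS i hx hτ, hg.rest i _ (hle 0 ⟨le_rfl, hx.1⟩), zero_add]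
  rw [intervalIntegral.integral_congr (g := fun _ => (0 : ℝ)), intervalIntegral.integral_zero]
  intro s hs
  rw [uIcc_of_le hx.1] at hs
  have hs' := Icc_subset_Icc_right hx.2 hs
  have := hS.source_le i (τ s) (fun j => v j (τ s) s) 0 (hv.mem_ball hA hs' _) le_rfl
    (fun j => by simp [hv.rest j (τ s) s hs' (hle s hs)])
  simpa using this

/-- A slowness at most `C` keeps the backward characteristic inside the region `t > C s`, where the
previous iterate is already periodic. Its translate by `P` is therefore again a characteristic, with
foot at a positive time. -/
theorem IsProfile.step_periodic (hv : IsProfile L P C κ Λ M v) (hA : Admissible L R C κ Λ)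
    (hS : IsSystem R C P μ f) (hg : IsDatum P κ₀ M₀ g) (i : ι) {t : ℝ} {x : ℝ}
    (hx : x ∈ Icc 0 L) (ht : C * x < t) :
    step L μ f g v i (t + P) x = step L μ f g v i t x := by
  obtain ⟨τ, rfl, hτ⟩ := hv.exists_char hA hS i t hx
  replace hτ := hτ.mono hx.2
  have hsub : Icc 0 x ⊆ Icc 0 L := Icc_subset_Icc_right hx.2
  have hlt : ∀ s ∈ Icc 0 x, C * s < τ s := fun s hs => by
    have h1 := hτ.lipschitz (fun s hs => hv.field_le hA hS i (τ s) (hsub hs)) hs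
      (right_mem_Icc.2 hx.1)
    rw [abs_sub_comm s x, abs_of_nonneg (sub_nonneg.2 hs.2)] at h1
    have := (abs_le.1 h1).1
    linarith
  have hper : ∀ s ∈ Icc 0 x, (fun j => v j (τ s + P) s) = fun j => v j (τ s) s := fun s hs =>
    funext fun j => hv.periodic j (τ s) s (hsub hs) (hlt s hs)
  have hτP : IsChar (field μ v i) x (fun s => τ s + P) := by
    intro s hs
    have : field μ v i (τ s + P) s = field μ v i (τ s) s := by
      simp only [field, hper s hs, hS.slowness_periodic]
    rw [this]
    exact (hτ s hs).add_const P
  have h0 := hlt 0 ⟨le_rfl, hx.1⟩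
  rw [mul_zero] at h0
  have := hv.step_eq (g := g) hA hS i hx hτP
  rw [this, hv.step_eq hA hS i hx hτ, hg.periodic i _ h0]
  congr 1
  refine intervalIntegral.integral_congr fun s hs => ?_
  rw [uIcc_of_le hx.1] at hs
  simp only [hper s hs, hS.source_periodic]

theorem IsProfile.quotientHolder_along (hv : IsProfile L P C κ Λ M v)
    (hA : Admissible L R C κ Λ) (hM : 2 ≤ M)
    {G : ℝ → (ι → ℝ) → ℝ} (hG : QuotientHolder R C G) {s : ℝ} (hs : s ∈ Icc 0 L)
    {a b c d E r : ℝ} (hab : a ≠ b) (hcd : c ≠ d) (hE : 1 ≤ E) (hr : 0 ≤ r)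
    (hac : |a - c| ≤ E * r) (hbd : |b - d| ≤ E * r) :
    |(G a (fun j => v j a s) - G b (fun j => v j b s)) / (a - b)
      - (G c (fun j => v j c s) - G d (fun j => v j d s)) / (c - d)|
      ≤ C * (M * E * Real.exp (Λ * s) * √r) := by
  have hex : 1 ≤ Real.exp (Λ * s) := Real.one_le_exp (mul_nonneg hA.Λ_pos.le hs.1)
  -- One `w` has to serve all closeness conditions of `QuotientHolder`. The bound on quotients of
  -- `v` dictates its form, and `M ≥ 2` makes it at least `2E√r`, enough for the others.
  set w := M * E * Real.exp (Λ * s) * √r with hw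
  have hw0 : 0 ≤ w := by positivity
  have hK : 2 * E ≤ M * E * Real.exp (Λ * s) := by
    have h1 : 2 * E ≤ M * E := mul_le_mul_of_nonneg_right hM (by linarith)
    exact h1.trans (le_mul_of_one_le_right (by positivity) hex)
  have hw2E : 2 * E * √r ≤ w := mul_le_mul_of_nonneg_right hK (Real.sqrt_nonneg _)
  have hsq : (√r) ^ 2 = r := Real.sq_sqrt hr
  have hsr : 0 ≤ √r := Real.sqrt_nonneg _
  have hw2 : E * r ≤ w ^ 2 := by
    have h1 : (2 * E * √r) ^ 2 ≤ w ^ 2 := pow_le_pow_left₀ (by positivity) hw2E 2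
    have h2 : (2 * E * √r) ^ 2 = 4 * E ^ 2 * r := by rw [mul_pow, hsq]; ring
    have h3 : E * r ≤ 4 * E ^ 2 * r := mul_le_mul_of_nonneg_right (by nlinarith) hr
    linarith
  have hclose : ∀ p q : ℝ, |p - q| ≤ E * r → ∀ j, |v j p s - v j q s| ≤ w := by
    intro p q hpq j
    have h1 := hv.lip_time_one hA hs p q j
    have h2 := (abs_sub _ _).trans (add_le_add (hv.mem_ball hA hs p j) (hv.mem_ball hA hs q j))
    have hR := hA.R_le
    refine le_trans ?_ hw2E
    -- For small `r` the Lipschitz bound is enough because `r ≤ √r`; for large `r` the difference is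
    -- at most `2R ≤ 2`.
    by_cases hs1 : √r ≤ 1
    · have : r ≤ √r := by nlinarith
      have h3 : E * r ≤ E * √r := mul_le_mul_of_nonneg_left this (by linarith)
      nlinarith
    · have : 1 * 1 ≤ E * √r := mul_le_mul hE (by linarith) zero_le_one (by linarith)
      linarith
  refine hG a b c d _ _ _ _ w hab hcd hw0 (hv.mem_ball hA hs a) (hv.mem_ball hA hs b)
    (hv.mem_ball hA hs c) (hv.mem_ball hA hs d) (hac.trans hw2) (hbd.trans hw2)
    (hclose a c hac) (hclose b d hbd) (hv.lip_time_one hA hs a b) (hv.lip_time_one hA hs c d)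
    (fun j => ?_)
  refine (hv.quot j s hs a b c d (E * r) hab hcd hac hbd).trans ?_
  have h1 : √(E * r) ≤ E * √r := by
    rw [Real.sqrt_mul (by linarith)]
    exact mul_le_mul_of_nonneg_right (Real.sqrt_le_iff.2 ⟨by linarith, by nlinarith⟩) hsr
  refine (mul_le_mul_of_nonneg_left h1 (by positivity)).trans (le_of_eq ?_)
  rw [hw]; ring

/-- Every quotient over the gap at `x` factors as the quotient over the gap at `s` times the ratio
of gaps, and both factors are Hölder-`1/2` in the endpoints. The datum uses half of `M`; every other
term is proportional to `M/Λ`. Hence `Λ_quot` does not involve `M`, and `M` can be as large as the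
datum demands. -/
theorem IsProfile.step_quot (hv : IsProfile L P C κ Λ M v) (hA : Admissible L R C κ Λ)
    (hS : IsSystem R C P μ f) (hg : IsDatum P κ₀ M₀ g)
    (hκ : 2 * Real.exp (2 * C * L) * κ₀ ≤ κ) (hM : 2 ≤ M)
    (hM₀ : 2 * Real.exp (2 * C * L) ^ 2 * M₀ ≤ M) (i : ι) {x : ℝ} (hx : x ∈ Icc 0 L)
    {a b c d r : ℝ} (hab : a ≠ b) (hcd : c ≠ d) (hac : |a - c| ≤ r) (hbd : |b - d| ≤ r) :
    |(step L μ f g v i a x - step L μ f g v i b x) / (a - b)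
      - (step L μ f g v i c x - step L μ f g v i d x) / (c - d)|
      ≤ M * Real.exp (Λ * x) * √r := by
  obtain ⟨τa, rfl, ha⟩ := hv.exists_char hA hS i a hx
  obtain ⟨τb, rfl, hb⟩ := hv.exists_char hA hS i b hx
  obtain ⟨τc, rfl, hc⟩ := hv.exists_char hA hS i c hx
  obtain ⟨τd, rfl, hd⟩ := hv.exists_char hA hS i d hx
  replace ha := ha.mono hx.2
  replace hb := hb.mono hx.2
  replace hc := hc.mono hx.2
  replace hd := hd.mono hx.2
  have hC := hA.C_pos
  have hΛ := hA.Λ_pos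
  have hE := hA.one_le_exp
  have hκ0 := hA.κ_nonneg
  have hL := hA.L_nonneg
  have hr : 0 ≤ r := (abs_nonneg _).trans hac
  set E := Real.exp (2 * C * L) with hEdef
  have hsub : Icc 0 x ⊆ Icc 0 L := Icc_subset_Icc_right hx.2
  have hlip : ∀ t t', ∀ s ∈ Icc 0 x,
      |field μ v i t s - field μ v i t' s| ≤ 2 * C * |t - t'| :=
    fun t t' s hs => hv.field_lip hA hS i t t' (hsub hs)
  have h2C : 0 ≤ 2 * C := by positivity
  have nab : ∀ s ∈ Icc 0 x, τa s ≠ τb s := fun s hs => ha.ne hb h2C hlip hab hs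
  have ncd : ∀ s ∈ Icc 0 x, τc s ≠ τd s := fun s hs => hc.ne hd h2C hlip hcd hs
  have hacs : ∀ s ∈ Icc 0 x, |τa s - τc s| ≤ E * r := fun s hs =>
    (hv.char_dist_le hA hS hx ha hc hs).trans (mul_le_mul_of_nonneg_left hac (by linarith))
  have hbds : ∀ s ∈ Icc 0 x, |τb s - τd s| ≤ E * r := fun s hs =>
    (hv.char_dist_le hA hS hx hb hd hs).trans (mul_le_mul_of_nonneg_left hbd (by linarith))
  set ab := τa x - τb x with hab_def
  set cd := τc x - τd x with hcd_def
  have hab0 : ab ≠ 0 := sub_ne_zero.2 hab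
  have hcd0 : cd ≠ 0 := sub_ne_zero.2 hcd
  have hΔ : ∀ s ∈ Icc 0 x, |(τa s - τb s) / ab| ≤ E := fun s hs => by
    rw [abs_div, div_le_iff₀ (abs_pos.2 hab0)]
    exact hv.char_dist_le hA hS hx ha hb hs
  have hΔΔ : ∀ s ∈ Icc 0 x, |(τa s - τb s) / ab - (τc s - τd s) / cd|
      ≤ C * M * E ^ 3 * √r / Λ * Real.exp (Λ * x) := by
    intro s hs
    refine (ha.quotient_dist_le hb hc hd h2C (B := C * (M * E * √r)) (by positivity) hΛ hlip
      hab hcd (fun s hs => ?_) s hs).trans ?_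
    · refine (hv.quotientHolder_along hA hM (hS.slowness_quot i) (hsub hs) (nab s hs) (ncd s hs)
        hE hr (hacs s hs) (hbds s hs)).trans (le_of_eq (by ring))
    · have e1 := hA.exp_le hx
      have e2 : 0 < Real.exp (2 * C * x) := Real.exp_pos _
      calc Real.exp (2 * C * x) * (C * (M * E * √r) * Real.exp (2 * C * x) / Λ * Real.exp (Λ * x))
          ≤ E * (C * (M * E * √r) * E / Λ * Real.exp (Λ * x)) := by gcongr
        _ = _ := by ring
  set W := C * M * E ^ 3 * √r / Λ * Real.exp (Λ * x) with hW
  have hW0 : 0 ≤ W := by positivity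
  have h0x : (0 : ℝ) ∈ Icc 0 x := ⟨le_rfl, hx.1⟩
  have hκ₀0 : 0 ≤ κ₀ := (abs_nonneg _).trans (hg.bound i 0)
  have hκ₀1 : κ₀ ≤ 1 := by
    have e1 := (hA.weight_le (x := 0) ⟨le_rfl, hL⟩).trans hA.R_le
    rw [mul_zero, Real.exp_zero, mul_one] at e1
    nlinarith
  have hdat : |(g i (τa 0) - g i (τb 0)) / ab - (g i (τc 0) - g i (τd 0)) / cd|
      ≤ M₀ * (E * √r) * E + 1 * W := by
    have e1 := nab 0 h0x
    have e2 := ncd 0 h0x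
    have q1 : (g i (τa 0) - g i (τb 0)) / ab
        = (g i (τa 0) - g i (τb 0)) / (τa 0 - τb 0) * ((τa 0 - τb 0) / ab) := by
      have := sub_ne_zero.2 e1; field_simp
    have q2 : (g i (τc 0) - g i (τd 0)) / cd
        = (g i (τc 0) - g i (τd 0)) / (τc 0 - τd 0) * ((τc 0 - τd 0) / cd) := by
      have := sub_ne_zero.2 e2; field_simp
    have hM₀0 : 0 ≤ M₀ := by
      have := (abs_nonneg _).trans (hg.quot i 1 0 1 0 1 one_ne_zero one_ne_zero (by simp) (by simp))
      simpa using this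
    rw [q1, q2]
    refine abs_mul_sub_mul_le ?_ (hΔ 0 h0x) ?_ (hΔΔ 0 h0x)
    · refine (hg.quot i _ _ _ _ (E * r) e1 e2 (hacs 0 h0x) (hbds 0 h0x)).trans ?_
      refine mul_le_mul_of_nonneg_left ?_ hM₀0
      rw [Real.sqrt_mul (by linarith)]
      exact mul_le_mul_of_nonneg_right (Real.sqrt_le_iff.2 ⟨by linarith, by nlinarith⟩) (Real.sqrt_nonneg _)
    · rw [abs_div, div_le_iff₀ (abs_pos.2 (sub_ne_zero.2 e2))]
      refine (hg.lip i _ _).trans (mul_le_mul_of_nonneg_right hκ₀1 (abs_nonneg _))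
  have hsrc := abs_integral_le_exp (K₁ := C * (M * E * √r) * E) (K₂ := 2 * C * W) (Λ := Λ)
    (h := fun s => (f i (τa s) (fun j => v j (τa s) s) - f i (τb s) (fun j => v j (τb s) s)) / ab
      - (f i (τc s) (fun j => v j (τc s) s) - f i (τd s) (fun j => v j (τd s) s)) / cd)
    hx.1 (by positivity) hΛ (fun s hs => by
      have e1 := sub_ne_zero.2 (nab s hs)
      have e2 := sub_ne_zero.2 (ncd s hs)
      have q1 : (f i (τa s) (fun j => v j (τa s) s) - f i (τb s) (fun j => v j (τb s) s)) / ab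
        = (f i (τa s) (fun j => v j (τa s) s) - f i (τb s) (fun j => v j (τb s) s))
          / (τa s - τb s) * ((τa s - τb s) / ab) := by field_simp
      have q2 : (f i (τc s) (fun j => v j (τc s) s) - f i (τd s) (fun j => v j (τd s) s)) / cd
        = (f i (τc s) (fun j => v j (τc s) s) - f i (τd s) (fun j => v j (τd s) s))
          / (τc s - τd s) * ((τc s - τd s) / cd) := by field_simp
      rw [q1, q2]
      refine (abs_mul_sub_mul_le (hv.quotientHolder_along hA hM (hS.source_quot i) (hsub hs)
        (nab s hs) (ncd s hs) hE hr (hacs s hs) (hbds s hs)) (hΔ s hs) (r := 2 * C) ?_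
        (hΔΔ s hs)).trans (le_of_eq (by ring))
      rw [abs_div, div_le_iff₀ (abs_pos.2 e2)]
      simpa using hv.comp_lip hA (hS.source_lipBall hA i) (hsub hs) (hsub hs) (τc s) (τd s))
  have hia := hv.intervalIntegrable_source hA hS i hx ha.continuousOn
  have hib := hv.intervalIntegrable_source hA hS i hx hb.continuousOn
  have hic := hv.intervalIntegrable_source hA hS i hx hc.continuousOn
  have hid := hv.intervalIntegrable_source hA hS i hx hd.continuousOn
  rw [intervalIntegral.integral_sub ((hia.sub hib).div_const _) ((hic.sub hid).div_const _),
    intervalIntegral.integral_div, intervalIntegral.integral_div,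
    intervalIntegral.integral_sub hia hib, intervalIntegral.integral_sub hic hid] at hsrc
  rw [hv.step_eq hA hS i hx ha, hv.step_eq hA hS i hx hb, hv.step_eq hA hS i hx hc,
    hv.step_eq hA hS i hx hd, add_sub_add_comm, add_sub_add_comm, add_div, add_div,
    add_sub_add_comm]
  refine (abs_add_le _ _).trans ((add_le_add hdat hsrc).trans ?_)
  have hex : 1 ≤ Real.exp (Λ * x) := Real.one_le_exp (mul_nonneg hΛ.le hx.1)
  have hsr : 0 ≤ √r := Real.sqrt_nonneg _
  have k1 : M₀ * (E * √r) * E ≤ M / 2 * Real.exp (Λ * x) * √r := by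
    have : M₀ * E ^ 2 ≤ M / 2 * Real.exp (Λ * x) := by
      have : M / 2 ≤ M / 2 * Real.exp (Λ * x) := le_mul_of_one_le_right (by linarith) hex
      linarith
    calc M₀ * (E * √r) * E = M₀ * E ^ 2 * √r := by ring
      _ ≤ _ := mul_le_mul_of_nonneg_right this hsr
  have k2 : C * (M * E * √r) * E / Λ * Real.exp (Λ * x) + 2 * C * W * x + 1 * W
      ≤ M / 2 * Real.exp (Λ * x) * √r := by
    have hWx : 2 * C * W * x ≤ 2 * C * W * L := mul_le_mul_of_nonneg_left hx.2 (by positivity)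
    -- Source, spreading of characteristics inside the source, and spreading at the datum add up to
    -- exactly the expression bounded by `Λ_quot`.
    have e : C * (M * E * √r) * E / Λ * Real.exp (Λ * x) + 2 * C * W * L + 1 * W
        = (2 * (C * E ^ 3 * (1 + 2 * C * L) + C * E ^ 2)) / Λ *
          (M / 2 * Real.exp (Λ * x) * √r) := by
      rw [hW]; field_simp; ring
    have e1 : (2 * (C * E ^ 3 * (1 + 2 * C * L) + C * E ^ 2)) / Λ ≤ 1 :=
      (div_le_one hΛ).2 hA.Λ_quot
    have e2 := mul_le_of_le_one_left (show 0 ≤ M / 2 * Real.exp (Λ * x) * √r by positivity) e1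
    linarith
  linarith

theorem IsProfile.step (hv : IsProfile L P C κ Λ M v) (hA : Admissible L R C κ Λ)
    (hS : IsSystem R C P μ f) (hg : IsDatum P κ₀ M₀ g)
    (hκ : 2 * Real.exp (2 * C * L) * κ₀ ≤ κ) (hM : 2 ≤ M)
    (hM₀ : 2 * Real.exp (2 * C * L) ^ 2 * M₀ ≤ M) :
    IsProfile L P C κ Λ M (step L μ f g v) where
  bound i t _ hx := hv.step_bound hA hS hg hκ i t hx
  lip_time i t t' _ hx := hv.step_lip_time hA hS hg hκ i t t' hx
  lip_space i t _ hx _ hx' := hv.step_lip_space hA hS hg hκ i t hx hx'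
  quot i _ hx _ _ _ _ _ hab hcd hac hbd := hv.step_quot hA hS hg hκ hM hM₀ i hx hab hcd hac hbd
  rest i _ _ hx ht := hv.step_rest hA hS hg i hx ht
  periodic i _ _ hx ht := hv.step_periodic hA hS hg i hx ht

/-- Characteristics of the two frozen fields through the same endpoint separate by at most `W`,
which carries the factor `D/Λ`. Datum and source are Lipschitz, so the images differ by a multiple
of `D/Λ`, and `Λ_contr` makes that `D/2`. The weighted sup norm suffices because the profiles are
already Lipschitz in time. -/
theorem IsProfile.step_contraction (hv : IsProfile L P C κ Λ M v)
    (hv' : IsProfile L P C κ Λ M v') (hA : Admissible L R C κ Λ)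
    (hS : IsSystem R C P μ f) (hg : IsDatum P κ₀ M₀ g)
    (hκ : 2 * Real.exp (2 * C * L) * κ₀ ≤ κ) {D : ℝ} (hD : 0 ≤ D)
    (h : ∀ i t, ∀ x ∈ Icc 0 L, |v i t x - v' i t x| ≤ D * Real.exp (Λ * x)) (i : ι) (t : ℝ)
    {x : ℝ} (hx : x ∈ Icc 0 L) :
    |EulerSource.step L μ f g v i t x - EulerSource.step L μ f g v' i t x|
      ≤ D / 2 * Real.exp (Λ * x) := by
  obtain ⟨τ, rfl, hτ⟩ := hv.exists_char hA hS i t hx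
  obtain ⟨σ, hστ, hσ⟩ := hv'.exists_char hA hS i (τ x) hx
  replace hτ := hτ.mono hx.2
  replace hσ := hσ.mono hx.2
  have hC := hA.C_pos
  have hΛ := hA.Λ_pos
  have hE := hA.one_le_exp
  have hκ0 := hA.κ_nonneg
  have hL := hA.L_nonneg
  set E := Real.exp (2 * C * L) with hEdef
  have hsub : Icc 0 x ⊆ Icc 0 L := Icc_subset_Icc_right hx.2
  have hcomp : ∀ {G : ℝ → (ι → ℝ) → ℝ}, LipBall R C G → ∀ s ∈ Icc 0 x,
      |G (τ s) (fun j => v j (τ s) s) - G (σ s) (fun j => v' j (σ s) s)|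
        ≤ 2 * C * |τ s - σ s| + C * D * Real.exp (Λ * s) := by
    intro G hG s hs
    refine (hG (τ s) (σ s) _ _ (|τ s - σ s| + D * Real.exp (Λ * s)) (hv.mem_ball hA (hsub hs) _)
      (hv'.mem_ball hA (hsub hs) _) (by positivity) (fun j => ?_)).trans (le_of_eq (by ring))
    exact (abs_sub_le _ (v j (σ s) s) _).trans (add_le_add
      (hv.lip_time_one hA (hsub hs) _ _ j) (h j _ s (hsub hs)))
  set W := E * (C * D / Λ * Real.exp (Λ * x)) with hW
  have hW0 : 0 ≤ W := by positivity
  have hdist : ∀ s ∈ Icc 0 x, |τ s - σ s| ≤ W := by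
    intro s hs
    have := hτ.dist_le_of_perturb hσ (A := 2 * C) (B := C * D) (by positivity) (by positivity) hΛ
      (fun s hs => hcomp (hS.slowness_lip i) s hs) s hs
    rw [hστ, sub_self, abs_zero, zero_add] at this
    exact this.trans (mul_le_mul_of_nonneg_right (hA.exp_le hx) (by positivity))
  have e1 := hv.step_eq (g := g) hA hS i hx hτ
  have e2 := hv'.step_eq (g := g) hA hS i hx hσ
  rw [hστ] at e2
  rw [e1, e2, add_sub_add_comm, ← intervalIntegral.integral_sub
    (hv.intervalIntegrable_source hA hS i hx hτ.continuousOn)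
    (hv'.intervalIntegrable_source hA hS i hx hσ.continuousOn)]
  have h1 := abs_integral_le_exp (K₁ := C * D) (K₂ := 2 * C * W) (Λ := Λ)
    (h := fun s => f i (τ s) (fun j => v j (τ s) s) - f i (σ s) (fun j => v' j (σ s) s))
    hx.1 (by positivity) hΛ
    (fun s hs => by
      have := hcomp (hS.source_lipBall hA i) s hs
      have := mul_le_mul_of_nonneg_left (hdist s hs) (show 0 ≤ 2 * C by positivity)
      linarith)
  have hκ₀0 : 0 ≤ κ₀ := (abs_nonneg _).trans (hg.bound i 0)
  have hκ₀1 : κ₀ ≤ 1 := by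
    have e1 := (hA.weight_le (x := 0) ⟨le_rfl, hL⟩).trans hA.R_le
    rw [mul_zero, Real.exp_zero, mul_one] at e1
    nlinarith
  have h2 : |g i (τ 0) - g i (σ 0)| ≤ W := by
    refine (hg.lip i _ _).trans ?_
    have := hdist 0 ⟨le_rfl, hx.1⟩
    nlinarith [abs_nonneg (τ 0 - σ 0)]
  refine (abs_add_le _ _).trans ((add_le_add h2 h1).trans ?_)
  have hWx : 2 * C * W * x ≤ 2 * C * W * L := mul_le_mul_of_nonneg_left hx.2 (by positivity)
  have e : W + (C * D / Λ * Real.exp (Λ * x) + 2 * C * W * L)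
      = (2 * (E * C + 2 * C * C * E * L + C)) / Λ * (D / 2 * Real.exp (Λ * x)) := by
    rw [hW]; field_simp; ring
  have e1 : (2 * (E * C + 2 * C * C * E * L + C)) / Λ ≤ 1 := (div_le_one hΛ).2 hA.Λ_contr
  have e2 := mul_le_of_le_one_left (show 0 ≤ D / 2 * Real.exp (Λ * x) by positivity) e1
  linarith

end

end EulerSource
end

noncomputable section
namespace EulerSource
open Filter Topology

variable {ι : Type*}

/-! ### Fixed point of the iteration -/

section

variable {L R C P κ Λ M κ₀ M₀ : ℝ} {μ f : ι → ℝ → (ι → ℝ) → ℝ} {g : ι → ℝ → ℝ}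

theorem isProfile_zero (hκ : 0 ≤ κ) (hM : 0 ≤ M) (hC : 0 ≤ C) :
    IsProfile L P C κ Λ M (fun (_ : ι) _ _ => 0) where
  bound _ _ _ _ := by simp only [abs_zero]; positivity
  lip_time _ _ _ _ _ := by simp only [sub_self, abs_zero]; positivity
  lip_space _ _ _ _ _ _ := by simp only [sub_self, abs_zero]; positivity
  quot _ _ _ _ _ _ _ _ _ _ _ _ := by simp only [sub_self, zero_div, abs_zero]; positivity
  rest _ _ _ _ _ := rfl
  periodic _ _ _ _ _ := rfl

/-- Every condition is closed under pointwise convergence. This is why regularity is encoded by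
difference quotients and not by derivatives. -/
theorem IsProfile.of_tendsto {V : ℕ → ι → ℝ → ℝ → ℝ} {v : ι → ℝ → ℝ → ℝ}
    (hV : ∀ n, IsProfile L P C κ Λ M (V n))
    (h : ∀ i t, ∀ x ∈ Icc 0 L, Tendsto (fun n => V n i t x) atTop (𝓝 (v i t x))) :
    IsProfile L P C κ Λ M v where
  bound i t x hx := le_of_tendsto' (h i t x hx).abs fun n => (hV n).bound i t x hx
  lip_time i t t' x hx :=
    le_of_tendsto' ((h i t x hx).sub (h i t' x hx)).abs fun n => (hV n).lip_time i t t' x hx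
  lip_space i t x hx x' hx' :=
    le_of_tendsto' ((h i t x hx).sub (h i t x' hx')).abs fun n => (hV n).lip_space i t x hx x' hx'
  quot i x hx a b c d r hab hcd hac hbd :=
    le_of_tendsto' ((((h i a x hx).sub (h i b x hx)).div_const _).sub
      (((h i c x hx).sub (h i d x hx)).div_const _)).abs
      fun n => (hV n).quot i x hx a b c d r hab hcd hac hbd
  rest i t x hx ht := by
    refine tendsto_nhds_unique (h i t x hx) ?_
    simp only [(hV _).rest i t x hx ht]
    exact tendsto_const_nhds
  periodic i t x hx ht := by
    refine tendsto_nhds_unique (h i (t + P) x hx) ?_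
    simp only [(hV _).periodic i t x hx ht]
    exact h i t x hx

theorem exists_isProfile_step_eq (hA : Admissible L R C κ Λ) (hS : IsSystem R C P μ f)
    (hg : IsDatum P κ₀ M₀ g) (hκ : 2 * Real.exp (2 * C * L) * κ₀ ≤ κ) (hM : 2 ≤ M)
    (hM₀ : 2 * Real.exp (2 * C * L) ^ 2 * M₀ ≤ M) :
    ∃ v : ι → ℝ → ℝ → ℝ, IsProfile L P C κ Λ M v ∧
      ∀ i t, ∀ x ∈ Icc 0 L, step L μ f g v i t x = v i t x := by
  have hκ0 := hA.κ_nonneg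
  set V : ℕ → ι → ℝ → ℝ → ℝ := fun n => (step L μ f g)^[n] (fun _ _ _ => 0) with hVdef
  have hVs : ∀ n, V (n + 1) = step L μ f g (V n) := fun n =>
    Function.iterate_succ_apply' _ _ _
  have hV : ∀ n, IsProfile L P C κ Λ M (V n) := by
    intro n
    induction n with
    | zero => exact isProfile_zero hκ0 (by linarith) hA.C_pos.le
    | succ n ih => rw [hVs]; exact ih.step hA hS hg hκ hM hM₀
  have hd : ∀ n i t, ∀ x ∈ Icc 0 L,
      |V n i t x - V (n + 1) i t x| ≤ κ / 2 ^ n * Real.exp (Λ * x) := by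
    intro n
    induction n with
    | zero =>
      intro i t x hx
      have := (hV 1).bound i t x hx
      simpa [hVdef] using this
    | succ n ih =>
      intro i t x hx
      have := (hV n).step_contraction (hV (n + 1)) hA hS hg hκ (by positivity) ih i t hx
      rw [← hVs, ← hVs] at this
      refine this.trans (le_of_eq ?_)
      rw [pow_succ]; ring
  have hd' : ∀ i t, ∀ x ∈ Icc 0 L, ∀ n,
      dist (V n i t x) (V (n + 1) i t x) ≤ 2 * κ * Real.exp (Λ * x) / 2 / 2 ^ n := by
    intro i t x hx n
    refine (hd n i t x hx).trans (le_of_eq ?_)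
    ring
  have hlim : ∀ i t x, ∃ l, x ∈ Icc 0 L → Tendsto (fun n => V n i t x) atTop (𝓝 l) := by
    intro i t x
    by_cases hx : x ∈ Icc 0 L
    · obtain ⟨l, hl⟩ := cauchySeq_tendsto_of_complete (cauchySeq_of_le_geometric_two (hd' i t x hx))
      exact ⟨l, fun _ => hl⟩
    · exact ⟨0, fun h => absurd h hx⟩
  choose v hv using hlim
  have hvP : IsProfile L P C κ Λ M v := IsProfile.of_tendsto hV hv
  refine ⟨v, hvP, fun i t x hx => ?_⟩
  have hrate : ∀ n i t, ∀ x ∈ Icc 0 L,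
      |V n i t x - v i t x| ≤ 2 * κ / 2 ^ n * Real.exp (Λ * x) := by
    intro n i t x hx
    refine (dist_le_of_le_geometric_two_of_tendsto (hd' i t x hx) (hv i t x hx) n).trans
      (le_of_eq ?_)
    ring
  have h1 : Tendsto (fun n => V (n + 1) i t x) atTop (𝓝 (v i t x)) :=
    (hv i t x hx).comp (tendsto_add_atTop_nat 1)
  -- The contraction estimate between the iterates and their limit makes `step` continuous along the
  -- sequence.
  have h2 : Tendsto (fun n => V (n + 1) i t x) atTop (𝓝 (step L μ f g v i t x)) := by
    rw [tendsto_iff_dist_tendsto_zero]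
    have h3 : Tendsto (fun n : ℕ => 2 * κ / 2 ^ n / 2 * Real.exp (Λ * x)) atTop (𝓝 0) := by
      have h4 : Tendsto (fun n : ℕ => (1 / 2 : ℝ) ^ n) atTop (𝓝 0) :=
        tendsto_pow_atTop_nhds_zero_of_lt_one (by norm_num) (by norm_num)
      have h5 := h4.const_mul (κ * Real.exp (Λ * x))
      rw [mul_zero] at h5
      refine h5.congr fun n => ?_
      rw [one_div, inv_pow]
      field_simp
    refine squeeze_zero (fun _ => dist_nonneg) (fun n => ?_) h3
    rw [hVs]
    exact (hV n).step_contraction hvP hA hS hg hκ (by positivity) (hrate n) i t hx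
  exact tendsto_nhds_unique h2 h1

end

/-! ### Differentiability from Hölder continuous difference quotients -/

/-- Quotients based at `t` with increment tending to zero form a Cauchy sequence. Letting one pair
of points tend to `t` gives the rate `√r` for every pair within `r` of `t`, whether or not it
contains `t`. -/
theorem exists_limit_of_quotient {F : ℝ → ℝ} {K : ℝ}
    (h : ∀ a b c d r, a ≠ b → c ≠ d → |a - c| ≤ r → |b - d| ≤ r →
      |(F a - F b) / (a - b) - (F c - F d) / (c - d)| ≤ K * √r) (t : ℝ) :
    ∃ p, ∀ a b r, a ≠ b → |a - t| ≤ r → |b - t| ≤ r →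
      |(F a - F b) / (a - b) - p| ≤ K * √r := by
  set e : ℕ → ℝ := fun n => 1 / ((n : ℝ) + 1) with he
  have he0 : ∀ n, 0 < e n := fun n => by positivity
  have hlim : Tendsto e atTop (𝓝 0) := tendsto_one_div_add_atTop_nhds_zero_nat
  set q : ℕ → ℝ := fun n => (F (t + e n) - F t) / (t + e n - t) with hq
  have hne : ∀ n, t + e n ≠ t := fun n => by have := he0 n; intro h; linarith
  have hcau : CauchySeq q := by
    refine cauchySeq_of_le_tendsto_0' (fun n => K * √(e n)) (fun n m hnm => ?_) ?_
    · refine h _ _ _ _ (e n) (hne n) (hne m) ?_ (by simpa using (he0 n).le)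
      have h1 : e m ≤ e n := one_div_le_one_div_of_le (by positivity) (by gcongr)
      rw [add_sub_add_left_eq_sub, abs_of_nonneg (by linarith)]
      linarith [he0 m]
    · simpa using (Real.continuous_sqrt.continuousAt.tendsto.comp hlim).const_mul K
  obtain ⟨p, hp⟩ := cauchySeq_tendsto_of_complete hcau
  refine ⟨p, fun a b r hab ha hb => ?_⟩
  have h1 : Tendsto (fun n => K * √(r + e n)) atTop (𝓝 (K * √r)) := by
    have := (Real.continuous_sqrt.continuousAt.tendsto.comp (hlim.const_add r)).const_mul K
    simpa using this
  refine le_of_tendsto_of_tendsto' (tendsto_const_nhds.sub hp).abs h1 fun n => ?_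
  refine h _ _ _ _ _ hab (hne n) ?_ ?_
  · have := abs_sub_le a t (t + e n)
    have h2 : |t - (t + e n)| = e n := by
      rw [show t - (t + e n) = -(e n) by ring, abs_neg, abs_of_pos (he0 n)]
    linarith
  · linarith [he0 n]

theorem hasDerivAt_of_quotient_limit {F : ℝ → ℝ} {K t p : ℝ}
    (h : ∀ a b r, a ≠ b → |a - t| ≤ r → |b - t| ≤ r →
      |(F a - F b) / (a - b) - p| ≤ K * √r) : HasDerivAt F p t := by
  rw [hasDerivAt_iff_tendsto_slope, tendsto_iff_dist_tendsto_zero]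
  have h1 : Tendsto (fun y => K * √|y - t|) (𝓝[≠] t) (𝓝 0) := by
    have : Continuous fun y => K * √|y - t| := by fun_prop
    have h2 := this.tendsto t
    simp only [sub_self, abs_zero, Real.sqrt_zero, mul_zero] at h2
    exact h2.mono_left nhdsWithin_le_nhds
  refine squeeze_zero' (Eventually.of_forall fun _ => dist_nonneg) ?_ h1
  filter_upwards [self_mem_nhdsWithin] with y hy
  rw [slope_def_field]
  exact h y t |y - t| hy le_rfl (by simp)

/-! ### From the fixed point to a classical solution -/

section

variable {L R C P κ Λ M κ₀ M₀ : ℝ} {μ f : ι → ℝ → (ι → ℝ) → ℝ} {g : ι → ℝ → ℝ}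

/-- `v` is a `C¹` solution of `∂ₓ v + μ(t, v) ∂ₜ v = f(t, v)` on `ℝ × [0, L]` of size `κ`, with time
derivative `p` and boundary data `g`. -/
structure IsClassicalSolution (L P C κ : ℝ) (μ f : ι → ℝ → (ι → ℝ) → ℝ) (g : ι → ℝ → ℝ)
    (v p : ι → ℝ → ℝ → ℝ) : Prop where
  boundary : ∀ i t, v i t 0 = g i t
  bound : ∀ i t, ∀ x ∈ Icc 0 L, |v i t x| ≤ κ
  bound_deriv : ∀ i t, ∀ x ∈ Icc 0 L, |p i t x| ≤ κ
  continuousOn : ∀ i, ContinuousOn (fun z : ℝ × ℝ => v i z.1 z.2) (univ ×ˢ Icc 0 L)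
  continuousOn_deriv : ∀ i, ContinuousOn (fun z : ℝ × ℝ => p i z.1 z.2) (univ ×ˢ Icc 0 L)
  hasFDerivWithinAt : ∀ i t, ∀ x ∈ Icc 0 L, HasFDerivWithinAt (fun z : ℝ × ℝ => v i z.1 z.2)
    (p i t x • ContinuousLinearMap.fst ℝ ℝ ℝ +
      (f i t (fun j => v j t x) - μ i t (fun j => v j t x) * p i t x) •
        ContinuousLinearMap.snd ℝ ℝ ℝ) (univ ×ˢ Icc 0 L) (t, x)
  rest : ∀ i t, ∀ x ∈ Icc 0 L, t ≤ 0 → v i t x = 0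
  periodic : ∀ i t, ∀ x ∈ Icc 0 L, C * x < t → v i (t + P) x = v i t x

theorem IsProfile.continuousOn {v : ι → ℝ → ℝ → ℝ} (hv : IsProfile L P C κ Λ M v)
    (hA : Admissible L R C κ Λ) (i : ι) :
    ContinuousOn (fun z : ℝ × ℝ => v i z.1 z.2) (univ ×ˢ Icc 0 L) := by
  have hC := hA.C_pos
  refine LipschitzOnWith.continuousOn (K := Real.toNNReal (1 + 2 * C))
    (LipschitzOnWith.of_dist_le_mul fun z hz w hw => ?_)
  rw [Real.coe_toNNReal _ (by positivity), Real.dist_eq]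
  have h1 := hv.lip_time_one hA hz.2 z.1 w.1 i
  have h2 := hv.lip_space i w.1 z.2 hz.2 w.2 hw.2
  have h3 : |z.1 - w.1| ≤ dist z w := by rw [Prod.dist_eq]; exact le_max_left _ _
  have h4 : |z.2 - w.2| ≤ dist z w := by rw [Prod.dist_eq]; exact le_max_right _ _
  refine (abs_sub_le _ (v i w.1 z.2) _).trans ?_
  nlinarith

/-- The quotient bound gives a time derivative `p`, continuous as a uniform limit of difference
quotients. Along a characteristic the fixed point has derivative `f`; removing the contribution `μ
p` of the drift in time leaves the space derivative. -/
theorem IsProfile.isClassicalSolution {v : ι → ℝ → ℝ → ℝ} (hv : IsProfile L P C κ Λ M v)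
    (hA : Admissible L R C κ Λ) (hS : IsSystem R C P μ f) (hM : 0 ≤ M)
    (hfix : ∀ i t, ∀ x ∈ Icc 0 L, EulerSource.step L μ f g v i t x = v i t x) :
    ∃ p, IsClassicalSolution L P C (κ * Real.exp (Λ * L)) μ f g v p := by
  have hC := hA.C_pos
  have hΛ := hA.Λ_pos
  have hκ0 := hA.κ_nonneg
  set K := M * Real.exp (Λ * L) with hK
  have hweight : ∀ x ∈ Icc 0 L, Real.exp (Λ * x) ≤ Real.exp (Λ * L) := fun x hx =>
    Real.exp_le_exp.2 (mul_le_mul_of_nonneg_left hx.2 hΛ.le)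
  have hquot : ∀ i, ∀ x ∈ Icc 0 L, ∀ a b c d r, a ≠ b → c ≠ d → |a - c| ≤ r → |b - d| ≤ r →
      |(v i a x - v i b x) / (a - b) - (v i c x - v i d x) / (c - d)| ≤ K * √r := by
    intro i x hx a b c d r hab hcd hac hbd
    refine (hv.quot i x hx a b c d r hab hcd hac hbd).trans ?_
    exact mul_le_mul_of_nonneg_right (mul_le_mul_of_nonneg_left (hweight x hx) hM)
      (Real.sqrt_nonneg _)
  have hex : ∀ i t x, ∃ p, x ∈ Icc 0 L → ∀ a b r, a ≠ b → |a - t| ≤ r → |b - t| ≤ r →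
      |(v i a x - v i b x) / (a - b) - p| ≤ K * √r := by
    intro i t x
    by_cases hx : x ∈ Icc 0 L
    · obtain ⟨p, hp⟩ := exists_limit_of_quotient (hquot i x hx) t
      exact ⟨p, fun _ => hp⟩
    · exact ⟨0, fun h => absurd h hx⟩
  choose p hp using hex
  have hderiv : ∀ i t, ∀ x ∈ Icc 0 L, HasDerivAt (fun t => v i t x) (p i t x) t :=
    fun i t x hx => hasDerivAt_of_quotient_limit (hp i t x hx)
  have hcont := fun i => hv.continuousOn hA i
  have hpcont : ∀ i, ContinuousOn (fun z : ℝ × ℝ => p i z.1 z.2) (univ ×ˢ Icc 0 L) := by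
    intro i
    set e : ℕ → ℝ := fun n => 1 / ((n : ℝ) + 1) with he
    have he0 : ∀ n, 0 < e n := fun n => by positivity
    have hlim : Tendsto e atTop (𝓝 0) := tendsto_one_div_add_atTop_nhds_zero_nat
    have hunif : TendstoUniformlyOn
        (fun n (z : ℝ × ℝ) => (v i (z.1 + e n) z.2 - v i z.1 z.2) / (z.1 + e n - z.1))
        (fun z : ℝ × ℝ => p i z.1 z.2) atTop (univ ×ˢ Icc 0 L) := by
      rw [Metric.tendstoUniformlyOn_iff]
      intro η hη
      have h1 : Tendsto (fun n => K * √(e n)) atTop (𝓝 0) := by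
        simpa using (Real.continuous_sqrt.continuousAt.tendsto.comp hlim).const_mul K
      filter_upwards [h1.eventually (gt_mem_nhds hη)] with n hn z hz
      rw [dist_comm]
      have h3 := he0 n
      refine (hp i z.1 z.2 hz.2 _ _ (e n) (by intro h; linarith) ?_ ?_).trans_lt hn
      · rw [add_sub_cancel_left, abs_of_pos h3]
      · simpa using h3.le
    refine hunif.continuousOn (Eventually.frequently (Eventually.of_forall fun n => ?_))
    have h2 : ContinuousOn (fun z : ℝ × ℝ => v i (z.1 + e n) z.2) (univ ×ˢ Icc 0 L) :=
      (hcont i).comp (f := fun z : ℝ × ℝ => (z.1 + e n, z.2)) (by fun_prop)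
        (fun z hz => ⟨trivial, hz.2⟩)
    simp only [add_sub_cancel_left]
    exact (h2.sub (hcont i)).div_const _
  have hspace : ∀ i t, ∀ x ∈ Icc 0 L, HasDerivWithinAt (fun x => v i t x)
      (f i t (fun j => v j t x) - μ i t (fun j => v j t x) * p i t x) (Icc 0 L) x := by
    intro i t x hx
    obtain ⟨τ, rfl, hτ⟩ := hv.exists_char hA hS i t hx
    have hLmem : L ∈ Icc 0 L := ⟨hA.L_nonneg, le_rfl⟩
    have hvτ : ∀ y ∈ Icc 0 L, v i (τ y) y = g i (τ 0) +
        ∫ s in (0 : ℝ)..y, f i (τ s) (fun j => v j (τ s) s) := fun y hy => by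
      rw [← hfix i (τ y) y hy, hv.step_eq hA hS i hy (hτ.mono hy.2)]
    have hscont := hv.continuousOn_source hA (hS.source_lipBall hA i) hLmem hτ.continuousOn
    have h1 : HasDerivWithinAt (fun y => v i (τ y) y) (f i (τ x) (fun j => v j (τ x) x))
        (Icc 0 L) x := by
      have h2 : HasDerivWithinAt (fun y => g i (τ 0) +
          ∫ s in (0 : ℝ)..y, f i (τ s) (fun j => v j (τ s) s))
          (f i (τ x) (fun j => v j (τ x) x)) (Icc 0 L) x := by
        refine HasDerivWithinAt.const_add _ ?_
        -- The one-sided fundamental theorem of calculus on `Icc 0 L` takes membership as an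
        -- instance.
        have : Fact (x ∈ Icc 0 L) := ⟨hx⟩
        refine intervalIntegral.integral_hasDerivWithinAt_right
          ((hv.intervalIntegrable_source hA hS i hLmem hτ.continuousOn).mono_set ?_)
          ⟨_, self_mem_nhdsWithin, hscont.aestronglyMeasurable measurableSet_Icc⟩
          (hscont x hx)
        rw [uIcc_of_le hx.1, uIcc_of_le hA.L_nonneg]
        exact Icc_subset_Icc_right hx.2
      exact h2.congr hvτ (hvτ x hx)
    have h2 : HasDerivWithinAt (fun y => v i (τ y) y - v i (τ x) y)
        (field μ v i (τ x) x * p i (τ x) x) (Icc 0 L) x := by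
      have hτx := hτ x hx
      rw [hasDerivWithinAt_iff_tendsto_slope] at hτx ⊢
      -- The increment is `(τ y - τ x) * Q y`. Where `τ y = τ x` the value of `Q` is immaterial for
      -- the product, and `p` keeps `Q` convergent.
      set Q : ℝ → ℝ := fun y => if τ y = τ x then p i (τ x) x
        else (v i (τ y) y - v i (τ x) y) / (τ y - τ x) with hQ
      have hQlim : Tendsto Q (𝓝[Icc 0 L \ {x}] x) (𝓝 (p i (τ x) x)) := by
        rw [tendsto_iff_dist_tendsto_zero]
        have e1 : Tendsto (fun y => K * √|τ y - τ x|) (𝓝[Icc 0 L \ {x}] x) (𝓝 0) := by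
          have c1 : ContinuousWithinAt (fun y => K * √|τ y - τ x|) (Icc 0 L) x := by
            have := (hτ.continuousOn x hx)
            fun_prop
          have := c1.tendsto
          simp only [sub_self, abs_zero, Real.sqrt_zero, mul_zero] at this
          exact this.mono_left (nhdsWithin_mono _ sdiff_subset)
        have e2 : Tendsto (fun y => |p i (τ x) y - p i (τ x) x|) (𝓝[Icc 0 L \ {x}] x) (𝓝 0) := by
          have c1 : ContinuousWithinAt (fun y => p i (τ x) y) (Icc 0 L) x :=
            ((hpcont i).comp (f := fun y : ℝ => (τ x, y)) (s := Icc 0 L) (by fun_prop)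
              (fun y hy => ⟨trivial, hy⟩)) x hx
          exact (tendsto_iff_dist_tendsto_zero.1 c1.tendsto).mono_left
            (nhdsWithin_mono _ sdiff_subset)
        refine squeeze_zero' (Eventually.of_forall fun _ => dist_nonneg) ?_
          (by simpa using e1.add e2)
        filter_upwards [self_mem_nhdsWithin] with y hy
        have e3 : 0 ≤ K * √|τ y - τ x| := by positivity
        rw [hQ, Real.dist_eq]
        dsimp only
        split_ifs with hyx
        · rw [sub_self, abs_zero]; positivity
        · refine (abs_sub_le _ (p i (τ x) y) _).trans (add_le_add ?_ le_rfl)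
          exact hp i (τ x) y hy.1 _ _ _ hyx le_rfl (by simp)
      have := hτx.mul hQlim
      refine this.congr' ?_
      filter_upwards [self_mem_nhdsWithin] with y hy
      rw [slope_def_field, slope_def_field, hQ]
      dsimp only
      split_ifs with hyx
      · simp [hyx]
      · have := sub_ne_zero.2 hyx
        field_simp
        simp
    have h3 := h1.sub h2
    simpa [field, Pi.sub_def] using h3
  refine ⟨p, ?_, ?_, ?_, hcont, hpcont, ?_, hv.rest, hv.periodic⟩
  · intro i t
    have h0 : (0 : ℝ) ∈ Icc 0 L := ⟨le_rfl, hA.L_nonneg⟩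
    obtain ⟨τ, rfl, hτ⟩ := hv.exists_char hA hS i t h0
    rw [← hfix i _ 0 h0, hv.step_eq hA hS i h0 (hτ.mono hA.L_nonneg)]
    simp
  · intro i t x hx
    exact (hv.bound i t x hx).trans (mul_le_mul_of_nonneg_left (hweight x hx) hκ0)
  · intro i t x hx
    have h1 := (hderiv i t x hx).le_of_lip' (C := κ * Real.exp (Λ * x)) (by positivity)
      (Eventually.of_forall fun y => by simpa using hv.lip_time i y t x hx)
    exact h1.trans (mul_le_mul_of_nonneg_left (hweight x hx) hκ0)
  · intro i t x hx
    set S : Set (ℝ × ℝ) := univ ×ˢ Icc 0 L with hSdef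
    have hz : (t, x) ∈ S := ⟨trivial, hx⟩
    have h1 : HasFDerivWithinAt (fun z : ℝ × ℝ => v i t z.2)
        ((f i t (fun j => v j t x) - μ i t (fun j => v j t x) * p i t x) •
          ContinuousLinearMap.snd ℝ ℝ ℝ) S (t, x) := by
      have := (hspace i t x hx).comp_hasFDerivWithinAt (t, x)
        (hasFDerivWithinAt_snd (𝕜 := ℝ) (E := ℝ) (F := ℝ) (p := (t, x)) (s := S))
        (fun z hz => hz.2)
      exact this
    -- The time increment is taken at the moving abscissa `z.2`. Its error is `K √|z.1 - t|` from
    -- the quotient rate plus the variation of `p` in `x`, both times `|z.1 - t|`.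
    have h2 : HasFDerivWithinAt (fun z : ℝ × ℝ => v i z.1 z.2 - v i t z.2)
        (p i t x • ContinuousLinearMap.fst ℝ ℝ ℝ) S (t, x) := by
      rw [hasFDerivWithinAt_iff_isLittleO, Asymptotics.isLittleO_iff]
      intro c hc
      have c1 : ContinuousWithinAt
          (fun z : ℝ × ℝ => K * √|z.1 - t| + |p i t z.2 - p i t x|) S (t, x) := by
        have c2 : ContinuousWithinAt (fun z : ℝ × ℝ => p i t z.2) S (t, x) :=
          ((hpcont i).comp (f := fun z : ℝ × ℝ => (t, z.2)) (s := S) (by fun_prop)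
              (fun y hy => ⟨trivial, hy.2⟩)) (t, x) hz
        have c4 : Continuous fun z : ℝ × ℝ => K * √|z.1 - t| := by fun_prop
        exact c4.continuousWithinAt.add (c2.sub continuousWithinAt_const).abs
      have c3 := c1.tendsto
      simp only [sub_self, abs_zero, Real.sqrt_zero, mul_zero, add_zero] at c3
      filter_upwards [self_mem_nhdsWithin, c3.eventually (gt_mem_nhds hc)] with z hzS hzc
      have e1 : |v i z.1 z.2 - v i t z.2 - p i t x * (z.1 - t)|
          ≤ (K * √|z.1 - t| + |p i t z.2 - p i t x|) * |z.1 - t| := by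
        by_cases hzt : z.1 = t
        · simp [hzt]
        · have h3 := hp i t z.2 hzS.2 z.1 t |z.1 - t| hzt le_rfl (by simp)
          have h4 : z.1 - t ≠ 0 := sub_ne_zero.2 hzt
          have h5 : v i z.1 z.2 - v i t z.2 - p i t x * (z.1 - t)
              = ((v i z.1 z.2 - v i t z.2) / (z.1 - t) - p i t z.2 +
                (p i t z.2 - p i t x)) * (z.1 - t) := by field_simp; ring
          rw [h5, abs_mul]
          exact mul_le_mul_of_nonneg_right ((abs_add_le _ _).trans (add_le_add h3 le_rfl))
            (abs_nonneg _)
      have e2 : |z.1 - t| ≤ ‖z - (t, x)‖ := by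
        simpa using norm_fst_le (z - (t, x))
      simp only [sub_self, sub_zero, smul_apply,
        ContinuousLinearMap.coe_fst', smul_eq_mul, Real.norm_eq_abs, Prod.fst_sub]
      refine e1.trans ?_
      exact mul_le_mul hzc.le e2 (abs_nonneg _) hc.le
    have h3 := h2.add h1
    simpa [Pi.add_def] using h3

/-- Small data launch a `C¹` solution on `ℝ × [0, L]`. -/
theorem exists_isClassicalSolution (hA : Admissible L R C κ Λ) (hS : IsSystem R C P μ f)
    (hg : IsDatum P κ₀ M₀ g) (hκ : 2 * Real.exp (2 * C * L) * κ₀ ≤ κ) :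
    ∃ v p, IsClassicalSolution L P C (κ * Real.exp (Λ * L)) μ f g v p := by
  -- `M` may depend on the individual datum, since the size bound in the conclusion is free of it.
  set M := max 2 (2 * Real.exp (2 * C * L) ^ 2 * M₀)
  obtain ⟨v, hv, hfix⟩ := exists_isProfile_step_eq hA hS hg hκ (M := M) (le_max_left _ _)
    (le_max_right _ _)
  exact ⟨v, hv.isClassicalSolution hA hS (zero_le_two.trans (le_max_left _ _)) hfix⟩

end

end EulerSource
end

noncomputable section
namespace EulerSource
open Filter Topology

/-! ### Hölder continuity of the derivative of an `H²` function -/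

/-- `φ` is the indicator of `[s, t]` smoothed by a bump `η`, so `φ'` is `η(· - s) - η(· - t)`.
Pairing a continuous function with `φ'` nearly evaluates it at `s` minus at `t`. -/
theorem exists_mollified_indicator {s t r : ℝ} (hst : s ≤ t) (hr : 0 < r) :
    ∃ φ : ℝ → ℝ, ContDiff ℝ ∞ φ ∧ (∀ x, |φ x| ≤ 1) ∧ (∀ x, x ∉ Icc (s - r) (t + r) → φ x = 0) ∧
      ∀ (F : ℝ → ℝ) (e : ℝ), Continuous F → (∀ x, |x - s| < r → |F x - F s| ≤ e) →
        (∀ x, |x - t| < r → |F x - F t| ≤ e) →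
        |(∫ x, F x * deriv φ x) - (F s - F t)| ≤ 2 * e := by
  set b : ContDiffBump (0 : ℝ) := ⟨r / 2, r, by positivity, by linarith⟩ with hb
  set η : ℝ → ℝ := b.normed volume with hη
  have hηc : Continuous η := b.continuous_normed
  have hηi : Integrable η := b.integrable_normed
  have hη0 : ∀ x, 0 ≤ η x := b.nonneg_normed
  have hηs : ∀ x, r ≤ |x| → η x = 0 := by
    intro x hx
    by_contra h
    have h1 : x ∈ Function.support η := h
    rw [hη, b.support_normed_eq, Metric.mem_ball, dist_zero_right, Real.norm_eq_abs] at h1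
    exact absurd h1 (not_lt.2 hx)
  set H : ℝ → ℝ := fun x => ∫ y in (0 : ℝ)..x, η y with hH
  have hHd : ∀ x, HasDerivAt H (η x) x := fun x =>
    intervalIntegral.integral_hasDerivAt_right (hηc.intervalIntegrable _ _)
      (hηc.stronglyMeasurableAtFilter _ _) hηc.continuousAt
  have hHsm : ContDiff ℝ ∞ H := by
    rw [contDiff_infty_iff_deriv]
    refine ⟨fun x => (hHd x).differentiableAt, ?_⟩
    rw [show deriv H = η from funext fun x => (hHd x).deriv]
    exact b.contDiff_normed
  set φ : ℝ → ℝ := fun x => H (x - s) - H (x - t) with hφ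
  have hφint : ∀ x, φ x = ∫ y in (x - t)..(x - s), η y := fun x => by
    rw [hφ]
    exact intervalIntegral.integral_interval_sub_left (hηc.intervalIntegrable _ _)
      (hηc.intervalIntegrable _ _)
  have hφd : ∀ x, HasDerivAt φ (η (x - s) - η (x - t)) x := by
    intro x
    exact ((hHd (x - s)).comp_sub_const x s).sub ((hHd (x - t)).comp_sub_const x t)
  refine ⟨φ, ?_, ?_, ?_, ?_⟩
  · exact (hHsm.comp (contDiff_id.sub contDiff_const)).sub
      (hHsm.comp (contDiff_id.sub contDiff_const))
  · intro x
    rw [hφint, intervalIntegral.integral_of_le (by linarith), abs_of_nonneg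
      (integral_nonneg hη0)]
    refine (setIntegral_le_integral hηi (Eventually.of_forall hη0)).trans ?_
    exact b.integral_normed.le
  · intro x hx
    rw [hφint]
    refine (intervalIntegral.integral_congr (g := fun _ => (0 : ℝ)) fun y hy => ?_).trans
      intervalIntegral.integral_zero
    rw [uIcc_of_le (by linarith)] at hy
    refine hηs y ?_
    rw [mem_Icc, not_and_or, not_le, not_le] at hx
    rcases hx with h | h
    · rw [abs_of_nonpos (by linarith [hy.2])]; linarith [hy.2]
    · rw [abs_of_nonneg (by linarith [hy.1])]; linarith [hy.1]
  · intro F e hF hs ht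
    have hconv : ∀ p, (∀ x, |x - p| < r → |F x - F p| ≤ e) →
        |(∫ x, F x * η (x - p)) - F p| ≤ e := by
      intro p hp
      have h1 := b.dist_normed_convolution_le (μ := volume) (g := F) (x₀ := p) (ε := e)
        hF.aestronglyMeasurable (fun x hx => hp x hx)
      rw [convolution_eq_swap, Real.dist_eq] at h1
      refine le_of_eq_of_le ?_ h1
      congr 3
      ext x
      rw [ContinuousLinearMap.lsmul_apply, smul_eq_mul, ← b.normed_neg, neg_sub, mul_comm]
    have hFi : ∀ p, Integrable (fun x => F x * η (x - p)) := by
      intro p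
      refine Continuous.integrable_of_hasCompactSupport (by fun_prop) ?_
      refine HasCompactSupport.mul_left ?_
      refine HasCompactSupport.of_support_subset_isCompact (K := Icc (p - r) (p + r))
        isCompact_Icc fun x hx => ?_
      by_contra h
      refine hx (hηs _ ?_)
      by_contra h2
      rw [not_le, abs_lt] at h2
      exact h ⟨by linarith, by linarith⟩
    have e1 : ∫ x, F x * deriv φ x = (∫ x, F x * η (x - s)) - ∫ x, F x * η (x - t) := by
      rw [← integral_sub (hFi s) (hFi t)]
      congr 1
      ext x
      rw [(hφd x).deriv, mul_sub]
    rw [e1]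
    have h1 := abs_le.1 (hconv s hs)
    have h2 := abs_le.1 (hconv t ht)
    rw [abs_le]
    constructor <;> linarith [h1.1, h1.2, h2.1, h2.2]

/-- Integration by parts shows that the classical derivative has the same pairings with test
functions; the fundamental lemma of the calculus of variations then identifies the two. -/
theorem ae_eq_deriv_of_isWeakDeriv {P : ℝ} {f g : ℝ → ℝ} (hf : ContDiff ℝ 1 f)
    (h : IsWeakDeriv (Ioo 0 P) f g) : ∀ᵐ x, x ∈ Ioo 0 P → g x = deriv f x := by
  have hf' : Continuous (deriv f) := hf.continuous_deriv le_rfl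
  have hloc : LocallyIntegrableOn (fun x => g x - deriv f x) (Ioo 0 P) :=
    h.2.1.sub (hf'.locallyIntegrable.locallyIntegrableOn _)
  have := isOpen_Ioo.ae_eq_zero_of_integral_contDiff_smul_eq_zero (μ := volume) hloc ?_
  · filter_upwards [this] with x hx hxI
    exact sub_eq_zero.1 (hx hxI)
  intro φ hφ hφc hφs
  have hφ' : Continuous (deriv φ) := hφ.continuous_deriv (by simp)
  have hφ0 : ∀ x, x ∉ Ioo 0 P → φ x = 0 := fun x hx =>
    image_eq_zero_of_notMem_tsupport fun hx' => hx (hφs hx')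
  have hφ'0 : ∀ x, x ∉ Ioo 0 P → deriv φ x = 0 := fun x hx =>
    image_eq_zero_of_notMem_tsupport fun hx' => hx (hφs (tsupport_deriv_subset hx'))
  have key := h.2.2 φ hφ hφc hφs
  rw [setIntegral_eq_integral_of_forall_compl_eq_zero (fun x hx => by rw [hφ'0 x hx, mul_zero]),
    setIntegral_eq_integral_of_forall_compl_eq_zero (fun x hx => by rw [hφ0 x hx, mul_zero])]
    at key
  have ibp : ∫ x, f x * deriv φ x = -∫ x, deriv f x * φ x := by
    refine integral_mul_deriv_eq_deriv_mul_of_integrable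
      (fun x _ => (hf.differentiable one_ne_zero x).hasDerivAt)
      (fun x _ => (hφ.differentiable (by simp) x).hasDerivAt) ?_ ?_ ?_
    · exact (hf.continuous.mul hφ').integrable_of_hasCompactSupport (hφc.deriv.mul_left)
    · exact (hf'.mul hφ.continuous).integrable_of_hasCompactSupport hφc.mul_left
    · exact (hf.continuous.mul hφ.continuous).integrable_of_hasCompactSupport hφc.mul_left
  have hgi : Integrable fun x => g x * φ x := by
    have h1 : IntegrableOn g (tsupport φ) :=
      h.2.1.integrableOn_compact_subset hφs hφc.isCompact
    have h2 : IntegrableOn (fun x => g x * φ x) (tsupport φ) :=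
      h1.mul_continuousOn hφ.continuous.continuousOn hφc.isCompact
    refine (integrableOn_iff_integrable_of_support_subset fun x hx => ?_).1 h2
    by_contra hx'
    exact hx (by simp [image_eq_zero_of_notMem_tsupport hx'])
  have hfi : Integrable fun x => deriv f x * φ x :=
    (hf'.mul hφ.continuous).integrable_of_hasCompactSupport hφc.mul_left
  have e1 : ∫ x, φ x • (g x - deriv f x) = (∫ x, g x * φ x) - ∫ x, deriv f x * φ x := by
    rw [← integral_sub hgi hfi]
    congr 1
    ext x
    rw [smul_eq_mul]; ring
  rw [e1]
  linarith

/-- `h2Norm` is an infimum, so witnesses are extracted from a strict inequality. Its use below costs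
a slack `e` that is sent to zero. -/
theorem exists_isWeakDeriv_of_h2Norm_lt {P : ℝ} {f : ℝ → ℝ} {ε : ℝ≥0∞} (h : h2Norm P f < ε) :
    ∃ g k : ℝ → ℝ, IsWeakDeriv (Ioo 0 P) f g ∧ IsWeakDeriv (Ioo 0 P) g k ∧
      eLpNorm k 2 (volume.restrict (Ioo 0 P)) ≤ ε := by
  rw [h2Norm] at h
  simp only [iInf_lt_iff] at h
  obtain ⟨g, k, h1, h2, h3⟩ := h
  refine ⟨g, k, h1, h2, le_trans ?_ h3.le⟩
  calc eLpNorm k 2 (volume.restrict (Ioo 0 P))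
      = (eLpNorm k 2 (volume.restrict (Ioo 0 P)) ^ (2 : ℝ)) ^ (1 / 2 : ℝ) := by
        rw [← ENNReal.rpow_mul]; norm_num
    _ ≤ _ := ENNReal.rpow_le_rpow le_add_self (by norm_num)

/-- Cauchy–Schwarz: a function bounded by `1` and supported in `[a, b]` has `L²` norm at most `√(b -
a)`. -/
theorem abs_integral_mul_le_of_eLpNorm {I : Set ℝ} {k φ : ℝ → ℝ} {a b ε : ℝ}
    (hk : AEStronglyMeasurable k (volume.restrict I))
    (hkε : eLpNorm k 2 (volume.restrict I) ≤ ENNReal.ofReal ε) (hε : 0 ≤ ε)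
    (hφ : Continuous φ) (hφ1 : ∀ x, |φ x| ≤ 1) (hφ0 : ∀ x, x ∉ Icc a b → φ x = 0) :
    |∫ x in I, k x * φ x| ≤ ε * √(b - a) := by
  have h1 : eLpNorm φ 2 (volume.restrict I) ≤ ENNReal.ofReal √(b - a) := by
    calc eLpNorm φ 2 (volume.restrict I) ≤ eLpNorm φ 2 volume :=
          eLpNorm_mono_measure _ Measure.restrict_le_self
      _ ≤ eLpNorm ((Icc a b).indicator fun _ => (1 : ℝ)) 2 volume := by
          refine eLpNorm_mono fun x => ?_
          by_cases hx : x ∈ Icc a b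
          · simpa [hx] using hφ1 x
          · simp [hx, hφ0 x hx]
      _ = ENNReal.ofReal √(b - a) := by
          rw [eLpNorm_indicator_const measurableSet_Icc (by simp) (by simp), Real.volume_Icc,
            Real.sqrt_eq_rpow]
          simp only [enorm_one, one_mul, ENNReal.toReal_ofNat]
          by_cases hab : 0 ≤ b - a
          · rw [ENNReal.ofReal_rpow_of_nonneg hab (by norm_num)]
          · rw [ENNReal.ofReal_of_nonpos (by linarith), ← Real.sqrt_eq_rpow,
              Real.sqrt_eq_zero_of_nonpos (by linarith)]
            simp
  have h2 : eLpNorm (φ • k) 1 (volume.restrict I) ≤ ENNReal.ofReal √(b - a) * ENNReal.ofReal ε :=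
    (eLpNorm_smul_le_mul_eLpNorm (p := 2) (q := 2) (r := 1) hk hφ.aestronglyMeasurable).trans
      (mul_le_mul' h1 hkε)
  have h3 : ‖∫ x in I, k x * φ x‖ₑ ≤ ENNReal.ofReal (ε * √(b - a)) := by
    refine (enorm_integral_le_lintegral_enorm _).trans ?_
    rw [ENNReal.ofReal_mul hε, mul_comm]
    rw [eLpNorm_one_eq_lintegral_enorm] at h2
    refine le_of_eq_of_le ?_ h2
    simp [mul_comm]
  rw [← ofReal_norm, ENNReal.ofReal_le_ofReal_iff (by positivity)] at h3
  exact h3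

/-- The one-dimensional embedding of `H¹` into Hölder-`1/2`, applied to `f'`. Testing the second
weak derivative against a smoothed indicator of `[s, t]` recovers the increment of `f'`, and
Cauchy–Schwarz bounds it. -/
theorem abs_deriv_sub_deriv_le_of_h2Norm {P ε : ℝ} (hP : 0 < P) (hε : 0 ≤ ε) {f : ℝ → ℝ}
    (hf : ContDiff ℝ 1 f) (h : h2Norm P f ≤ ENNReal.ofReal ε) {s t : ℝ} (hs : s ∈ Icc 0 P)
    (ht : t ∈ Icc 0 P) : |deriv f t - deriv f s| ≤ ε * √|t - s| := by
  have hf' : Continuous (deriv f) := hf.continuous_deriv le_rfl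
  have open_case : ∀ s ∈ Ioo 0 P, ∀ t ∈ Ioo 0 P, s ≤ t →
      |deriv f t - deriv f s| ≤ ε * √(t - s) := by
    intro s hs t ht hst
    have approx : ∀ e > 0, |deriv f t - deriv f s| ≤ (ε + e) * √(t - s + 2 * e) + 2 * e := by
      intro e he
      obtain ⟨g, k, hg, hk, hkn⟩ := exists_isWeakDeriv_of_h2Norm_lt
        (h.trans_lt ((ENNReal.ofReal_lt_ofReal_iff (by linarith)).2 (lt_add_of_pos_right ε he)))
      obtain ⟨d₁, hd₁, hd₁'⟩ := Metric.continuous_iff.1 hf' s e he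
      obtain ⟨d₂, hd₂, hd₂'⟩ := Metric.continuous_iff.1 hf' t e he
      -- The radius respects the continuity of `f'` at both ends, keeps the support inside `(0, P)`,
      -- and lengthens the interval by at most `2e`.
      set r := min (min d₁ d₂) (min e (min (s / 2) ((P - t) / 2))) with hr
      have hr0 : 0 < r := by
        have := hs.1; have := ht.2
        simp only [hr, lt_min_iff]
        exact ⟨⟨hd₁, hd₂⟩, he, by linarith, by linarith⟩
      have hrd₁ : r ≤ d₁ := (min_le_left _ _).trans (min_le_left _ _)
      have hrd₂ : r ≤ d₂ := (min_le_left _ _).trans (min_le_right _ _)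
      have hre : r ≤ e := (min_le_right _ _).trans (min_le_left _ _)
      have hrs : r ≤ s / 2 := (min_le_right _ _).trans ((min_le_right _ _).trans (min_le_left _ _))
      have hrt : r ≤ (P - t) / 2 :=
        (min_le_right _ _).trans ((min_le_right _ _).trans (min_le_right _ _))
      obtain ⟨φ, hφ, hφ1, hφ0, hφF⟩ := exists_mollified_indicator hst hr0
      have hsup : tsupport φ ⊆ Icc (s - r) (t + r) := by
        refine closure_minimal (fun x hx => ?_) isClosed_Icc
        by_contra hx'
        exact hx (hφ0 x hx')
      have hIcc : Icc (s - r) (t + r) ⊆ Ioo 0 P := fun x hx =>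
        ⟨by linarith [hx.1, hs.1], by linarith [hx.2, ht.2]⟩
      have hφc : HasCompactSupport φ := isCompact_Icc.of_isClosed_subset (isClosed_tsupport _) hsup
      have e1 : ∫ x, deriv f x * deriv φ x = -∫ x in Ioo 0 P, k x * φ x := by
        rw [← hk.2.2 φ hφ hφc (hsup.trans hIcc),
          ← setIntegral_eq_integral_of_forall_compl_eq_zero (s := Ioo 0 P) (fun x hx => by
            rw [image_eq_zero_of_notMem_tsupport (f := deriv φ) fun hx' =>
              hx (hIcc (hsup (tsupport_deriv_subset hx'))), mul_zero])]
        refine setIntegral_congr_ae measurableSet_Ioo ?_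
        filter_upwards [ae_eq_deriv_of_isWeakDeriv hf hg] with x hx hxI
        rw [hx hxI]
      have e2 := hφF (deriv f) e hf'
        (fun x hx => (hd₁' x (lt_of_lt_of_le hx hrd₁)).le)
        (fun x hx => (hd₂' x (lt_of_lt_of_le hx hrd₂)).le)
      have e3 := abs_integral_mul_le_of_eLpNorm hk.2.1.aestronglyMeasurable hkn (by positivity)
        hφ.continuous hφ1 hφ0
      have e4 : √(t + r - (s - r)) ≤ √(t - s + 2 * e) := Real.sqrt_le_sqrt (by linarith)
      have e5 := mul_le_mul_of_nonneg_left e4 (show 0 ≤ ε + e by positivity)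
      rw [e1] at e2
      have e6 := abs_le.1 e2
      have e7 := abs_le.1 e3
      rw [abs_le]
      constructor <;> linarith [e6.1, e6.2, e7.1, e7.2]
    have hlim : Tendsto (fun e : ℝ => (ε + e) * √(t - s + 2 * e) + 2 * e) (𝓝[>] 0)
        (𝓝 (ε * √(t - s))) := by
      have : Continuous fun e : ℝ => (ε + e) * √(t - s + 2 * e) + 2 * e := by fun_prop
      have h1 := this.tendsto 0
      simp only [add_zero, mul_zero] at h1
      exact h1.mono_left nhdsWithin_le_nhds
    refine ge_of_tendsto hlim ?_
    filter_upwards [self_mem_nhdsWithin] with e he using approx e he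
  have symm_case : ∀ s ∈ Ioo 0 P, ∀ t ∈ Ioo 0 P, |deriv f t - deriv f s| ≤ ε * √|t - s| := by
    intro s hs t ht
    rcases le_total s t with h1 | h1
    · rw [abs_of_nonneg (sub_nonneg.2 h1)]
      exact open_case s hs t ht h1
    · rw [abs_sub_comm, abs_sub_comm t s, abs_of_nonneg (sub_nonneg.2 h1)]
      exact open_case t ht s hs h1
  -- The endpoints `0` and `P` are reached by continuity.
  have hcl : ((s, t) : ℝ × ℝ) ∈ closure (Ioo 0 P ×ˢ Ioo 0 P) := by
    rw [closure_prod_eq, closure_Ioo hP.ne]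
    exact ⟨hs, ht⟩
  have hclosed : IsClosed {z : ℝ × ℝ | |deriv f z.2 - deriv f z.1| ≤ ε * √|z.2 - z.1|} :=
    isClosed_le (by fun_prop) (by fun_prop)
  exact closure_minimal (fun z hz => symm_case z.1 hz.1 z.2 hz.2) hclosed hcl

/-! ### Perturbations that start from rest -/

/-- A `C¹` perturbation `r` with derivative `r'` of size `η`, at rest for `t ≤ 0` and periodic
for `t > 0`. -/
structure IsRestPerturbation (P η : ℝ) (r r' : ℝ → ℝ) : Prop where
  hasDerivAt : ∀ t, HasDerivAt r (r' t) t
  bound : ∀ t, |r t| ≤ η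
  bound_deriv : ∀ t, |r' t| ≤ η
  holder : ∀ s t, |r' t - r' s| ≤ η * √|t - s|
  rest : ∀ t, t ≤ 0 → r t = 0
  periodic : ∀ t, 0 < t → r (t + P) = r t

theorem periodic_deriv {f : ℝ → ℝ} {P : ℝ} (hfP : Function.Periodic f P) :
    Function.Periodic (deriv f) P := by
  intro t
  have : f = fun x => f (x + P) := funext fun x => (hfP x).symm
  conv_rhs => rw [this]
  rw [deriv_comp_add_const]

/-- `f'` vanishes at every multiple of `P`, so points of different periods are compared through
zeros lying between them. The two legs account for the factor `2`. -/
theorem abs_deriv_sub_deriv_le_of_periodic {P ε : ℝ} (hP : 0 < P) (hε : 0 ≤ ε) {f : ℝ → ℝ}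
    (hfP : Function.Periodic f P) (h0' : deriv f 0 = 0)
    (h : ∀ s ∈ Icc 0 P, ∀ t ∈ Icc 0 P, |deriv f t - deriv f s| ≤ ε * √|t - s|) (s t : ℝ) :
    |deriv f t - deriv f s| ≤ 2 * ε * √|t - s| := by
  have hper := periodic_deriv hfP
  have hperz : ∀ (k : ℤ) x, deriv f (x - k * P) = deriv f x := fun k x => hper.sub_int_mul_eq k
  have hP' : deriv f P = 0 := by rw [← h0', ← hper 0, zero_add]
  wlog hst : s ≤ t generalizing s t
  · rw [abs_sub_comm, abs_sub_comm t s]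
    exact this t s (le_of_not_ge hst)
  set k := ⌊s / P⌋ with hk
  set m := ⌊t / P⌋ with hm
  have hk1 : k * P ≤ s := (le_div_iff₀ hP).1 (Int.floor_le _)
  have hk2 : s < (k + 1) * P := (div_lt_iff₀ hP).1 (Int.lt_floor_add_one _)
  have hm1 : m * P ≤ t := (le_div_iff₀ hP).1 (Int.floor_le _)
  have hm2 : t < (m + 1) * P := (div_lt_iff₀ hP).1 (Int.lt_floor_add_one _)
  have hkm : k ≤ m := Int.floor_le_floor ((div_le_div_iff_of_pos_right hP).2 hst)
  have hsI : s - k * P ∈ Icc 0 P := ⟨by linarith, by linarith⟩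
  have htI : t - m * P ∈ Icc 0 P := ⟨by linarith, by linarith⟩
  have hsq : 0 ≤ √|t - s| := Real.sqrt_nonneg _
  rcases hkm.eq_or_lt with heq | hlt
  · have := h _ hsI (t - k * P) (by rw [heq]; exact htI)
    rw [hperz, hperz, sub_sub_sub_cancel_right] at this
    nlinarith
  · have hkm' : ((k : ℝ) + 1) * P ≤ m * P := by
      have : (k : ℝ) + 1 ≤ m := by exact_mod_cast hlt
      exact mul_le_mul_of_nonneg_right this hP.le
    have h1 := h 0 (left_mem_Icc.2 hP.le) _ htI
    have h2 := h P (right_mem_Icc.2 hP.le) _ hsI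
    rw [hperz, h0', sub_zero, sub_zero] at h1
    rw [hperz, hP', sub_zero] at h2
    have h3 : √|t - m * P| ≤ √|t - s| := by
      refine Real.sqrt_le_sqrt ?_
      rw [abs_of_nonneg (by linarith), abs_of_nonneg (by linarith)]
      linarith
    have h4 : √|s - k * P - P| ≤ √|t - s| := by
      refine Real.sqrt_le_sqrt ?_
      rw [abs_of_nonpos (by linarith), abs_of_nonneg (by linarith)]
      linarith
    have h5 := mul_le_mul_of_nonneg_left h3 hε
    have h6 := mul_le_mul_of_nonneg_left h4 hε
    refine (abs_sub _ _).trans ?_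
    linarith

/-- The compatibility conditions `f 0 = 0` and `f' 0 = 0` make the extension by zero `C¹`. In the
constant, `2` serves the Hölder bound, `√P` bounds `f'` by its oscillation from `0`, and `P √P`
bounds `f` by the mean value inequality. -/
theorem isRestPerturbation_of_h2Norm {P ε : ℝ} (hP : 0 < P) (hε : 0 ≤ ε) {f : ℝ → ℝ}
    (hf : ContDiff ℝ 1 f) (hfP : Function.Periodic f P) (h0 : f 0 = 0) (h0' : deriv f 0 = 0)
    (h : h2Norm P f ≤ ENNReal.ofReal ε) :
    IsRestPerturbation P ((2 + √P + P * √P) * ε) (fun t => if t ≤ 0 then 0 else f t)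
      (fun t => if t ≤ 0 then 0 else deriv f t) := by
  have hH : ∀ s ∈ Icc 0 P, ∀ t ∈ Icc 0 P, |deriv f t - deriv f s| ≤ ε * √|t - s| :=
    fun s hs t ht => abs_deriv_sub_deriv_le_of_h2Norm hP hε hf h hs ht
  have hH2 := abs_deriv_sub_deriv_le_of_periodic hP hε hfP h0' hH
  have hsP : 0 ≤ √P := Real.sqrt_nonneg _
  have hd : ∀ t ∈ Icc 0 P, |deriv f t| ≤ √P * ε := by
    intro t ht
    have h1 := hH 0 (left_mem_Icc.2 hP.le) t ht
    rw [h0', sub_zero, sub_zero, abs_of_nonneg ht.1] at h1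
    have h2 : √t ≤ √P := Real.sqrt_le_sqrt ht.2
    nlinarith
  have hb : ∀ t ∈ Icc 0 P, |f t| ≤ P * √P * ε := by
    intro t ht
    have h1 := (convex_Icc 0 P).norm_image_sub_le_of_norm_deriv_le
      (fun x _ => hf.differentiable one_ne_zero x) (fun x hx => hd x hx)
      (left_mem_Icc.2 hP.le) ht
    rw [h0, sub_zero, sub_zero, Real.norm_eq_abs, Real.norm_eq_abs, abs_of_nonneg ht.1] at h1
    have h2 : √P * ε * t ≤ √P * ε * P := mul_le_mul_of_nonneg_left ht.2 (by positivity)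
    linarith
  have hPP : 0 ≤ P * √P * ε := by positivity
  have hPP' : 0 ≤ √P * ε := by positivity
  constructor
  · intro t
    rcases lt_trichotomy t 0 with ht | ht | ht
    · rw [if_pos ht.le]
      refine (hasDerivAt_const t (0 : ℝ)).congr_of_eventuallyEq ?_
      filter_upwards [gt_mem_nhds ht] with x hx
      rw [if_pos hx.le]
    · subst ht
      rw [if_pos le_rfl]
      have h1 : HasDerivWithinAt (fun t => if t ≤ 0 then 0 else f t) 0 (Iic 0) 0 :=
        (hasDerivWithinAt_const (0 : ℝ) (Iic 0) (0 : ℝ)).congr (fun x hx => if_pos hx)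
          (if_pos le_rfl)
      have h2 : HasDerivWithinAt (fun t => if t ≤ 0 then 0 else f t) 0 (Ici 0) 0 := by
        have h3 : HasDerivWithinAt f 0 (Ici 0) 0 := by
          have := (hf.differentiable one_ne_zero 0).hasDerivAt
          rw [h0'] at this
          exact this.hasDerivWithinAt
        refine h3.congr (fun x hx => ?_) (by simp [h0])
        by_cases hx0 : x ≤ 0
        · rw [if_pos hx0, le_antisymm hx0 hx, h0]
        · rw [if_neg hx0]
      have h3 := h1.union h2
      rw [Iic_union_Ici, hasDerivWithinAt_univ] at h3
      exact h3
    · rw [if_neg (not_le.2 ht)]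
      refine (hf.differentiable one_ne_zero t).hasDerivAt.congr_of_eventuallyEq ?_
      filter_upwards [lt_mem_nhds ht] with x hx
      rw [if_neg (not_le.2 hx)]
  · intro t
    split_ifs
    · simp only [abs_zero]; positivity
    · obtain ⟨y, hy, hyt⟩ := hfP.exists_mem_Ico₀ hP t
      rw [hyt]
      have := hb y ⟨hy.1, hy.2.le⟩
      nlinarith
  · intro t
    split_ifs
    · simp only [abs_zero]; positivity
    · obtain ⟨y, hy, hyt⟩ := (periodic_deriv hfP).exists_mem_Ico₀ hP t
      rw [hyt]
      have := hd y ⟨hy.1, hy.2.le⟩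
      nlinarith
  · have hle : ∀ s t, 2 * ε * √|t - s| ≤ (2 + √P + P * √P) * ε * √|t - s| := fun s t =>
      mul_le_mul_of_nonneg_right (by nlinarith) (Real.sqrt_nonneg _)
    have hmono : ∀ s t, s ≤ 0 → 0 < t → |deriv f t| ≤ 2 * ε * √|t - s| := by
      intro s t hs ht
      have h1 := hH2 0 t
      rw [h0', sub_zero, sub_zero] at h1
      refine h1.trans (mul_le_mul_of_nonneg_left (Real.sqrt_le_sqrt ?_) (by positivity))
      rw [abs_of_pos ht, abs_of_nonneg (by linarith)]
      linarith
    intro s t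
    refine le_trans ?_ (hle s t)
    split_ifs with ht hs hs
    · simp only [sub_self, abs_zero]; positivity
    · rw [zero_sub, abs_neg, abs_sub_comm t s]
      exact hmono t s ht (not_le.1 hs)
    · rw [sub_zero]
      exact hmono s t hs (not_le.1 ht)
    · exact hH2 s t
  · intro t ht
    rw [if_pos ht]
  · intro t ht
    rw [if_neg (not_le.2 ht), if_neg (not_le.2 (by linarith)), hfP]

end EulerSource
end

noncomputable section
namespace EulerSource
open Filter Topology

variable {ι : Type*}

/-! ### Coefficients with controlled difference quotients -/

/-- Bounded, Lipschitz, with controlled difference quotients on the ball of radius `R`. -/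
structure Tame (R C : ℝ) (G : ℝ → (ι → ℝ) → ℝ) : Prop where
  bound : ∀ t y, (∀ j, |y j| ≤ R) → |G t y| ≤ C
  lip : LipBall R C G
  quot : QuotientHolder R C G

namespace Tame

variable {R C C' : ℝ} {G H : ℝ → (ι → ℝ) → ℝ}

theorem nonneg (hR : 0 ≤ R) (hG : Tame R C G) : 0 ≤ C :=
  (abs_nonneg _).trans (hG.bound 0 (fun _ => 0) (by simpa using fun _ => hR))

theorem mono (hG : Tame R C G) (h : C ≤ C') : Tame R C' G where
  bound t y hy := (hG.bound t y hy).trans h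
  lip t t' y y' w hy hy' hw hyy := (hG.lip t t' y y' w hy hy' hw hyy).trans
    (mul_le_mul_of_nonneg_right h (by positivity))
  quot a b c d ya yb yc yd w hab hcd hw h1 h2 h3 h4 h5 h6 h7 h8 h9 h10 h11 :=
    (hG.quot a b c d ya yb yc yd w hab hcd hw h1 h2 h3 h4 h5 h6 h7 h8 h9 h10 h11).trans
      (mul_le_mul_of_nonneg_right h hw)

/-- Times are `w²`-close and values `w`-close. For `w ≤ 1` the Lipschitz bound suffices since `w² ≤
w`; for `w ≥ 1` the sup bound does. -/
theorem close (hR : 0 ≤ R) (hG : Tame R C G) {a c w : ℝ} {ya yc : ι → ℝ} (hw : 0 ≤ w)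
    (ha : ∀ j, |ya j| ≤ R) (hc : ∀ j, |yc j| ≤ R) (hac : |a - c| ≤ w ^ 2)
    (hy : ∀ j, |ya j - yc j| ≤ w) : |G a ya - G c yc| ≤ 2 * C * w := by
  have hC := hG.nonneg hR
  rcases le_total w 1 with h | h
  · refine (hG.lip a c ya yc w ha hc hw hy).trans ?_
    have : |a - c| + w ≤ 2 * w := by nlinarith
    nlinarith
  · refine (abs_sub _ _).trans ?_
    have h1 := hG.bound a ya ha
    have h2 := hG.bound c yc hc
    nlinarith

theorem quotient_le (hG : Tame R C G) {a b : ℝ} {ya yb : ι → ℝ} (hab : a ≠ b)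
    (ha : ∀ j, |ya j| ≤ R) (hb : ∀ j, |yb j| ≤ R) (hy : ∀ j, |ya j - yb j| ≤ |a - b|) :
    |(G a ya - G b yb) / (a - b)| ≤ 2 * C := by
  rw [abs_div, div_le_iff₀ (abs_pos.2 (sub_ne_zero.2 hab))]
  refine (hG.lip a b ya yb |a - b| ha hb (abs_nonneg _) hy).trans (le_of_eq (by ring))

theorem add (hG : Tame R C G) (hH : Tame R C' H) :
    Tame R (C + C') (fun t y => G t y + H t y) where
  bound t y hy := (abs_add_le _ _).trans (add_le_add (hG.bound t y hy) (hH.bound t y hy))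
  lip t t' y y' w hy hy' hw hyy := by
    rw [add_sub_add_comm, add_mul]
    exact (abs_add_le _ _).trans (add_le_add (hG.lip t t' y y' w hy hy' hw hyy)
      (hH.lip t t' y y' w hy hy' hw hyy))
  quot a b c d ya yb yc yd w hab hcd hw h1 h2 h3 h4 h5 h6 h7 h8 h9 h10 h11 := by
    rw [add_sub_add_comm, add_sub_add_comm, add_div, add_div, add_sub_add_comm, add_mul]
    exact (abs_add_le _ _).trans (add_le_add
      (hG.quot a b c d ya yb yc yd w hab hcd hw h1 h2 h3 h4 h5 h6 h7 h8 h9 h10 h11)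
      (hH.quot a b c d ya yb yc yd w hab hcd hw h1 h2 h3 h4 h5 h6 h7 h8 h9 h10 h11))

theorem mul (hR : 0 ≤ R) (hG : Tame R C G) (hH : Tame R C' H) :
    Tame R (10 * C * C') (fun t y => G t y * H t y) := by
  have hC := hG.nonneg hR
  have hC' := hH.nonneg hR
  have hCC : 0 ≤ C * C' := mul_nonneg hC hC'
  constructor
  · intro t y hy
    rw [abs_mul]
    have := mul_le_mul (hG.bound t y hy) (hH.bound t y hy) (abs_nonneg _) hC
    linarith
  · intro t t' y y' w hy hy' hw hyy
    have h0 : 0 ≤ |t - t'| + w := by positivity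
    refine (abs_mul_sub_mul_le (hG.lip t t' y y' w hy hy' hw hyy) (hH.bound t y hy)
      (hG.bound t' y' hy') (hH.lip t t' y y' w hy hy' hw hyy)).trans ?_
    nlinarith [mul_nonneg hCC h0]
  · intro a b c d ya yb yc yd w hab hcd hw h1 h2 h3 h4 h5 h6 h7 h8 h9 h10 h11
    -- Discrete Leibniz rule. Each of the two products contributes `5 C C' w`, whence the constant
    -- `10`.
    have e : ∀ p q r s x : ℝ, (p * q - r * s) / x = (p - r) / x * q + r * ((q - s) / x) := by
      intro p q r s x; ring
    rw [e, e, add_sub_add_comm]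
    refine (abs_add_le _ _).trans ?_
    have k1 := abs_mul_sub_mul_le
      (hG.quot a b c d ya yb yc yd w hab hcd hw h1 h2 h3 h4 h5 h6 h7 h8 h9 h10 h11)
      (hH.bound a ya h1) (hG.quotient_le hcd h3 h4 h10) (hH.close hR hw h1 h3 h5 h7)
    have k2 := abs_mul_sub_mul_le (hG.close hR hw h2 h4 h6 h8) (hH.quotient_le hab h1 h2 h9)
      (hG.bound d yd h4)
      (hH.quot a b c d ya yb yc yd w hab hcd hw h1 h2 h3 h4 h5 h6 h7 h8 h9 h10 h11)
    refine (add_le_add k1 k2).trans (le_of_eq (by ring))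

theorem const (c : ℝ) : Tame R |c| (fun _ (_ : ι → ℝ) => c) where
  bound _ _ _ := le_rfl
  lip _ _ _ _ _ _ _ _ _ := by rw [sub_self, abs_zero]; positivity
  quot _ _ _ _ _ _ _ _ _ _ _ _ _ _ _ _ _ _ _ _ _ _ _ := by
    simp only [sub_self, zero_div, abs_zero]; positivity

theorem coord (hR : R ≤ 1) (i : ι) : Tame R 1 (fun _ (y : ι → ℝ) => y i) where
  bound _ _ hy := (hy i).trans hR
  lip t t' _ _ w _ _ _ hyy := by
    rw [one_mul]
    exact (hyy i).trans (le_add_of_nonneg_left (abs_nonneg _))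
  quot _ _ _ _ _ _ _ _ _ _ _ _ _ _ _ _ _ _ _ _ _ _ h := by
    rw [one_mul]
    exact h i

theorem inv (hR : 0 ≤ R) (hG : Tame R C G) {m : ℝ} (hm : 0 < m)
    (hGm : ∀ t y, (∀ j, |y j| ≤ R) → m ≤ G t y) :
    ∃ C', Tame R C' (fun t y => (G t y)⁻¹) := by
  have hC := hG.nonneg hR
  have hpos : ∀ t y, (∀ j, |y j| ≤ R) → 0 < G t y := fun t y hy => hm.trans_le (hGm t y hy)
  have hinv : ∀ t y, (∀ j, |y j| ≤ R) → |(G t y)⁻¹| ≤ m⁻¹ := fun t y hy => by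
    rw [abs_of_pos (inv_pos.2 (hpos t y hy))]
    exact inv_anti₀ hm (hGm t y hy)
  have hdiff : ∀ t y t' y' D, (∀ j, |y j| ≤ R) → (∀ j, |y' j| ≤ R) → |G t y - G t' y'| ≤ D →
      |(G t y)⁻¹ - (G t' y')⁻¹| ≤ m⁻¹ * m⁻¹ * D := by
    intro t y t' y' D hy hy' hD
    have e : (G t y)⁻¹ - (G t' y')⁻¹ = -((G t y)⁻¹ * (G t' y')⁻¹ * (G t y - G t' y')) := by
      have := (hpos t y hy).ne'
      have := (hpos t' y' hy').ne'
      field_simp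
      ring
    rw [e, abs_neg, abs_mul, abs_mul]
    exact mul_le_mul (mul_le_mul (hinv t y hy) (hinv t' y' hy') (abs_nonneg _) (by positivity))
      hD (abs_nonneg _) (by positivity)
  have hm' : 0 < m⁻¹ := inv_pos.2 hm
  set n := m⁻¹ with hn
  -- With `n = 1/m`, the summands cover in turn the sup bound, the Lipschitz bound and the quotient
  -- bound.
  refine ⟨n + n * n * C + (n * n * C + 2 * C * (n * (n * n * (2 * C)) + n * (n * n * (2 * C)))),
    ?_, ?_, ?_⟩
  · intro t y hy
    refine (hinv t y hy).trans ?_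
    have : 0 ≤ n * n * C +
      (n * n * C + 2 * C * (n * (n * n * (2 * C)) + n * (n * n * (2 * C)))) := by positivity
    linarith
  · intro t t' y y' w hy hy' hw hyy
    refine (hdiff t y t' y' _ hy hy' (hG.lip t t' y y' w hy hy' hw hyy)).trans ?_
    rw [← mul_assoc]
    refine mul_le_mul_of_nonneg_right ?_ (by positivity)
    have : 0 ≤ n +
      (n * n * C + 2 * C * (n * (n * n * (2 * C)) + n * (n * n * (2 * C)))) := by positivity
    linarith
  · intro a b c d ya yb yc yd w hab hcd hw h1 h2 h3 h4 h5 h6 h7 h8 h9 h10 h11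
    have e : ∀ p q x : ℝ, p ≠ 0 → q ≠ 0 →
        (p⁻¹ - q⁻¹) / x = -((p - q) / x * (p⁻¹ * q⁻¹)) := by
      intro p q x hp hq
      rw [inv_sub_inv hp hq]
      field_simp
      ring
    rw [e _ _ _ (hpos a ya h1).ne' (hpos b yb h2).ne', e _ _ _ (hpos c yc h3).ne' (hpos d yd h4).ne',
      neg_sub_neg, abs_sub_comm]
    have k := abs_mul_sub_mul_le (hdiff a ya c yc _ h1 h3 (hG.close hR hw h1 h3 h5 h7))
      (hinv b yb h2) (hinv c yc h3) (hdiff b yb d yd _ h2 h4 (hG.close hR hw h2 h4 h6 h8))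
    refine (abs_mul_sub_mul_le (q := n * n)
      (hG.quot a b c d ya yb yc yd w hab hcd hw h1 h2 h3 h4 h5 h6 h7 h8 h9 h10 h11)
      ?_ (hG.quotient_le hcd h3 h4 h10) k).trans ?_
    · rw [abs_mul]
      exact mul_le_mul (hinv a ya h1) (hinv b yb h2) (abs_nonneg _) (by positivity)
    · have : 0 ≤ (n + n * n * C) * w := by positivity
      nlinarith

end Tame

/-- A difference quotient is the average of `F'` over its segment. The mean value inequality in the
segment parameter `θ` replaces that integral, and points with equal `θ` on the two segments stay
within `r`. -/
theorem quotient_sub_quotient_le {F F' : ℝ → ℝ} {K : ℝ} (hK : 0 ≤ K)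
    (hF : ∀ t, HasDerivAt F (F' t) t) (hF' : ∀ s t, |F' t - F' s| ≤ K * √|t - s|)
    {a b c d r : ℝ} (hab : a ≠ b) (hcd : c ≠ d) (hac : |a - c| ≤ r) (hbd : |b - d| ≤ r) :
    |(F a - F b) / (a - b) - (F c - F d) / (c - d)| ≤ K * √r := by
  have h1 : a - b ≠ 0 := sub_ne_zero.2 hab
  have h2 : c - d ≠ 0 := sub_ne_zero.2 hcd
  have hline : ∀ p q θ : ℝ, HasDerivAt (fun θ => q + θ * (p - q)) (p - q) θ := by
    intro p q θ
    simpa using ((hasDerivAt_id θ).mul_const (p - q)).const_add q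
  have hd : ∀ θ ∈ Icc (0 : ℝ) 1, HasDerivWithinAt
      (fun θ => F (b + θ * (a - b)) / (a - b) - F (d + θ * (c - d)) / (c - d))
      (F' (b + θ * (a - b)) - F' (d + θ * (c - d))) (Icc 0 1) θ := by
    intro θ _
    have e1 := ((hF (b + θ * (a - b))).comp θ (hline a b θ)).div_const (a - b)
    have e2 := ((hF (d + θ * (c - d))).comp θ (hline c d θ)).div_const (c - d)
    rw [mul_div_cancel_right₀ _ h1] at e1
    rw [mul_div_cancel_right₀ _ h2] at e2
    exact (e1.sub e2).hasDerivWithinAt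
  have key := (convex_Icc (0 : ℝ) 1).norm_image_sub_le_of_norm_hasDerivWithin_le (C := K * √r) hd
    (fun θ hθ => ?_) (left_mem_Icc.2 zero_le_one) (right_mem_Icc.2 zero_le_one)
  · have e : F (b + 1 * (a - b)) / (a - b) - F (d + 1 * (c - d)) / (c - d)
        - (F (b + 0 * (a - b)) / (a - b) - F (d + 0 * (c - d)) / (c - d))
        = (F a - F b) / (a - b) - (F c - F d) / (c - d) := by
      simp only [one_mul, zero_mul, add_zero, add_sub_cancel]
      ring
    rw [e] at key
    simpa using key
  · rw [Real.norm_eq_abs]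
    refine (hF' _ _).trans (mul_le_mul_of_nonneg_left (Real.sqrt_le_sqrt ?_) hK)
    have e : b + θ * (a - b) - (d + θ * (c - d)) = (1 - θ) * (b - d) + θ * (a - c) := by ring
    rw [e]
    refine (abs_add_le _ _).trans ?_
    rw [abs_mul, abs_mul, abs_of_nonneg (sub_nonneg.2 hθ.2), abs_of_nonneg hθ.1]
    nlinarith [mul_le_mul_of_nonneg_left hbd (sub_nonneg.2 hθ.2),
      mul_le_mul_of_nonneg_left hac hθ.1]

theorem sub_le_of_hasDerivAt {F F' : ℝ → ℝ} {K : ℝ} (hF : ∀ t, HasDerivAt F (F' t) t)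
    (hF' : ∀ t, |F' t| ≤ K) (s t : ℝ) : |F s - F t| ≤ K * |s - t| := by
  simpa using convex_univ.norm_image_sub_le_of_norm_hasDerivWithin_le (f := F) (f' := F')
    (fun x _ => (hF x).hasDerivWithinAt) (fun x _ => by simpa using hF' x) (mem_univ t) (mem_univ s)

/-- A bounded Lipschitz derivative is Hölder-`1/2`, by the Lipschitz bound at short distance and the
sup bound at long distance. With `r = w²` this is the required quotient bound. -/
theorem Tame.of_time {R : ℝ} {h h' : ℝ → ℝ} {C : ℝ} (hd : ∀ t, HasDerivAt h (h' t) t)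
    (hb : ∀ t, |h t| ≤ C) (hb' : ∀ t, |h' t| ≤ C) (hl : ∀ s t, |h' s - h' t| ≤ C * |s - t|) :
    Tame R (2 * C) (fun t (_ : ι → ℝ) => h t) := by
  have hC : 0 ≤ C := (abs_nonneg _).trans (hb 0)
  constructor
  · intro t y _
    linarith [hb t]
  · intro t t' y y' w _ _ hw _
    refine (sub_le_of_hasDerivAt hd hb' t t').trans ?_
    nlinarith [abs_nonneg (t - t'), mul_nonneg hC (abs_nonneg (t - t')), mul_nonneg hC hw]
  · intro a b c d ya yb yc yd w hab hcd hw _ _ _ _ h5 h6 _ _ _ _ _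
    have := quotient_sub_quotient_le (F := h) (F' := h') (K := 2 * C) (by positivity) hd
      (fun s t => ?_) hab hcd h5 h6
    · rwa [Real.sqrt_sq hw] at this
    · have hsq := Real.sq_sqrt (abs_nonneg (t - s))
      have hs0 := Real.sqrt_nonneg |t - s|
      rcases le_total √|t - s| 1 with h1 | h1
      · refine (hl t s).trans ?_
        have : |t - s| ≤ √|t - s| := by nlinarith
        nlinarith
      · refine (abs_sub _ _).trans ?_
        have := hb' t
        have := hb' s
        nlinarith

theorem exists_bound_of_periodic {h : ℝ → ℝ} {P : ℝ} (hP : 0 < P) (hc : Continuous h)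
    (hp : Function.Periodic h P) : ∃ C, ∀ t, |h t| ≤ C := by
  obtain ⟨C, hC⟩ := (isCompact_Icc (a := (0 : ℝ)) (b := P)).exists_bound_of_continuousOn
    hc.continuousOn
  refine ⟨C, fun t => ?_⟩
  obtain ⟨y, hy, hyt⟩ := hp.exists_mem_Ico₀ hP t
  rw [hyt]
  exact hC y ⟨hy.1, hy.2.le⟩

theorem exists_tame_of_periodic {R : ℝ} {h : ℝ → ℝ} {P : ℝ} (hP : 0 < P) (hc : ContDiff ℝ 2 h)
    (hp : Function.Periodic h P) : ∃ C, Tame R C (fun t (_ : ι → ℝ) => h t) := by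
  have hp' : Function.Periodic (deriv h) P := periodic_deriv hp
  have hp'' : Function.Periodic (deriv (deriv h)) P := periodic_deriv hp'
  have hd1 : ContDiff ℝ 1 (deriv h) := by
    have : ContDiff ℝ (1 + 1) h := by simpa [one_add_one_eq_two] using hc
    exact (contDiff_succ_iff_deriv.1 this).2.2
  obtain ⟨C₀, h0⟩ := exists_bound_of_periodic hP hc.continuous hp
  obtain ⟨C₁, h1⟩ := exists_bound_of_periodic hP hd1.continuous hp'
  obtain ⟨C₂, h2⟩ := exists_bound_of_periodic hP (hd1.continuous_deriv le_rfl) hp''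
  set C := max C₀ (max C₁ C₂) with hC
  refine ⟨2 * C, Tame.of_time (h' := deriv h)
    (fun t => (hc.differentiable two_ne_zero t).hasDerivAt)
    (fun t => (h0 t).trans (le_max_left _ _))
    (fun t => (h1 t).trans ((le_max_left _ _).trans (le_max_right _ _))) (fun s t => ?_)⟩
  exact sub_le_of_hasDerivAt (fun t => (hd1.differentiable one_ne_zero t).hasDerivAt)
    (fun t => (h2 t).trans ((le_max_right _ _).trans (le_max_right _ _))) s t

/-! ### The Euler system in perturbed Riemann invariants -/

section background

variable {α : ℝ → ℝ} {u₀ P : ℝ}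

theorem hasDerivAt_backgroundVelocity (hα : Continuous α) (t : ℝ) :
    HasDerivAt (backgroundVelocity α u₀) (α t * backgroundVelocity α u₀ t) t := by
  have h1 : HasDerivAt (fun t => ∫ s in (0 : ℝ)..t, α s) (α t) t :=
    intervalIntegral.integral_hasDerivAt_right (hα.intervalIntegrable _ _)
      (hα.stronglyMeasurableAtFilter _ _) hα.continuousAt
  refine (h1.exp.mul_const u₀).congr_deriv ?_
  rw [backgroundVelocity]; ring

theorem contDiff_backgroundVelocity (hα : ContDiff ℝ 2 α) :
    ContDiff ℝ 2 (backgroundVelocity α u₀) := by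
  have h1 : ContDiff ℝ (1 + 1) (fun t => ∫ s in (0 : ℝ)..t, α s) := by
    have hd : ∀ t, HasDerivAt (fun t => ∫ s in (0 : ℝ)..t, α s) (α t) t := fun t =>
      intervalIntegral.integral_hasDerivAt_right (hα.continuous.intervalIntegrable _ _)
        (hα.continuous.stronglyMeasurableAtFilter _ _) hα.continuous.continuousAt
    refine contDiff_succ_iff_deriv.2 ⟨fun t => (hd t).differentiableAt, by simp, ?_⟩
    rw [show deriv (fun t => ∫ s in (0 : ℝ)..t, α s) = α from funext fun t => (hd t).deriv]
    exact hα.of_le one_le_two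
  rw [one_add_one_eq_two] at h1
  exact h1.exp.mul contDiff_const

theorem periodic_backgroundVelocity (hα : Continuous α) (hαP : Function.Periodic α P)
    (hmean : ∫ s in (0 : ℝ)..P, α s = 0) :
    Function.Periodic (backgroundVelocity α u₀) P := by
  intro t
  have h1 : ∫ s in (0 : ℝ)..(t + P), α s = ∫ s in (0 : ℝ)..t, α s := by
    rw [← intervalIntegral.integral_add_adjacent_intervals (hα.intervalIntegrable 0 t)
      (hα.intervalIntegrable t (t + P)), hαP.intervalIntegral_add_eq t 0, zero_add, hmean, add_zero]
  rw [backgroundVelocity, backgroundVelocity, h1]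

/-- Nonnegativity of the integral is assumed only for `t ≥ 0`; periodicity carries the bound to
negative times, where the extended problem also lives. -/
theorem le_backgroundVelocity (hP : 0 < P) (hα : Continuous α) (hαP : Function.Periodic α P)
    (hmean : ∫ s in (0 : ℝ)..P, α s = 0) (hnn : ∀ t : ℝ, 0 ≤ t → 0 ≤ ∫ s in (0 : ℝ)..t, α s)
    (hu₀ : 0 ≤ u₀) (t : ℝ) : u₀ ≤ backgroundVelocity α u₀ t := by
  obtain ⟨y, hy, hyt⟩ := (periodic_backgroundVelocity (u₀ := u₀) hα hαP hmean).exists_mem_Ico₀ hP t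
  rw [hyt, backgroundVelocity]
  exact le_mul_of_one_le_left hu₀ (Real.one_le_exp (hnn y hy.1))

end background

/-- The sign of a characteristic family: `-1` for `u - c`, `1` for `u + c`. -/
def familySign (i : Bool) : ℝ := if i then 1 else -1

theorem abs_familySign (i : Bool) : |familySign i| = 1 := by
  cases i <;> simp [familySign]

/-- The velocity perturbation in terms of the perturbed Riemann invariants. -/
def velocityPart (y : Bool → ℝ) : ℝ := (y false + y true) / 2

/-- The sound speed perturbation in terms of the perturbed Riemann invariants. -/
def soundPart (γ : ℝ) (y : Bool → ℝ) : ℝ := (γ - 1) / 4 * (y true - y false)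

/-- The characteristic speeds `u ∓ c` over a background with velocity `U` and sound speed `c₀`. -/
def charSpeed (γ c₀ : ℝ) (U : ℝ → ℝ) (i : Bool) (t : ℝ) (y : Bool → ℝ) : ℝ :=
  U t + velocityPart y + familySign i * (c₀ + soundPart γ y)

/-- The inverse characteristic speeds. -/
def slowness (γ c₀ : ℝ) (U : ℝ → ℝ) (i : Bool) (t : ℝ) (y : Bool → ℝ) : ℝ :=
  (charSpeed γ c₀ U i t y)⁻¹

/-- The source of the system evolving in space. -/
def source (γ c₀ : ℝ) (U α : ℝ → ℝ) (i : Bool) (t : ℝ) (y : Bool → ℝ) : ℝ :=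
  slowness γ c₀ U i t y * α t * velocityPart y

theorem abs_velocityPart_le {y : Bool → ℝ} {R : ℝ} (hy : ∀ j, |y j| ≤ R) :
    |velocityPart y| ≤ R := by
  have h1 := abs_le.1 (hy false)
  have h2 := abs_le.1 (hy true)
  rw [velocityPart, abs_le]
  constructor <;> linarith [h1.1, h1.2, h2.1, h2.2]

theorem abs_velocityPart_sub_le {y y' : Bool → ℝ} {w : ℝ} (hy : ∀ j, |y j - y' j| ≤ w) :
    |velocityPart y - velocityPart y'| ≤ w := by
  have := abs_velocityPart_le (y := fun j => y j - y' j) hy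
  refine le_of_eq_of_le ?_ this
  simp only [velocityPart]
  congr 1
  ring

theorem abs_soundPart_le {γ : ℝ} (hγ : 1 < γ) {y : Bool → ℝ} {R : ℝ} (hy : ∀ j, |y j| ≤ R) :
    |soundPart γ y| ≤ (γ - 1) / 2 * R := by
  have h1 := abs_le.1 (hy false)
  have h2 := abs_le.1 (hy true)
  have h3 : |y true - y false| ≤ 2 * R := by
    rw [abs_le]; constructor <;> linarith [h1.1, h1.2, h2.1, h2.2]
  rw [soundPart, abs_mul, abs_of_pos (by linarith)]
  nlinarith

/-- A perturbation of size `R` changes `u ∓ c` by at most `R (1 + (γ - 1)/2)`, hence uses at most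
half of the supersonic gap. -/
theorem charSpeed_ge {γ c₀ u₀ R : ℝ} (hγ : 1 < γ) {U : ℝ → ℝ}
    (hU : ∀ t, u₀ ≤ U t) (hc₀ : 0 < c₀) (hR2 : R * (1 + (γ - 1) / 2) ≤ (u₀ - c₀) / 2)
    (i : Bool) (t : ℝ) {y : Bool → ℝ} (hy : ∀ j, |y j| ≤ R) :
    (u₀ - c₀) / 2 ≤ charSpeed γ c₀ U i t y := by
  have h1 := abs_le.1 (abs_velocityPart_le hy)
  have h2 := abs_le.1 (abs_soundPart_le hγ hy)
  have h3 := hU t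
  rw [charSpeed]
  cases i
  · simp only [familySign, Bool.false_eq_true, if_false]
    linarith [h1.1, h2.2]
  · simp only [familySign, if_true]
    linarith [h1.1, h2.1]

/-- Speeds are built from tame pieces and bounded below, so their inverses are tame too. The source
is a tame factor times the linear `velocityPart`, which yields the bounds proportional to the size
of `v`. -/
theorem exists_isSystem {γ c₀ u₀ R P : ℝ} (hγ : 1 < γ) (hP : 0 < P) {α U : ℝ → ℝ}
    (hα : ContDiff ℝ 2 α) (hαP : Function.Periodic α P) (hUc : ContDiff ℝ 2 U)
    (hUP : Function.Periodic U P) (hU : ∀ t, u₀ ≤ U t) (hc₀ : 0 < c₀) (hcu : c₀ < u₀)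
    (hR : 0 < R) (hR1 : R ≤ 1) (hR2 : R * (1 + (γ - 1) / 2) ≤ (u₀ - c₀) / 2) :
    ∃ C, 1 ≤ C ∧ IsSystem R C P (slowness γ c₀ U) (source γ c₀ U α) := by
  obtain ⟨CU, hCU⟩ := exists_tame_of_periodic (ι := Bool) (R := R) hP hUc hUP
  obtain ⟨Cα, hCα⟩ := exists_tame_of_periodic (ι := Bool) (R := R) hP hα hαP
  have hvel : ∃ C, Tame R C (fun _ y => velocityPart y) := by
    have := (((Tame.coord (R := R) hR1 false).add (Tame.coord hR1 true)).mul hR.le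
      (Tame.const (1 / 2)))
    have e : (fun (_ : ℝ) y => velocityPart y) =
        fun (_ : ℝ) (y : Bool → ℝ) => (y false + y true) * (1 / 2) := by
      funext _ y; rw [velocityPart]; ring
    rw [e]
    exact ⟨_, this⟩
  obtain ⟨CV, hCV⟩ := hvel
  have hsound : ∃ C, Tame R C (fun _ y => soundPart γ y) := by
    have := ((Tame.coord (R := R) hR1 true).add ((Tame.const (-1)).mul hR.le
      (Tame.coord hR1 false)))
    have := (Tame.const ((γ - 1) / 4)).mul hR.le this
    have e : (fun (_ : ℝ) y => soundPart γ y) =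
        fun (_ : ℝ) (y : Bool → ℝ) => (γ - 1) / 4 * (y true + -1 * y false) := by
      funext _ y; rw [soundPart]; ring
    rw [e]
    exact ⟨_, this⟩
  obtain ⟨CS, hCS⟩ := hsound
  have hm : 0 < (u₀ - c₀) / 2 := by linarith
  have hslow : ∀ i, ∃ C, Tame R C (slowness γ c₀ U i) := fun i =>
    ((hCU.add hCV).add ((Tame.const (familySign i)).mul hR.le ((Tame.const c₀).add hCS))).inv
      hR.le hm (fun t y hy => charSpeed_ge hγ hU hc₀ hR2 i t hy)
  choose Cs hCs using hslow
  have hψ : ∀ i, Tame R (10 * Cs i * Cα) (fun t y => slowness γ c₀ U i t y * α t) := fun i =>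
    (hCs i).mul hR.le hCα
  have hf : ∀ i, Tame R (10 * (10 * Cs i * Cα) * CV) (source γ c₀ U α i) := fun i =>
    (hψ i).mul hR.le hCV
  obtain ⟨D, hD1, hDs, hDψ, hDf⟩ : ∃ D, 1 ≤ D ∧ (∀ i, Cs i ≤ D) ∧ (∀ i, 10 * Cs i * Cα ≤ D) ∧
      ∀ i, 10 * (10 * Cs i * Cα) * CV ≤ D := by
    have hle : ∀ h : Bool → ℝ, ∀ i, h i ≤ |h false| + |h true| := by
      intro h i
      cases i
      · linarith [le_abs_self (h false), abs_nonneg (h true)]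
      · linarith [le_abs_self (h true), abs_nonneg (h false)]
    set p := fun i => Cs i
    set q := fun i => 10 * Cs i * Cα
    set r := fun i => 10 * (10 * Cs i * Cα) * CV
    refine ⟨1 + (|p false| + |p true|) + (|q false| + |q true|) + (|r false| + |r true|),
      ?_, ?_, ?_, ?_⟩
    · have : 0 ≤ (|p false| + |p true|) + (|q false| + |q true|) + (|r false| + |r true|) := by
        positivity
      linarith
    · intro i
      refine (hle p i).trans ?_
      have : 0 ≤ (|q false| + |q true|) + (|r false| + |r true|) := by positivity
      linarith
    · intro i
      refine (hle q i).trans ?_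
      have : 0 ≤ (|p false| + |p true|) + (|r false| + |r true|) := by positivity
      linarith
    · intro i
      refine (hle r i).trans ?_
      have : 0 ≤ (|p false| + |p true|) + (|q false| + |q true|) := by positivity
      linarith
  have hs2 : ∀ i, Tame R (2 * D) (slowness γ c₀ U i) := fun i =>
    (hCs i).mono ((hDs i).trans (by linarith))
  have hψD : ∀ i, Tame R D (fun t y => slowness γ c₀ U i t y * α t) := fun i =>
    (hψ i).mono (hDψ i)
  have hf2 : ∀ i, Tame R (2 * D) (source γ c₀ U α i) := fun i =>
    (hf i).mono ((hDf i).trans (by linarith))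
  -- The factor `2` pays for `source_lip`, where `w` appears once from the tame factor and once from
  -- `velocityPart`.
  refine ⟨2 * D, by linarith, ?_⟩
  constructor
  · intro i t y hy
    exact (inv_pos.2 (hm.trans_le (charSpeed_ge hγ hU hc₀ hR2 i t hy))).le
  · intro i t y hy
    exact (le_abs_self _).trans ((hs2 i).bound t y hy)
  · exact fun i => (hs2 i).lip
  · exact fun i => (hs2 i).quot
  · intro i t y
    simp only [slowness, charSpeed, hUP t]
  · intro i t y w hy hw hyw
    rw [source, abs_mul]
    have h1 := (hψD i).bound t y hy
    have h2 := abs_velocityPart_le hyw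
    have := mul_le_mul h1 h2 (abs_nonneg _) (by linarith)
    nlinarith
  · intro i t t' y y' b w hy hy' hyb hyb' hb hw hyy
    have h1 := (hψD i).lip t t' y y' w hy hy' hw hyy
    have hvb := abs_velocityPart_le hyb
    have hv1 := (abs_velocityPart_le hy).trans hR1
    have h2 := abs_mul_sub_mul_le h1 (le_refl |velocityPart y|) ((hψD i).bound t' y' hy')
      (abs_velocityPart_sub_le hyy)
    refine h2.trans ?_
    have h3 : (|t - t'| + w) * |velocityPart y| ≤ b * |t - t'| + w := by
      nlinarith [abs_nonneg (t - t'), mul_le_mul_of_nonneg_left hvb (abs_nonneg (t - t')),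
        mul_le_mul_of_nonneg_left hv1 hw]
    have h4 := mul_le_mul_of_nonneg_left h3 (show 0 ≤ D by linarith)
    have h5 : 0 ≤ D * (b * |t - t'|) := by positivity
    nlinarith
  · exact fun i => (hf2 i).quot
  · intro i t y
    simp only [source, slowness, charSpeed, hUP t, hαP t]

end EulerSource
end

noncomputable section
namespace EulerSource
open Filter Topology

/-! ### Partial derivatives on the space-time domain -/

/-- `F` is differentiable at `z` within `domain L`, with time derivative `Ft` and space
derivative `Fx`. -/
def HasPartials (L : ℝ) (F : ℝ × ℝ → ℝ) (z : ℝ × ℝ) (Ft Fx : ℝ) : Prop :=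
  HasFDerivWithinAt F (Ft • ContinuousLinearMap.fst ℝ ℝ ℝ + Fx • ContinuousLinearMap.snd ℝ ℝ ℝ)
    (domain L) z

theorem uniqueDiffOn_domain {L : ℝ} (hL : 0 < L) : UniqueDiffOn ℝ (domain L) :=
  (uniqueDiffOn_Ici 0).prod (uniqueDiffOn_Icc hL)

namespace HasPartials

variable {L : ℝ} {F G : ℝ × ℝ → ℝ} {z : ℝ × ℝ} {Ft Fx Gt Gx : ℝ}

theorem add (hF : HasPartials L F z Ft Fx) (hG : HasPartials L G z Gt Gx) :
    HasPartials L (fun w => F w + G w) z (Ft + Gt) (Fx + Gx) := by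
  refine (HasFDerivWithinAt.add hF hG).congr_fderiv ?_
  ext <;> simp

theorem sub (hF : HasPartials L F z Ft Fx) (hG : HasPartials L G z Gt Gx) :
    HasPartials L (fun w => F w - G w) z (Ft - Gt) (Fx - Gx) := by
  refine (HasFDerivWithinAt.sub hF hG).congr_fderiv ?_
  ext <;> simp

theorem mul (hF : HasPartials L F z Ft Fx) (hG : HasPartials L G z Gt Gx) :
    HasPartials L (fun w => F w * G w) z (Ft * G z + F z * Gt) (Fx * G z + F z * Gx) := by
  refine (HasFDerivWithinAt.mul hF hG).congr_fderiv ?_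
  ext <;> simp <;> ring

theorem const_mul (c : ℝ) (hF : HasPartials L F z Ft Fx) :
    HasPartials L (fun w => c * F w) z (c * Ft) (c * Fx) := by
  refine (HasFDerivWithinAt.const_mul hF c).congr_fderiv ?_
  ext <;> simp

theorem sub_const (c : ℝ) (hF : HasPartials L F z Ft Fx) :
    HasPartials L (fun w => F w - c) z Ft Fx := HasFDerivWithinAt.sub_const c hF

theorem const_add (c : ℝ) (hF : HasPartials L F z Ft Fx) :
    HasPartials L (fun w => c + F w) z Ft Fx := HasFDerivWithinAt.const_add c hF

theorem comp {φ : ℝ → ℝ} {φ' : ℝ} (hφ : HasDerivAt φ φ' (F z)) (hF : HasPartials L F z Ft Fx) :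
    HasPartials L (fun w => φ (F w)) z (φ' * Ft) (φ' * Fx) := by
  refine (hφ.comp_hasFDerivWithinAt z hF).congr_fderiv ?_
  ext <;> simp

theorem of_time {h : ℝ → ℝ} {h' : ℝ} (hh : HasDerivAt h h' z.1) :
    HasPartials L (fun w => h w.1) z h' 0 := by
  refine (hh.comp_hasFDerivWithinAt z hasFDerivWithinAt_fst).congr_fderiv ?_
  ext <;> simp

theorem time (hF : HasPartials L F z Ft Fx) (hz : z ∈ domain L) :
    HasDerivWithinAt (fun t => F (t, z.2)) Ft (Ici 0) z.1 := by
  have h1 : HasDerivWithinAt (fun t : ℝ => (t, z.2)) ((1 : ℝ), (0 : ℝ)) (Ici 0) z.1 :=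
    (hasDerivWithinAt_id _ _).prodMk (hasDerivWithinAt_const _ _ _)
  have hF' : HasFDerivWithinAt F (Ft • ContinuousLinearMap.fst ℝ ℝ ℝ +
    Fx • ContinuousLinearMap.snd ℝ ℝ ℝ) (domain L) (z.1, z.2) := hF
  have := hF'.comp_hasDerivWithinAt (f := fun t => (t, z.2)) z.1 h1 (fun t ht => ⟨ht, hz.2⟩)
  exact this.congr_deriv (by simp)

theorem space (hF : HasPartials L F z Ft Fx) (hz : z ∈ domain L) :
    HasDerivWithinAt (fun x => F (z.1, x)) Fx (Icc 0 L) z.2 := by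
  have h1 : HasDerivWithinAt (fun x : ℝ => (z.1, x)) ((0 : ℝ), (1 : ℝ)) (Icc 0 L) z.2 :=
    (hasDerivWithinAt_const _ _ _).prodMk (hasDerivWithinAt_id _ _)
  have hF' : HasFDerivWithinAt F (Ft • ContinuousLinearMap.fst ℝ ℝ ℝ +
    Fx • ContinuousLinearMap.snd ℝ ℝ ℝ) (domain L) (z.1, z.2) := hF
  have := hF'.comp_hasDerivWithinAt (f := fun x => (z.1, x)) z.2 h1 (fun x hx => ⟨hz.1, hx⟩)
  exact this.congr_deriv (by simp)

theorem dt_eq (hF : HasPartials L F z Ft Fx) (hz : z ∈ domain L) : dt F z = Ft :=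
  (hF.time hz).derivWithin (uniqueDiffOn_Ici 0 z.1 hz.1)

theorem dx_eq (hL : 0 < L) (hF : HasPartials L F z Ft Fx) (hz : z ∈ domain L) : dx L F z = Fx :=
  (hF.space hz).derivWithin (uniqueDiffOn_Icc hL z.2 hz.2)

theorem of_fderivWithin (hF : DifferentiableWithinAt ℝ F (domain L) z) :
    HasPartials L F z (fderivWithin ℝ F (domain L) z (1, 0))
      (fderivWithin ℝ F (domain L) z (0, 1)) := by
  refine hF.hasFDerivWithinAt.congr_fderiv ?_
  ext <;> simp

theorem of_contDiffOn (hL : 0 < L) (hF : ContDiffOn ℝ 1 F (domain L)) (hz : z ∈ domain L) :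
    HasPartials L F z (dt F z) (dx L F z) := by
  have h := of_fderivWithin (hF.differentiableOn one_ne_zero z hz)
  rwa [h.dt_eq hz, h.dx_eq hL hz]

end HasPartials

theorem continuousOn_dx {L : ℝ} (hL : 0 < L) {F : ℝ × ℝ → ℝ} (hF : ContDiffOn ℝ 1 F (domain L)) :
    ContinuousOn (dx L F) (domain L) := by
  have h1 := hF.continuousOn_fderivWithin (uniqueDiffOn_domain hL) le_rfl
  refine (h1.clm_apply (continuousOn_const (c := ((0 : ℝ), (1 : ℝ))))).congr fun z hz => ?_
  exact (HasPartials.of_fderivWithin (hF.differentiableOn one_ne_zero z hz)).dx_eq hL hz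

/-! ### Sound speed and Riemann invariants -/

/-- The sound speed `√(a γ) ρ^((γ - 1) / 2)`. -/
def soundSpeed (a γ ρ : ℝ) : ℝ := √(a * γ) * ρ ^ ((γ - 1) / 2)

section

variable {a γ : ℝ}

theorem sqrt_mul_pos (ha : 0 < a) (hγ : 1 < γ) : 0 < √(a * γ) :=
  Real.sqrt_pos.2 (mul_pos ha (by linarith))

theorem soundSpeed_pos (ha : 0 < a) (hγ : 1 < γ) {ρ : ℝ} (hρ : 0 < ρ) : 0 < soundSpeed a γ ρ :=
  mul_pos (sqrt_mul_pos ha hγ) (Real.rpow_pos_of_pos hρ _)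

theorem soundSpeed_sq (ha : 0 < a) (hγ : 1 < γ) {ρ : ℝ} (hρ : 0 < ρ) :
    soundSpeed a γ ρ ^ 2 = a * γ * ρ ^ (γ - 1) := by
  rw [soundSpeed, mul_pow, Real.sq_sqrt (by nlinarith), ← Real.rpow_natCast, ← Real.rpow_mul hρ.le]
  norm_num

theorem hasDerivAt_soundSpeed {ρ : ℝ} (hρ : 0 < ρ) :
    HasDerivAt (soundSpeed a γ) ((γ - 1) / 2 * (soundSpeed a γ ρ / ρ)) ρ := by
  refine ((Real.hasDerivAt_rpow_const (p := (γ - 1) / 2) (Or.inl hρ.ne')).const_mul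
    (√(a * γ))).congr_deriv ?_
  rw [soundSpeed, Real.rpow_sub_one hρ.ne']
  ring

theorem soundSpeed_injOn (ha : 0 < a) (hγ : 1 < γ) : InjOn (soundSpeed a γ) (Ici 0) := by
  intro x hx y hy hxy
  have h1 := mul_left_cancel₀ (sqrt_mul_pos ha hγ).ne' hxy
  exact (Real.rpow_left_inj hx hy (by linarith)).1 h1

/-- The Riemann invariants `u ∓ 2 c / (γ - 1)`. -/
def riemann (a γ : ℝ) (ρ u : ℝ × ℝ → ℝ) (i : Bool) (z : ℝ × ℝ) : ℝ :=
  u z + familySign i * (2 / (γ - 1) * soundSpeed a γ (ρ z))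

theorem familySign_mul_self (i : Bool) : familySign i * familySign i = 1 := by
  cases i <;> simp [familySign]

theorem hasPartials_pressure {L : ℝ} {ρ : ℝ × ℝ → ℝ} {z : ℝ × ℝ} {ρt ρx : ℝ} (hρ : 0 < ρ z)
    (h : HasPartials L ρ z ρt ρx) :
    HasPartials L (fun w => a * ρ w ^ γ) z (a * (γ * ρ z ^ (γ - 1) * ρt))
      (a * (γ * ρ z ^ (γ - 1) * ρx)) :=
  (h.comp (Real.hasDerivAt_rpow_const (p := γ) (Or.inl hρ.ne'))).const_mul a

theorem hasPartials_sq {L : ℝ} {u : ℝ × ℝ → ℝ} {z : ℝ × ℝ} {ut ux : ℝ}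
    (h : HasPartials L u z ut ux) :
    HasPartials L (fun w => u w ^ 2) z (2 * u z * ut) (2 * u z * ux) := by
  have := h.comp (hasDerivAt_pow 2 (u z))
  simpa using this

/-- Momentum minus `u` times mass is the velocity equation multiplied by `ρ`. Adding `σ c` times
mass and using `σ² = 1` and `c² = a γ ρ^(γ-1)` gives the characteristic form. -/
theorem riemann_eq_of_euler (ha : 0 < a) (hγ : 1 < γ) {ρ u ρt ρx ut ux α σ : ℝ} (hρ : 0 < ρ)
    (hσ : σ * σ = 1) (hmass : ρt + (ρx * u + ρ * ux) = 0)
    (hmom : ρt * u + ρ * ut + (ρx * u ^ 2 + ρ * (2 * u * ux) + a * (γ * ρ ^ (γ - 1) * ρx))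
      = α * ρ * u) :
    ut + σ * (soundSpeed a γ ρ / ρ * ρt) + (u + σ * soundSpeed a γ ρ) *
      (ux + σ * (soundSpeed a γ ρ / ρ * ρx)) = α * u := by
  have hc := soundSpeed_sq ha hγ hρ
  set c := soundSpeed a γ ρ
  have h1 : a * (γ * ρ ^ (γ - 1) * ρx) = c ^ 2 * ρx := by rw [hc]; ring
  rw [h1] at hmom
  have h2 : ρ * (ut + u * ux) + c ^ 2 * ρx = α * ρ * u := by linear_combination hmom - u * hmass
  have h3 : ρ * (ut + σ * (c / ρ * ρt) + (u + σ * c) * (ux + σ * (c / ρ * ρx)))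
      = ρ * (α * u) := by
    have e : ρ * (ut + σ * (c / ρ * ρt) + (u + σ * c) * (ux + σ * (c / ρ * ρx)))
        = ρ * ut + σ * c * ρt + (u + σ * c) * (ρ * ux + σ * c * ρx) := by
      field_simp
    rw [e]
    linear_combination h2 + σ * c * hmass + c ^ 2 * ρx * hσ
  exact mul_left_cancel₀ hρ.ne' h3

theorem hasPartials_riemann {L : ℝ} (hγ : 1 < γ) {ρ u : ℝ × ℝ → ℝ} {z : ℝ × ℝ} {ρt ρx ut ux : ℝ}
    (hρz : 0 < ρ z) (hρ : HasPartials L ρ z ρt ρx) (hu : HasPartials L u z ut ux) (i : Bool) :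
    HasPartials L (riemann a γ ρ u i) z
      (ut + familySign i * (soundSpeed a γ (ρ z) / ρ z * ρt))
      (ux + familySign i * (soundSpeed a γ (ρ z) / ρ z * ρx)) := by
  have h := hu.add (((hρ.comp (hasDerivAt_soundSpeed (a := a) (γ := γ) hρz)).const_mul
    (2 / (γ - 1))).const_mul (familySign i))
  have hγ' : γ - 1 ≠ 0 := by linarith
  refine HasFDerivWithinAt.congr_fderiv h ?_
  congr 2 <;> field_simp

theorem IsSolution.riemann_eq {L ρ₀ u₀ : ℝ} {α ρl ul : ℝ → ℝ} {ρ u : ℝ × ℝ → ℝ} (ha : 0 < a)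
    (hγ : 1 < γ) (hL : 0 < L) (h : IsSolution a γ L α ρ₀ u₀ ρl ul ρ u) {z : ℝ × ℝ}
    (hz : z ∈ domain L) (hρz : 0 < ρ z) (i : Bool) :
    dt u z + familySign i * (soundSpeed a γ (ρ z) / ρ z * dt ρ z) +
      (u z + familySign i * soundSpeed a γ (ρ z)) *
        (dx L u z + familySign i * (soundSpeed a γ (ρ z) / ρ z * dx L ρ z)) = α z.1 * u z := by
  have hρ := HasPartials.of_contDiffOn hL h.density_contDiffOn hz
  have hu := HasPartials.of_contDiffOn hL h.velocity_contDiffOn hz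
  refine riemann_eq_of_euler ha hγ hρz (familySign_mul_self i) ?_ ?_
  · rw [← h.mass z hz, (hρ.mul hu).dx_eq hL hz]
  · rw [← h.momentum z hz, (hρ.mul hu).dt_eq hz,
      ((hρ.mul (hasPartials_sq hu)).add (hasPartials_pressure hρz hρ)).dx_eq hL hz]

end

/-! ### Uniqueness -/

/-- Only points to the left matter, so the final time and the outflow boundary `x = L` are covered.
-/
theorem deriv_nonneg_of_left_max {f : ℝ → ℝ} {f' x y : ℝ} (hxy : x < y)
    (h : HasDerivWithinAt f f' (Icc x y) y) (hmax : ∀ s ∈ Icc x y, f s ≤ f y) : 0 ≤ f' := by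
  rw [hasDerivWithinAt_iff_tendsto_slope, Icc_sdiff_right] at h
  have : (𝓝[Ico x y] y).NeBot := by
    rw [nhdsWithin_Ico_eq_nhdsLT hxy]; infer_instance
  refine ge_of_tendsto h ?_
  filter_upwards [self_mem_nhdsWithin] with s hs
  rw [slope_def_field]
  exact div_nonneg_of_nonpos (by linarith [hmax s ⟨hs.1, hs.2.le⟩]) (by linarith [hs.2])

/-- Maximum principle for a weakly coupled system of transport inequalities with nonnegative
speeds, started from zero and with zero inflow. -/
theorem eq_zero_of_transport_inequality {L t₀ η N₀ : ℝ} {d dT dX sp : Bool → ℝ × ℝ → ℝ}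
    (ht₀ : 0 ≤ t₀)
    (hd : ∀ i, ∀ z ∈ Icc t₀ (t₀ + η) ×ˢ Icc 0 L, HasPartials L (d i) z (dT i z) (dX i z))
    (hsp : ∀ i, ∀ z ∈ Icc t₀ (t₀ + η) ×ˢ Icc 0 L, 0 ≤ sp i z)
    (hin : ∀ i, ∀ x ∈ Icc 0 L, d i (t₀, x) = 0)
    (hbd : ∀ i, ∀ t ∈ Icc t₀ (t₀ + η), d i (t, 0) = 0)
    (hN₀ : ∀ i, ∀ z ∈ Icc t₀ (t₀ + η) ×ˢ Icc 0 L,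
      |dT i z + sp i z * dX i z| ≤ N₀ * max |d false z| |d true z|) :
    ∀ i, ∀ z ∈ Icc t₀ (t₀ + η) ×ˢ Icc 0 L, d i z = 0 := by
  set K : Set (ℝ × ℝ) := Icc t₀ (t₀ + η) ×ˢ Icc 0 L with hK
  have hKdom : K ⊆ domain L := fun z hz => ⟨ht₀.trans hz.1.1, hz.2⟩
  have hKc : IsCompact K := isCompact_Icc.prod isCompact_Icc
  have hdc : ∀ i, ContinuousOn (d i) K := fun i z hz =>
    (hd i z hz).continuousWithinAt.mono hKdom
  -- The extra `1` makes the contradiction at the maximum strict.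
  set N := N₀ + 1 with hN
  set m : ℝ × ℝ → ℝ := fun z => max |d false z| |d true z| with hm
  have hmd : ∀ i z, |d i z| ≤ m z := by
    intro i z
    cases i
    · exact le_max_left _ _
    · exact le_max_right _ _
  set Ψ : ℝ × ℝ → ℝ := fun z => m z * Real.exp (-N * (z.1 - t₀)) with hΨ
  have hΨc : ContinuousOn Ψ K := by
    have h1 : Continuous fun z : ℝ × ℝ => Real.exp (-N * (z.1 - t₀)) := by fun_prop
    exact (ContinuousOn.sup (hdc false).abs (hdc true).abs).mul h1.continuousOn
  intro i₀ z₀ hz₀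
  by_contra hne
  obtain ⟨w, hwK, hw⟩ := hKc.exists_isMaxOn ⟨z₀, hz₀⟩ hΨc
  have hwpos : 0 < m w := by
    have h1 : Ψ z₀ ≤ Ψ w := hw hz₀
    have h2 : 0 < m z₀ := (abs_pos.2 hne).trans_le (hmd i₀ z₀)
    have h3 : 0 < Ψ w := lt_of_lt_of_le (by positivity) h1
    exact (mul_pos_iff_of_pos_right (Real.exp_pos _)).1 h3
  obtain ⟨i, hi⟩ : ∃ i, |d i w| = m w := by
    rcases max_choice |d false w| |d true w| with h | h
    · exact ⟨false, h.symm⟩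
    · exact ⟨true, h.symm⟩
  obtain ⟨σ, hσ1, hσ⟩ : ∃ σ : ℝ, |σ| = 1 ∧ σ * d i w = m w := by
    rcases le_total 0 (d i w) with h | h
    · exact ⟨1, by simp, by rw [one_mul, ← hi, abs_of_nonneg h]⟩
    · exact ⟨-1, by simp, by rw [neg_one_mul, ← hi, abs_of_nonpos h]⟩
  have hφle : ∀ z ∈ K, σ * d i z * Real.exp (-N * (z.1 - t₀)) ≤
      σ * d i w * Real.exp (-N * (w.1 - t₀)) := by
    intro z hz
    have h1 : σ * d i z ≤ m z := by
      refine (le_abs_self _).trans ?_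
      rw [abs_mul, hσ1, one_mul]
      exact hmd i z
    calc _ ≤ Ψ z := mul_le_mul_of_nonneg_right h1 (Real.exp_pos _).le
      _ ≤ Ψ w := hw hz
      _ = _ := by rw [hσ]
  have hdw : d i w ≠ 0 := by
    intro h
    rw [h, abs_zero] at hi
    exact hwpos.ne hi
  have htw : t₀ < w.1 := by
    refine lt_of_le_of_ne hwK.1.1 fun h => hdw ?_
    rw [show w = (t₀, w.2) from Prod.ext h.symm rfl]
    exact hin i w.2 hwK.2
  have hxw : 0 < w.2 := by
    refine lt_of_le_of_ne hwK.2.1 fun h => hdw ?_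
    rw [show w = (w.1, 0) from Prod.ext rfl h.symm]
    exact hbd i w.1 hwK.1
  have hpart := hd i w hwK
  have htime : 0 ≤ σ * dT i w - N * m w := by
    have h1 : HasDerivWithinAt (fun t => d i (t, w.2)) (dT i w) (Icc t₀ w.1) w.1 :=
      (hpart.time (hKdom hwK)).mono fun t ht => ht₀.trans ht.1
    have h2 : HasDerivWithinAt (fun t => Real.exp (-N * (t - t₀)))
        (Real.exp (-N * (w.1 - t₀)) * (-N)) (Icc t₀ w.1) w.1 := by
      have := (((hasDerivAt_id w.1).sub_const t₀).const_mul (-N)).exp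
      simpa using this.hasDerivWithinAt
    have h3 := deriv_nonneg_of_left_max htw ((h1.const_mul σ).mul h2) (fun t ht =>
      hφle (t, w.2) ⟨⟨ht.1, ht.2.trans hwK.1.2⟩, hwK.2⟩)
    have h4 : σ * dT i w * Real.exp (-N * (w.1 - t₀)) +
        σ * d i w * (Real.exp (-N * (w.1 - t₀)) * (-N))
        = (σ * dT i w - N * m w) * Real.exp (-N * (w.1 - t₀)) := by
      rw [hσ]; ring
    change 0 ≤ σ * dT i w * Real.exp (-N * (w.1 - t₀)) +
        σ * d i w * (Real.exp (-N * (w.1 - t₀)) * (-N)) at h3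
    rw [h4] at h3
    exact nonneg_of_mul_nonneg_left h3 (Real.exp_pos _)
  have hspace : 0 ≤ σ * dX i w := by
    have h1 : HasDerivWithinAt (fun x => d i (w.1, x)) (dX i w) (Icc 0 w.2) w.2 :=
      (hpart.space (hKdom hwK)).mono (Icc_subset_Icc_right hwK.2.2)
    refine deriv_nonneg_of_left_max hxw (h1.const_mul σ) (fun x hx => ?_)
    have := hφle (w.1, x) ⟨hwK.1, hx.1, hx.2.trans hwK.2.2⟩
    exact le_of_mul_le_mul_right this (Real.exp_pos _)
  -- At the maximum of the weighted function, `N m ≤ σ (dT + sp dX) ≤ N₀ m` with `m > 0`, which is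
  -- impossible.
  have h1 : σ * (dT i w + sp i w * dX i w) ≤ N₀ * m w := by
    refine (le_abs_self _).trans ?_
    rw [abs_mul, hσ1, one_mul]
    exact hN₀ i w hwK
  have h2 : 0 ≤ sp i w * (σ * dX i w) := mul_nonneg (hsp i w hwK) hspace
  nlinarith

/-! ### Comparison of two Euler solutions -/

section

variable {a γ L ρ₀ u₀ : ℝ} {α ρl ul : ℝ → ℝ} {ρ u ρ' u' : ℝ × ℝ → ℝ}

theorem abs_familySign_mul (i : Bool) (x : ℝ) : |familySign i * x| = |x| := by
  rw [abs_mul, abs_familySign, one_mul]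

/-- The differences are transported with the nonnegative speeds of the supersonic solution. The
mismatch of speeds multiplies `x`-derivatives of the other solution's invariants, bounded on the
compact strip. Of the other solution only positive density is required. -/
theorem IsSolution.eq_on_strip (ha : 0 < a) (hγ : 1 < γ) (hL : 0 < L) (hα : Continuous α)
    (h : IsSolution a γ L α ρ₀ u₀ ρl ul ρ u) (h' : IsSolution a γ L α ρ₀ u₀ ρl ul ρ' u')
    (hpos : ∀ z ∈ domain L, 0 < ρ z) (hsup : ∀ z ∈ domain L, soundSpeed a γ (ρ z) < u z)
    {t₀ η : ℝ} (ht₀ : 0 ≤ t₀)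
    (heq : ∀ x ∈ Icc 0 L, ρ' (t₀, x) = ρ (t₀, x) ∧ u' (t₀, x) = u (t₀, x))
    (hpos' : ∀ z ∈ Icc t₀ (t₀ + η) ×ˢ Icc 0 L, 0 < ρ' z) :
    ∀ z ∈ Icc t₀ (t₀ + η) ×ˢ Icc 0 L, ρ' z = ρ z ∧ u' z = u z := by
  set K : Set (ℝ × ℝ) := Icc t₀ (t₀ + η) ×ˢ Icc 0 L with hK
  have hKdom : K ⊆ domain L := fun z hz => ⟨ht₀.trans hz.1.1, hz.2⟩
  have hKc : IsCompact K := isCompact_Icc.prod isCompact_Icc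
  have hγ1 : 0 < γ - 1 := by linarith
  set wx' : Bool → ℝ × ℝ → ℝ := fun i z =>
    dx L u' z + familySign i * (soundSpeed a γ (ρ' z) / ρ' z * dx L ρ' z) with hwx'
  have hwx'c : ∀ i, ContinuousOn (wx' i) K := by
    intro i
    have c1 := (continuousOn_dx hL h'.velocity_contDiffOn).mono hKdom
    have c2 := (continuousOn_dx hL h'.density_contDiffOn).mono hKdom
    have c3 := h'.density_contDiffOn.continuousOn.mono hKdom
    have c4 : ContinuousOn (fun z => soundSpeed a γ (ρ' z)) K := fun z hz =>
      ((hasDerivAt_soundSpeed (hpos' z hz)).continuousAt).comp_continuousWithinAt (c3 z hz)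
    exact c1.add (continuousOn_const.mul ((c4.div c3 fun z hz => (hpos' z hz).ne').mul c2))
  obtain ⟨B₀, hB₀⟩ := hKc.exists_bound_of_continuousOn (hwx'c false)
  obtain ⟨B₁, hB₁⟩ := hKc.exists_bound_of_continuousOn (hwx'c true)
  obtain ⟨A, hA⟩ := (isCompact_Icc (a := t₀) (b := t₀ + η)).exists_bound_of_continuousOn
    hα.continuousOn
  set B := max B₀ B₁ with hBdef
  have hB : ∀ i, ∀ z ∈ K, |wx' i z| ≤ B := by
    intro i z hz
    cases i
    · exact (hB₀ z hz).trans (le_max_left _ _)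
    · exact (hB₁ z hz).trans (le_max_right _ _)
  have key := eq_zero_of_transport_inequality (L := L) (η := η) (N₀ := A + (1 + (γ - 1) / 2) * B)
    (d := fun i z => riemann a γ ρ u i z - riemann a γ ρ' u' i z)
    (dT := fun i z => dt u z + familySign i * (soundSpeed a γ (ρ z) / ρ z * dt ρ z) -
      (dt u' z + familySign i * (soundSpeed a γ (ρ' z) / ρ' z * dt ρ' z)))
    (dX := fun i z => dx L u z + familySign i * (soundSpeed a γ (ρ z) / ρ z * dx L ρ z) - wx' i z)
    (sp := fun i z => u z + familySign i * soundSpeed a γ (ρ z)) ht₀ ?_ ?_ ?_ ?_ ?_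
  · intro z hz
    have e0 := sub_eq_zero.1 (key false z hz)
    have e1 := sub_eq_zero.1 (key true z hz)
    simp only [riemann, familySign, Bool.false_eq_true, if_false, if_true] at e0 e1
    have hc : 2 / (γ - 1) * soundSpeed a γ (ρ' z) = 2 / (γ - 1) * soundSpeed a γ (ρ z) := by
      linarith
    have hc' := mul_left_cancel₀ (div_pos two_pos hγ1).ne' hc
    exact ⟨soundSpeed_injOn ha hγ (hpos' z hz).le (hpos z (hKdom hz)).le hc', by linarith⟩
  · intro i z hz
    exact (hasPartials_riemann hγ (hpos z (hKdom hz))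
      (HasPartials.of_contDiffOn hL h.density_contDiffOn (hKdom hz))
      (HasPartials.of_contDiffOn hL h.velocity_contDiffOn (hKdom hz)) i).sub
      (hasPartials_riemann hγ (hpos' z hz)
      (HasPartials.of_contDiffOn hL h'.density_contDiffOn (hKdom hz))
      (HasPartials.of_contDiffOn hL h'.velocity_contDiffOn (hKdom hz)) i)
  · intro i z hz
    have h1 := hsup z (hKdom hz)
    have h2 := soundSpeed_pos ha hγ (hpos z (hKdom hz))
    have h3 := abs_le.1 (abs_familySign_mul i (soundSpeed a γ (ρ z))).le
    rw [abs_of_pos h2] at h3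
    linarith [h3.1]
  · intro i x hx
    simp only [riemann, (heq x hx).1, (heq x hx).2, sub_self]
  · intro i t ht
    have h1 := h.boundary t (ht₀.trans ht.1)
    have h2 := h'.boundary t (ht₀.trans ht.1)
    simp only [riemann, h1.1, h1.2, h2.1, h2.2, sub_self]
  · intro i z hz
    have r1 := h.riemann_eq ha hγ hL (hKdom hz) (hpos z (hKdom hz)) i
    have r2 := h'.riemann_eq ha hγ hL (hKdom hz) (hpos' z hz) i
    set c := soundSpeed a γ (ρ z)
    set c' := soundSpeed a γ (ρ' z)
    set m := max |riemann a γ ρ u false z - riemann a γ ρ' u' false z|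
      |riemann a γ ρ u true z - riemann a γ ρ' u' true z| with hm
    have hm0 : |riemann a γ ρ u false z - riemann a γ ρ' u' false z| ≤ m := le_max_left _ _
    have hm1 : |riemann a γ ρ u true z - riemann a γ ρ' u' true z| ≤ m := le_max_right _ _
    have hu : |u z - u' z| ≤ m := by
      have e : u z - u' z = ((riemann a γ ρ u false z - riemann a γ ρ' u' false z) +
          (riemann a γ ρ u true z - riemann a γ ρ' u' true z)) / 2 := by
        simp only [riemann, familySign, Bool.false_eq_true, if_false, if_true]; ring
      rw [e, abs_div, abs_two]
      linarith [abs_add_le (riemann a γ ρ u false z - riemann a γ ρ' u' false z)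
        (riemann a γ ρ u true z - riemann a γ ρ' u' true z)]
    have hc : |c - c'| ≤ (γ - 1) / 2 * m := by
      have e : c - c' = (γ - 1) / 4 * ((riemann a γ ρ u true z - riemann a γ ρ' u' true z) -
          (riemann a γ ρ u false z - riemann a γ ρ' u' false z)) := by
        simp only [riemann, familySign, Bool.false_eq_true, if_false, if_true, c, c']
        field_simp
        ring
      rw [e, abs_mul, abs_of_pos (by linarith)]
      have := abs_sub (riemann a γ ρ u true z - riemann a γ ρ' u' true z)
        (riemann a γ ρ u false z - riemann a γ ρ' u' false z)
      nlinarith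
    have hAz : |α z.1| ≤ A := hA z.1 hz.1
    have hBz := hB i z hz
    have hm00 : 0 ≤ m := (abs_nonneg _).trans hm0
    have e : dt u z + familySign i * (c / ρ z * dt ρ z) -
        (dt u' z + familySign i * (c' / ρ' z * dt ρ' z)) + (u z + familySign i * c) *
        (dx L u z + familySign i * (c / ρ z * dx L ρ z) - wx' i z)
        = α z.1 * (u z - u' z) - ((u z - u' z) + familySign i * (c - c')) * wx' i z := by
      simp only [hwx']
      linear_combination r1 - r2
    rw [e]
    refine (abs_sub _ _).trans ?_
    rw [abs_mul, abs_mul]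
    have k1 : |α z.1| * |u z - u' z| ≤ A * m :=
      mul_le_mul hAz hu (abs_nonneg _) ((abs_nonneg _).trans hAz)
    have k2 : |(u z - u' z) + familySign i * (c - c')| ≤ (1 + (γ - 1) / 2) * m := by
      refine (abs_add_le _ _).trans ?_
      rw [abs_familySign_mul]
      linarith
    have k3 := mul_le_mul k2 hBz (abs_nonneg _) (by positivity)
    linarith

/-- Continuation in time: the set of times of coincidence is closed and contains `0`. At such a time
`ρ' = ρ` is positive on the compact interval, hence stays positive for a short while, and the strip
lemma extends the coincidence. -/
theorem IsSolution.eq_of_supersonic (ha : 0 < a) (hγ : 1 < γ) (hL : 0 < L) (hα : Continuous α)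
    (h : IsSolution a γ L α ρ₀ u₀ ρl ul ρ u) (h' : IsSolution a γ L α ρ₀ u₀ ρl ul ρ' u')
    (hpos : ∀ z ∈ domain L, 0 < ρ z) (hsup : ∀ z ∈ domain L, soundSpeed a γ (ρ z) < u z) :
    ∀ z ∈ domain L, ρ' z = ρ z ∧ u' z = u z := by
  intro z hz
  set S : Set ℝ := {t | ∀ x ∈ Icc 0 L, ρ' (t, x) = ρ (t, x) ∧ u' (t, x) = u (t, x)} with hS
  have hline : ∀ {F : ℝ × ℝ → ℝ}, ContDiffOn ℝ 1 F (domain L) → ∀ x ∈ Icc 0 L,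
      ContinuousOn (fun t => F (t, x)) (Icc 0 z.1) := fun hF x hx =>
    hF.continuousOn.comp (f := fun t => (t, x)) (by fun_prop) fun t ht => ⟨ht.1, hx⟩
  have hclosed : IsClosed (S ∩ Icc 0 z.1) := by
    have e : S ∩ Icc 0 z.1 = Icc 0 z.1 ∩ ⋂ x ∈ Icc 0 L,
        ({t ∈ Icc 0 z.1 | ρ' (t, x) = ρ (t, x)} ∩ {t ∈ Icc 0 z.1 | u' (t, x) = u (t, x)}) := by
      ext t
      simp only [hS, mem_inter_iff, mem_ofPred_eq, mem_iInter]
      constructor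
      · rintro ⟨h1, h2⟩
        exact ⟨h2, fun x hx => ⟨⟨h2, (h1 x hx).1⟩, h2, (h1 x hx).2⟩⟩
      · rintro ⟨h1, h2⟩
        exact ⟨fun x hx => ⟨(h2 x hx).1.2, (h2 x hx).2.2⟩, h1⟩
    rw [e]
    refine isClosed_Icc.inter (isClosed_biInter fun x hx => ?_)
    exact (isClosed_Icc.isClosed_eq (hline h'.density_contDiffOn x hx)
      (hline h.density_contDiffOn x hx)).inter
      (isClosed_Icc.isClosed_eq (hline h'.velocity_contDiffOn x hx)
      (hline h.velocity_contDiffOn x hx))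
  have hzero : (0 : ℝ) ∈ S := fun x hx => by
    rw [(h.initial x hx).1, (h.initial x hx).2, (h'.initial x hx).1, (h'.initial x hx).2]
    exact ⟨rfl, rfl⟩
  have hsub : Icc 0 z.1 ⊆ S := by
    refine hclosed.Icc_subset_of_forall_exists_gt hzero ?_
    rintro t₀ ⟨ht₀S, ht₀⟩ y hy
    set Q : Set (ℝ × ℝ) := Icc t₀ (t₀ + 1) ×ˢ Icc 0 L with hQ
    have hQdom : Q ⊆ domain L := fun w hw => ⟨ht₀.1.trans hw.1.1, hw.2⟩
    have hQc : IsCompact Q := isCompact_Icc.prod isCompact_Icc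
    have hunif := hQc.uniformContinuousOn_of_continuous
      (h'.density_contDiffOn.continuousOn.mono hQdom)
    have hρ't : ContinuousOn (fun x => ρ' (t₀, x)) (Icc 0 L) :=
      h'.density_contDiffOn.continuousOn.comp (f := fun x => (t₀, x)) (by fun_prop)
        fun x hx => ⟨ht₀.1, hx⟩
    obtain ⟨x₁, hx₁, hmin⟩ := isCompact_Icc.exists_isMinOn
      (nonempty_Icc.2 hL.le) hρ't
    have hm : 0 < ρ' (t₀, x₁) := by
      rw [(ht₀S x₁ hx₁).1]
      exact hpos _ ⟨ht₀.1, hx₁⟩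
    obtain ⟨δ, hδ, hδ'⟩ := Metric.uniformContinuousOn_iff.1 hunif _ hm
    -- The continuation principle asks for a new time in `(t₀, y]`, hence the bound by `y - t₀`.
    set η := min (min (δ / 2) 1) (y - t₀) with hη
    have hη0 : 0 < η := by
      have : 0 < y - t₀ := sub_pos.2 hy
      positivity
    have hηδ : η ≤ δ / 2 := (min_le_left _ _).trans (min_le_left _ _)
    have hη1 : η ≤ 1 := (min_le_left _ _).trans (min_le_right _ _)
    have hηy : η ≤ y - t₀ := min_le_right _ _
    have hpos' : ∀ w ∈ Icc t₀ (t₀ + η) ×ˢ Icc 0 L, 0 < ρ' w := by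
      intro w hw
      have hwQ : w ∈ Q := ⟨⟨hw.1.1, hw.1.2.trans (by linarith)⟩, hw.2⟩
      have hwQ' : (t₀, w.2) ∈ Q := ⟨⟨le_rfl, by linarith⟩, hw.2⟩
      have h1 := hδ' w hwQ (t₀, w.2) hwQ' (by
        rw [Prod.dist_eq, dist_self, Real.dist_eq, max_lt_iff]
        refine ⟨?_, hδ⟩
        rw [abs_of_nonneg (sub_nonneg.2 hw.1.1)]
        linarith [hw.1.2])
      have h2 : ρ' (t₀, x₁) ≤ ρ' (t₀, w.2) := hmin hw.2
      rw [Real.dist_eq] at h1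
      linarith [(abs_lt.1 h1).1]
    refine ⟨t₀ + η, fun x hx => ?_, by linarith, by linarith⟩
    exact h.eq_on_strip ha hγ hL hα h' hpos hsup ht₀.1 ht₀S hpos' (t₀ + η, x)
      ⟨⟨by linarith, le_rfl⟩, hx⟩
  exact hsub ⟨hz.1, le_rfl⟩ z.2 hz.2

end

end EulerSource
end

noncomputable section
namespace EulerSource
open Filter Topology

/-! ### Boundary data in Riemann invariants -/

/-- The perturbed Riemann invariants of the boundary data `ρ₀ + r`, `U + w`. -/
def boundaryDatum (a γ ρ₀ : ℝ) (r w : ℝ → ℝ) (i : Bool) (t : ℝ) : ℝ :=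
  w t + familySign i * (2 / (γ - 1) * (soundSpeed a γ (ρ₀ + r t) - soundSpeed a γ ρ₀))

/-- Away from vacuum the sound speed is smooth; compactness bounds its first two derivatives. -/
theorem exists_soundSpeed_bounds {a γ ρ₀ : ℝ} (hρ₀ : 0 < ρ₀) :
    ∃ K, 0 ≤ K ∧ (∀ x ∈ Icc (ρ₀ / 2) (3 * ρ₀ / 2), |(γ - 1) / 2 * (soundSpeed a γ x / x)| ≤ K) ∧
      ∀ x ∈ Icc (ρ₀ / 2) (3 * ρ₀ / 2), ∀ y ∈ Icc (ρ₀ / 2) (3 * ρ₀ / 2),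
        |(γ - 1) / 2 * (soundSpeed a γ x / x) - (γ - 1) / 2 * (soundSpeed a γ y / y)|
          ≤ K * |x - y| := by
  set I := Icc (ρ₀ / 2) (3 * ρ₀ / 2) with hI
  have hpos : ∀ x ∈ I, 0 < x := fun x hx => by have := hx.1; linarith
  have hs : ContinuousOn (soundSpeed a γ) I := fun x hx =>
    (hasDerivAt_soundSpeed (hpos x hx)).continuousAt.continuousWithinAt
  have hd : ∀ x ∈ I, HasDerivAt (fun x => (γ - 1) / 2 * (soundSpeed a γ x / x))
      ((γ - 1) / 2 * (((γ - 1) / 2 * (soundSpeed a γ x / x) * x - soundSpeed a γ x * 1) / x ^ 2))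
      x := fun x hx =>
    ((hasDerivAt_soundSpeed (hpos x hx)).div (hasDerivAt_id x) (hpos x hx).ne').const_mul _
  have hdiv : ContinuousOn (fun x => soundSpeed a γ x / x) I :=
    hs.div continuousOn_id fun x hx => (hpos x hx).ne'
  obtain ⟨K₁, hK₁⟩ := isCompact_Icc.exists_bound_of_continuousOn
    (continuousOn_const (c := (γ - 1) / 2) |>.mul hdiv)
  have hc2 : ContinuousOn (fun x => (γ - 1) / 2 *
      (((γ - 1) / 2 * (soundSpeed a γ x / x) * x - soundSpeed a γ x * 1) / x ^ 2)) I :=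
    continuousOn_const.mul ((((continuousOn_const.mul hdiv).mul continuousOn_id).sub
      (hs.mul continuousOn_const)).div (continuousOn_id.pow 2)
        fun x hx => pow_ne_zero 2 (hpos x hx).ne')
  obtain ⟨K₂, hK₂⟩ := isCompact_Icc.exists_bound_of_continuousOn hc2
  refine ⟨max 0 (max K₁ K₂), le_max_left _ _, fun x hx => (hK₁ x hx).trans
    ((le_max_left _ _).trans (le_max_right _ _)), fun x hx y hy => ?_⟩
  have := (convex_Icc (ρ₀ / 2) (3 * ρ₀ / 2)).norm_image_sub_le_of_norm_hasDerivWithin_le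
    (fun x hx => (hd x hx).hasDerivWithinAt) (fun x hx => hK₂ x hx) hy hx
  exact this.trans (mul_le_mul_of_nonneg_right
    ((le_max_right _ _).trans (le_max_right _ _)) (norm_nonneg _))

/-- The constant `K` is uniform in the perturbations, so the datum has size linear in `η`. `M₀`
comes from the Hölder bound on the chain-rule derivative. -/
theorem exists_isDatum {a γ ρ₀ P : ℝ} (hγ : 1 < γ) (hρ₀ : 0 < ρ₀) :
    ∃ K, 0 < K ∧ ∀ η r r' w w', η ≤ ρ₀ / 2 → IsRestPerturbation P η r r' →
      IsRestPerturbation P η w w' → ∃ M₀, IsDatum P (K * η) M₀ (boundaryDatum a γ ρ₀ r w) := by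
  obtain ⟨K, hK0, hK1, hK2⟩ := exists_soundSpeed_bounds (a := a) (γ := γ) hρ₀
  have hγ1 : 0 < 2 / (γ - 1) := div_pos two_pos (by linarith)
  set k := 2 / (γ - 1) with hk
  set s1 : ℝ → ℝ := fun x => (γ - 1) / 2 * (soundSpeed a γ x / x) with hs1
  refine ⟨1 + k * K, by positivity, fun η r r' w w' hη hr hw => ?_⟩
  have hη0 : 0 ≤ η := (abs_nonneg _).trans (hr.bound 0)
  have hrI : ∀ t, ρ₀ + r t ∈ Icc (ρ₀ / 2) (3 * ρ₀ / 2) := fun t => by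
    have := abs_le.1 (hr.bound t)
    constructor <;> linarith [this.1, this.2]
  have hρI : ρ₀ ∈ Icc (ρ₀ / 2) (3 * ρ₀ / 2) := ⟨by linarith, by linarith⟩
  have hpos : ∀ x ∈ Icc (ρ₀ / 2) (3 * ρ₀ / 2), 0 < x := fun x hx => by have := hx.1; linarith
  have hd : ∀ i t, HasDerivAt (boundaryDatum a γ ρ₀ r w i)
      (w' t + familySign i * (k * (s1 (ρ₀ + r t) * r' t))) t := by
    intro i t
    have h1 := (hasDerivAt_soundSpeed (a := a) (γ := γ) (hpos _ (hrI t))).comp t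
      ((hr.hasDerivAt t).const_add ρ₀)
    exact (hw.hasDerivAt t).add (((h1.sub_const _).const_mul k).const_mul (familySign i))
  have hd_le : ∀ i t, |w' t + familySign i * (k * (s1 (ρ₀ + r t) * r' t))| ≤ (1 + k * K) * η := by
    intro i t
    refine (abs_add_le _ _).trans ?_
    rw [abs_familySign_mul, abs_mul, abs_of_pos hγ1, abs_mul]
    have h1 := mul_le_mul (hK1 _ (hrI t)) (hr.bound_deriv t) (abs_nonneg _) hK0
    have h2 := mul_le_mul_of_nonneg_left h1 hγ1.le
    linarith [hw.bound_deriv t]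
  have hr_holder : ∀ s t, |r t - r s| ≤ 2 * η * √|t - s| := by
    intro s t
    have hsq := Real.sq_sqrt (abs_nonneg (t - s))
    have hs0 := Real.sqrt_nonneg |t - s|
    rcases le_total √|t - s| 1 with h1 | h1
    · refine (sub_le_of_hasDerivAt hr.hasDerivAt hr.bound_deriv t s).trans ?_
      have : |t - s| ≤ √|t - s| := by nlinarith
      nlinarith
    · refine (abs_sub _ _).trans ?_
      have := hr.bound t
      have := hr.bound s
      nlinarith
  refine ⟨η + k * (K * (2 * η) * η + K * η), ?_, ?_, ?_, ?_, ?_⟩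
  · intro i t
    have h1 : |soundSpeed a γ (ρ₀ + r t) - soundSpeed a γ ρ₀| ≤ K * η := by
      have := (convex_Icc (ρ₀ / 2) (3 * ρ₀ / 2)).norm_image_sub_le_of_norm_hasDerivWithin_le
        (fun x hx => (hasDerivAt_soundSpeed (a := a) (γ := γ) (hpos x hx)).hasDerivWithinAt)
        (fun x hx => hK1 x hx) hρI (hrI t)
      rw [add_sub_cancel_left] at this
      exact this.trans (mul_le_mul_of_nonneg_left (hr.bound t) hK0)
    rw [boundaryDatum]
    refine (abs_add_le _ _).trans ?_
    rw [abs_familySign_mul, abs_mul, abs_of_pos hγ1]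
    have h2 := mul_le_mul_of_nonneg_left h1 hγ1.le
    linarith [hw.bound t]
  · intro i t t'
    exact sub_le_of_hasDerivAt (hd i) (hd_le i) t t'
  · intro i p q p' q' ρ hpq hpq' h1 h2
    refine quotient_sub_quotient_le (by positivity) (hd i) (fun s t => ?_) hpq hpq' h1 h2
    have e : w' t + familySign i * (k * (s1 (ρ₀ + r t) * r' t)) -
        (w' s + familySign i * (k * (s1 (ρ₀ + r s) * r' s)))
        = (w' t - w' s) + familySign i * (k * (s1 (ρ₀ + r t) * r' t - s1 (ρ₀ + r s) * r' s)) := by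
      ring
    rw [e]
    refine (abs_add_le _ _).trans ?_
    rw [abs_familySign_mul, abs_mul, abs_of_pos hγ1]
    have h3 : |s1 (ρ₀ + r t) - s1 (ρ₀ + r s)| ≤ K * (2 * η) * √|t - s| := by
      refine (hK2 _ (hrI t) _ (hrI s)).trans ?_
      rw [add_sub_add_left_eq_sub, mul_assoc]
      exact mul_le_mul_of_nonneg_left (hr_holder s t) hK0
    have h4 := abs_mul_sub_mul_le h3 (hr.bound_deriv t) (hK1 _ (hrI s)) (hr.holder s t)
    have h5 := mul_le_mul_of_nonneg_left h4 hγ1.le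
    have h6 := hw.holder s t
    refine (add_le_add h6 h5).trans (le_of_eq (by ring))
  · intro i t ht
    simp [boundaryDatum, hw.rest t ht, hr.rest t ht]
  · intro i t ht
    simp only [boundaryDatum, hw.periodic t ht, hr.periodic t ht]

/-! ### From Riemann invariants to the Euler system -/

/-- The density with sound speed `c`. -/
def densityOf (a γ c : ℝ) : ℝ := (c / √(a * γ)) ^ (2 / (γ - 1))

section

variable {a γ : ℝ}

theorem densityOf_pos (ha : 0 < a) (hγ : 1 < γ) {c : ℝ} (hc : 0 < c) : 0 < densityOf a γ c :=
  Real.rpow_pos_of_pos (div_pos hc (sqrt_mul_pos ha hγ)) _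

theorem soundSpeed_densityOf (ha : 0 < a) (hγ : 1 < γ) {c : ℝ} (hc : 0 < c) :
    soundSpeed a γ (densityOf a γ c) = c := by
  have hs := sqrt_mul_pos ha hγ
  have hγ1 : γ - 1 ≠ 0 := by linarith
  rw [soundSpeed, densityOf, ← Real.rpow_mul (div_pos hc hs).le]
  rw [show 2 / (γ - 1) * ((γ - 1) / 2) = 1 by field_simp, Real.rpow_one]
  field_simp

theorem densityOf_soundSpeed (ha : 0 < a) (hγ : 1 < γ) {ρ : ℝ} (hρ : 0 < ρ) :
    densityOf a γ (soundSpeed a γ ρ) = ρ :=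
  soundSpeed_injOn ha hγ (densityOf_pos ha hγ (soundSpeed_pos ha hγ hρ)).le hρ.le
    (soundSpeed_densityOf ha hγ (soundSpeed_pos ha hγ hρ))

theorem hasDerivAt_densityOf (ha : 0 < a) (hγ : 1 < γ) {c : ℝ} (hc : 0 < c) :
    HasDerivAt (densityOf a γ) (2 / (γ - 1) * (densityOf a γ c / c)) c := by
  have hs := sqrt_mul_pos ha hγ
  have h1 := ((hasDerivAt_id c).div_const (√(a * γ))).rpow_const (p := 2 / (γ - 1))
    (Or.inl (div_pos hc hs).ne')
  refine h1.congr_deriv ?_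
  simp only [id]
  rw [Real.rpow_sub_one (div_pos hc hs).ne', densityOf]
  have := hc.ne'
  field_simp

theorem exists_densityOf_bound (ha : 0 < a) (hγ : 1 < γ) {c₀ : ℝ} (hc₀ : 0 < c₀) :
    ∃ K, 0 ≤ K ∧ (∀ c ∈ Icc (c₀ / 2) (3 * c₀ / 2), |2 / (γ - 1) * (densityOf a γ c / c)| ≤ K) ∧
      ∀ c ∈ Icc (c₀ / 2) (3 * c₀ / 2), |densityOf a γ c - densityOf a γ c₀| ≤ K * |c - c₀| := by
  set I := Icc (c₀ / 2) (3 * c₀ / 2) with hI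
  have hpos : ∀ x ∈ I, 0 < x := fun x hx => by have := hx.1; linarith
  have hs : ContinuousOn (densityOf a γ) I := fun x hx =>
    (hasDerivAt_densityOf ha hγ (hpos x hx)).continuousAt.continuousWithinAt
  have hdiv : ContinuousOn (fun x => densityOf a γ x / x) I :=
    hs.div continuousOn_id fun x hx => (hpos x hx).ne'
  obtain ⟨K, hK⟩ := isCompact_Icc.exists_bound_of_continuousOn
    (continuousOn_const (c := 2 / (γ - 1)) |>.mul hdiv)
  have hc₀I : c₀ ∈ I := ⟨by linarith, by linarith⟩
  refine ⟨K, (norm_nonneg _).trans (hK c₀ hc₀I), hK, fun c hc => ?_⟩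
  exact (convex_Icc (c₀ / 2) (3 * c₀ / 2)).norm_image_sub_le_of_norm_hasDerivWithin_le
    (fun x hx => (hasDerivAt_densityOf ha hγ (hpos x hx)).hasDerivWithinAt) hK hc₀I hc

/-- Multiplying the sound speed equation by `dρ/dc = 2ρ/((γ - 1)c)` gives mass; momentum is `u`
times mass plus `ρ` times the velocity equation, since the pressure gradient `c² ρₓ` equals `ρ · 2c
cₓ/(γ - 1)`. -/
theorem euler_of_acoustic (ha : 0 < a) (hγ : 1 < γ) {ρ u c ct cx ut ux α : ℝ} (hρ : 0 < ρ)
    (hc : soundSpeed a γ ρ = c) (h1 : ct + u * cx + (γ - 1) / 2 * c * ux = 0)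
    (h2 : ut + u * ux + 2 / (γ - 1) * c * cx = α * u) :
    2 / (γ - 1) * (ρ / c) * ct + (2 / (γ - 1) * (ρ / c) * cx * u + ρ * ux) = 0 ∧
    (2 / (γ - 1) * (ρ / c) * ct * u + ρ * ut) + (2 / (γ - 1) * (ρ / c) * cx * u ^ 2 +
      ρ * (2 * u * ux) + a * (γ * ρ ^ (γ - 1) * (2 / (γ - 1) * (ρ / c) * cx))) = α * ρ * u := by
  have hcpos : c ≠ 0 := by rw [← hc]; exact (soundSpeed_pos ha hγ hρ).ne'
  have hγ1 : γ - 1 ≠ 0 := by linarith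
  have hsq := soundSpeed_sq ha hγ hρ
  rw [hc] at hsq
  have hmass : 2 / (γ - 1) * (ρ / c) * ct + (2 / (γ - 1) * (ρ / c) * cx * u + ρ * ux) = 0 := by
    have e : 2 / (γ - 1) * (ρ / c) * ct + (2 / (γ - 1) * (ρ / c) * cx * u + ρ * ux)
        = 2 / (γ - 1) * (ρ / c) * (ct + u * cx + (γ - 1) / 2 * c * ux) := by
      field_simp
      ring
    rw [e, h1, mul_zero]
  refine ⟨hmass, ?_⟩
  have e1 : a * (γ * ρ ^ (γ - 1) * (2 / (γ - 1) * (ρ / c) * cx))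
      = ρ * (2 / (γ - 1) * c * cx) := by
    have : a * (γ * ρ ^ (γ - 1) * (2 / (γ - 1) * (ρ / c) * cx))
        = (a * γ * ρ ^ (γ - 1)) * (2 / (γ - 1) * (ρ / c) * cx) := by ring
    rw [this, ← hsq]
    field_simp
  rw [e1]
  linear_combination u * hmass + ρ * h2

theorem c1Norm_le {L B₁ B₂ B₃ : ℝ} {F : ℝ × ℝ → ℝ} (hB₁ : 0 ≤ B₁) (hB₂ : 0 ≤ B₂) (hB₃ : 0 ≤ B₃)
    (h1 : ∀ z ∈ domain L, |F z| ≤ B₁) (h2 : ∀ z ∈ domain L, |dt F z| ≤ B₂)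
    (h3 : ∀ z ∈ domain L, |dx L F z| ≤ B₃) : c1Norm L F ≤ ENNReal.ofReal (B₁ + B₂ + B₃) := by
  have key : ∀ (G : ℝ × ℝ → ℝ) (B : ℝ), (∀ z ∈ domain L, |G z| ≤ B) →
      (⨆ z ∈ domain L, ‖G z‖ₑ) ≤ ENNReal.ofReal B := by
    intro G B h
    refine iSup₂_le fun z hz => ?_
    rw [← ofReal_norm]
    exact ENNReal.ofReal_le_ofReal (h z hz)
  rw [c1Norm, ENNReal.ofReal_add (by positivity) hB₃, ENNReal.ofReal_add hB₁ hB₂]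
  exact add_le_add (add_le_add (key _ _ h1) (key _ _ h2)) (key _ _ h3)

theorem contDiffOn_of_hasPartials {L : ℝ} (hL : 0 < L) {F Ft Fx : ℝ × ℝ → ℝ}
    (h : ∀ z ∈ domain L, HasPartials L F z (Ft z) (Fx z)) (ht : ContinuousOn Ft (domain L))
    (hx : ContinuousOn Fx (domain L)) : ContDiffOn ℝ 1 F (domain L) := by
  rw [show (1 : ℕ∞ω) = 0 + 1 from rfl, contDiffOn_succ_iff_fderivWithin (uniqueDiffOn_domain hL)]
  refine ⟨fun z hz => HasFDerivWithinAt.differentiableWithinAt (h z hz), by simp,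
    contDiffOn_zero.2 ?_⟩
  refine ContinuousOn.congr (f := fun z => Ft z • ContinuousLinearMap.fst ℝ ℝ ℝ +
    Fx z • ContinuousLinearMap.snd ℝ ℝ ℝ)
    ((ht.smul continuousOn_const).add (hx.smul continuousOn_const)) fun z hz => ?_
  exact HasFDerivWithinAt.fderivWithin (h z hz) (uniqueDiffOn_domain hL z hz)

end

/-! ### Density and velocity of a classical solution -/

section

variable {a γ L P C κ R ρ₀ c₀ u₀ : ℝ} {α U : ℝ → ℝ} {g : Bool → ℝ → ℝ} {v p : Bool → ℝ → ℝ → ℝ}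

/-- The velocity field of perturbed Riemann invariants `v`. -/
def velocityField (U : ℝ → ℝ) (v : Bool → ℝ → ℝ → ℝ) (z : ℝ × ℝ) : ℝ :=
  U z.1 + velocityPart fun j => v j z.1 z.2

/-- The sound speed of perturbed Riemann invariants `v`. -/
def soundField (γ c₀ : ℝ) (v : Bool → ℝ → ℝ → ℝ) (z : ℝ × ℝ) : ℝ :=
  c₀ + soundPart γ fun j => v j z.1 z.2

/-- The space derivative of `v` read off from the system. -/
def spaceDeriv (γ c₀ : ℝ) (U α : ℝ → ℝ) (v p : Bool → ℝ → ℝ → ℝ) (i : Bool) (z : ℝ × ℝ) : ℝ :=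
  source γ c₀ U α i z.1 (fun j => v j z.1 z.2) -
    slowness γ c₀ U i z.1 (fun j => v j z.1 z.2) * p i z.1 z.2

namespace IsClassicalSolution

theorem hasPartials (h : IsClassicalSolution L P C κ (slowness γ c₀ U) (source γ c₀ U α) g v p)
    (i : Bool) {z : ℝ × ℝ} (hz : z ∈ domain L) :
    HasPartials L (fun w => v i w.1 w.2) z (p i z.1 z.2) (spaceDeriv γ c₀ U α v p i z) :=
  (h.hasFDerivWithinAt i z.1 z.2 hz.2).mono fun _ hw => ⟨trivial, hw.2⟩

theorem continuousOn_spaceDeriv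
    (h : IsClassicalSolution L P C κ (slowness γ c₀ U) (source γ c₀ U α) g v p)
    (hU : Continuous U) (hα : Continuous α)
    (hsp : ∀ i, ∀ z ∈ domain L, 0 < charSpeed γ c₀ U i z.1 fun j => v j z.1 z.2) (i : Bool) :
    ContinuousOn (spaceDeriv γ c₀ U α v p i) (domain L) := by
  have hsub : domain L ⊆ univ ×ˢ Icc 0 L := fun _ hw => ⟨trivial, hw.2⟩
  have hv : ∀ i, ContinuousOn (fun z : ℝ × ℝ => v i z.1 z.2) (domain L) := fun i =>
    (h.continuousOn i).mono hsub
  have hp := (h.continuousOn_deriv i).mono hsub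
  have hvel : ContinuousOn (fun z : ℝ × ℝ => velocityPart fun j => v j z.1 z.2) (domain L) :=
    ((hv false).add (hv true)).div_const 2
  have hsound : ContinuousOn (fun z : ℝ × ℝ => soundPart γ fun j => v j z.1 z.2) (domain L) :=
    continuousOn_const.mul ((hv true).sub (hv false))
  have hspeed : ContinuousOn (fun z : ℝ × ℝ => charSpeed γ c₀ U i z.1 fun j => v j z.1 z.2)
      (domain L) :=
    (((hU.comp continuous_fst).continuousOn).add hvel).add
      (continuousOn_const.mul (continuousOn_const.add hsound))
  have hslow : ContinuousOn (fun z : ℝ × ℝ => slowness γ c₀ U i z.1 fun j => v j z.1 z.2)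
      (domain L) := hspeed.inv₀ fun z hz => (hsp i z hz).ne'
  exact ((hslow.mul (hα.comp continuous_fst).continuousOn).mul hvel).sub (hslow.mul hp)

theorem abs_spaceDeriv_le
    (h : IsClassicalSolution L P C κ (slowness γ c₀ U) (source γ c₀ U α) g v p)
    (hS : IsSystem R C P (slowness γ c₀ U) (source γ c₀ U α)) (hκ : κ ≤ R) (hκ0 : 0 ≤ κ)
    (hC : 0 ≤ C) (i : Bool) {z : ℝ × ℝ} (hz : z ∈ domain L) :
    |spaceDeriv γ c₀ U α v p i z| ≤ 2 * C * κ := by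
  have hb : ∀ j, |v j z.1 z.2| ≤ κ := fun j => h.bound j z.1 z.2 hz.2
  have hbR : ∀ j, |v j z.1 z.2| ≤ R := fun j => (hb j).trans hκ
  have h1 := hS.source_le i z.1 (fun j => v j z.1 z.2) κ hbR hκ0 hb
  have h2 : |slowness γ c₀ U i z.1 (fun j => v j z.1 z.2) * p i z.1 z.2| ≤ C * κ := by
    rw [abs_mul, abs_of_nonneg (hS.slowness_nonneg i z.1 _ hbR)]
    exact mul_le_mul (hS.slowness_le i z.1 _ hbR) (h.bound_deriv i z.1 z.2 hz.2) (abs_nonneg _) hC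
  refine (abs_sub _ _).trans ?_
  linarith

theorem hasPartials_velocityPart
    (h : IsClassicalSolution L P C κ (slowness γ c₀ U) (source γ c₀ U α) g v p)
    {z : ℝ × ℝ} (hz : z ∈ domain L) :
    HasPartials L (fun w => velocityPart fun j => v j w.1 w.2) z
      (velocityPart fun j => p j z.1 z.2)
      (velocityPart fun j => spaceDeriv γ c₀ U α v p j z) := by
  have := ((h.hasPartials false hz).add (h.hasPartials true hz)).const_mul (1 / 2)
  simpa only [velocityPart, one_div, inv_mul_eq_div] using this

theorem hasPartials_soundField
    (h : IsClassicalSolution L P C κ (slowness γ c₀ U) (source γ c₀ U α) g v p)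
    {z : ℝ × ℝ} (hz : z ∈ domain L) :
    HasPartials L (soundField γ c₀ v) z (soundPart γ fun j => p j z.1 z.2)
      (soundPart γ fun j => spaceDeriv γ c₀ U α v p j z) :=
  (((h.hasPartials true hz).sub (h.hasPartials false hz)).const_mul ((γ - 1) / 4)).const_add c₀

theorem hasPartials_velocityField
    (h : IsClassicalSolution L P C κ (slowness γ c₀ U) (source γ c₀ U α) g v p)
    (hU : ∀ t, HasDerivAt U (α t * U t) t) {z : ℝ × ℝ} (hz : z ∈ domain L) :
    HasPartials L (velocityField U v) z
      (α z.1 * U z.1 + velocityPart fun j => p j z.1 z.2)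
      (velocityPart fun j => spaceDeriv γ c₀ U α v p j z) := by
  have := (HasPartials.of_time (L := L) (hU z.1)).add (h.hasPartials_velocityPart hz)
  rw [zero_add] at this
  exact this

/-- Multiply each equation by its speed. The half-sum of the two families is the velocity equation,
and `(γ - 1)/4` times their difference is the sound speed equation. -/
theorem acoustic (hγ : 1 < γ)
    (hsp : ∀ i, ∀ z ∈ domain L, 0 < charSpeed γ c₀ U i z.1 fun j => v j z.1 z.2)
    {z : ℝ × ℝ} (hz : z ∈ domain L) :
    ((soundPart γ fun j => p j z.1 z.2) + velocityField U v z *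
      (soundPart γ fun j => spaceDeriv γ c₀ U α v p j z) + (γ - 1) / 2 * soundField γ c₀ v z *
        (velocityPart fun j => spaceDeriv γ c₀ U α v p j z) = 0) ∧
    ((α z.1 * U z.1 + velocityPart fun j => p j z.1 z.2) + velocityField U v z *
      (velocityPart fun j => spaceDeriv γ c₀ U α v p j z) +
        2 / (γ - 1) * soundField γ c₀ v z * (soundPart γ fun j => spaceDeriv γ c₀ U α v p j z)
        = α z.1 * velocityField U v z) := by
  have key : ∀ i, (velocityField U v z + familySign i * soundField γ c₀ v z) *
      spaceDeriv γ c₀ U α v p i z + p i z.1 z.2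
        = α z.1 * velocityPart fun j => v j z.1 z.2 := by
    intro i
    have h1 := (hsp i z hz).ne'
    have e : velocityField U v z + familySign i * soundField γ c₀ v z
        = charSpeed γ c₀ U i z.1 fun j => v j z.1 z.2 := rfl
    rw [e, spaceDeriv, source, slowness]
    field_simp
    ring
  have k0 := key false
  have k1 := key true
  simp only [familySign, Bool.false_eq_true, if_false, if_true] at k0 k1
  have hγ1 : γ - 1 ≠ 0 := by linarith
  have e : velocityField U v z = U z.1 + velocityPart fun j => v j z.1 z.2 := rfl
  set q0 := spaceDeriv γ c₀ U α v p false z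
  set q1 := spaceDeriv γ c₀ U α v p true z
  have s1 : (soundPart γ fun j => spaceDeriv γ c₀ U α v p j z) = (γ - 1) / 4 * (q1 - q0) := rfl
  have s2 : (soundPart γ fun j => p j z.1 z.2)
    = (γ - 1) / 4 * (p true z.1 z.2 - p false z.1 z.2) := rfl
  have s3 : (velocityPart fun j => spaceDeriv γ c₀ U α v p j z) = (q0 + q1) / 2 := rfl
  have s4 : (velocityPart fun j => p j z.1 z.2) = (p false z.1 z.2 + p true z.1 z.2) / 2 := rfl
  rw [s1, s2, s3, s4]
  constructor
  · linear_combination (γ - 1) / 4 * (k1 - k0)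
  · have e2 : 2 / (γ - 1) * soundField γ c₀ v z * ((γ - 1) / 4 * (q1 - q0))
        = soundField γ c₀ v z * (q1 - q0) / 2 := by field_simp; ring
    rw [e2]
    linear_combination (k0 + k1) / 2 - α z.1 * e

/-- A classical solution in perturbed Riemann invariants solves the Euler system. -/
theorem isSolution {ρl ul : ℝ → ℝ} (ha : 0 < a) (hγ : 1 < γ) (hL : 0 < L)
    (h : IsClassicalSolution L P C κ (slowness γ c₀ U) (source γ c₀ U α) g v p)
    (hUd : ∀ t, HasDerivAt U (α t * U t) t) (hα : Continuous α) (hU0 : U 0 = u₀)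
    (hρ₀ : densityOf a γ c₀ = ρ₀)
    (hsp : ∀ i, ∀ z ∈ domain L, 0 < charSpeed γ c₀ U i z.1 fun j => v j z.1 z.2)
    (hcpos : ∀ z ∈ domain L, 0 < soundField γ c₀ v z)
    (hbd : ∀ t, 0 ≤ t → densityOf a γ (soundField γ c₀ v (t, 0)) = ρl t ∧
      velocityField U v (t, 0) = ul t) :
    IsSolution a γ L α ρ₀ u₀ ρl ul (fun z => densityOf a γ (soundField γ c₀ v z))
      (velocityField U v) := by
  have hUc : Continuous U := continuous_iff_continuousAt.2 fun t => (hUd t).continuousAt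
  have hsub : domain L ⊆ univ ×ˢ Icc 0 L := fun _ hw => ⟨trivial, hw.2⟩
  have hpc : ∀ i, ContinuousOn (fun z : ℝ × ℝ => p i z.1 z.2) (domain L) := fun i =>
    (h.continuousOn_deriv i).mono hsub
  have hqc := h.continuousOn_spaceDeriv hUc hα hsp
  have hc_part := fun z (hz : z ∈ domain L) => h.hasPartials_soundField hz
  have hu_part := fun z (hz : z ∈ domain L) => h.hasPartials_velocityField hUd hz
  have hρ_part : ∀ z ∈ domain L, HasPartials L (fun w => densityOf a γ (soundField γ c₀ v w)) z
      (2 / (γ - 1) * (densityOf a γ (soundField γ c₀ v z) / soundField γ c₀ v z) *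
        soundPart γ fun j => p j z.1 z.2)
      (2 / (γ - 1) * (densityOf a γ (soundField γ c₀ v z) / soundField γ c₀ v z) *
        soundPart γ fun j => spaceDeriv γ c₀ U α v p j z) := fun z hz =>
    (hc_part z hz).comp (hasDerivAt_densityOf ha hγ (hcpos z hz))
  have hcc : ContinuousOn (soundField γ c₀ v) (domain L) := fun z hz =>
    HasFDerivWithinAt.continuousWithinAt (hc_part z hz)
  have hρc : ContinuousOn (fun z => densityOf a γ (soundField γ c₀ v z)) (domain L) :=
    fun z hz => HasFDerivWithinAt.continuousWithinAt (hρ_part z hz)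
  have hsc : ContinuousOn (fun z : ℝ × ℝ => soundPart γ fun j => p j z.1 z.2) (domain L) :=
    continuousOn_const.mul ((hpc true).sub (hpc false))
  have hsc' : ContinuousOn (fun z : ℝ × ℝ => soundPart γ fun j => spaceDeriv γ c₀ U α v p j z)
      (domain L) := continuousOn_const.mul ((hqc true).sub (hqc false))
  have hvc : ContinuousOn (fun z : ℝ × ℝ => velocityPart fun j => p j z.1 z.2) (domain L) :=
    ((hpc false).add (hpc true)).div_const 2
  have hvc' : ContinuousOn (fun z : ℝ × ℝ => velocityPart fun j => spaceDeriv γ c₀ U α v p j z)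
      (domain L) := ((hqc false).add (hqc true)).div_const 2
  have hfac : ContinuousOn (fun z => 2 / (γ - 1) *
      (densityOf a γ (soundField γ c₀ v z) / soundField γ c₀ v z)) (domain L) :=
    continuousOn_const.mul (hρc.div hcc fun z hz => (hcpos z hz).ne')
  constructor
  · exact contDiffOn_of_hasPartials hL hρ_part (hfac.mul hsc) (hfac.mul hsc')
  · exact contDiffOn_of_hasPartials hL hu_part
      ((((hα.mul hUc).comp continuous_fst).continuousOn).add hvc) hvc'
  · exact fun z hz => (densityOf_pos ha hγ (hcpos z hz)).le
  · intro z hz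
    have hm := (hρ_part z hz).mul (hu_part z hz)
    rw [(hρ_part z hz).dt_eq hz, hm.dx_eq hL hz]
    obtain ⟨k1, k2⟩ := acoustic (p := p) (α := α) hγ hsp hz
    exact (euler_of_acoustic ha hγ (densityOf_pos ha hγ (hcpos z hz))
      (soundSpeed_densityOf ha hγ (hcpos z hz)) k1 k2).1
  · intro z hz
    have hρpos := densityOf_pos ha hγ (hcpos z hz)
    have hm := (hρ_part z hz).mul (hu_part z hz)
    have hm2 := ((hρ_part z hz).mul (hasPartials_sq (hu_part z hz))).add
      (hasPartials_pressure (a := a) (γ := γ) hρpos (hρ_part z hz))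
    rw [hm.dt_eq hz, hm2.dx_eq hL hz]
    obtain ⟨k1, k2⟩ := acoustic (p := p) (α := α) hγ hsp hz
    exact (euler_of_acoustic ha hγ hρpos (soundSpeed_densityOf ha hγ (hcpos z hz)) k1 k2).2
  -- At `t = 0` the perturbation is at rest, which gives the initial data.
  · intro x hx
    have h0 : ∀ j, v j 0 x = 0 := fun j => h.rest j 0 x hx le_rfl
    simp [soundField, velocityField, soundPart, velocityPart, h0, hρ₀, hU0]
  · exact fun t ht => hbd t ht

/-- Values and time derivatives of `v` have size `κ`, and space derivatives have size `2Cκ` by the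
equation. The factor `K (γ - 1)/2` converts invariants to density. -/
theorem c1Norm_le (ha : 0 < a) (hγ : 1 < γ) (hL : 0 < L)
    (h : IsClassicalSolution L P C κ (slowness γ c₀ U) (source γ c₀ U α) g v p)
    (hS : IsSystem R C P (slowness γ c₀ U) (source γ c₀ U α)) (hκ : κ ≤ R) (hκ0 : 0 ≤ κ)
    (hC : 0 ≤ C) (hc₀ : 0 < c₀)
    (hRc : (γ - 1) / 2 * R ≤ c₀ / 2) (hρ₀ : densityOf a γ c₀ = ρ₀) {K : ℝ} (hK : 0 ≤ K)
    (hK1 : ∀ c ∈ Icc (c₀ / 2) (3 * c₀ / 2), |2 / (γ - 1) * (densityOf a γ c / c)| ≤ K)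
    (hK2 : ∀ c ∈ Icc (c₀ / 2) (3 * c₀ / 2), |densityOf a γ c - densityOf a γ c₀| ≤ K * |c - c₀|) :
    c1Norm L (fun z => densityOf a γ (soundField γ c₀ v z) - ρ₀) +
      c1Norm L (fun z => velocityField U v z - U z.1) ≤
      ENNReal.ofReal ((K * ((γ - 1) / 2) + 1) * (2 + 2 * C) * κ) := by
  have hγ1 : 0 < γ - 1 := by linarith
  have hb : ∀ z ∈ domain L, ∀ j, |v j z.1 z.2| ≤ κ := fun z hz j => h.bound j z.1 z.2 hz.2
  have hpb : ∀ z ∈ domain L, ∀ j, |p j z.1 z.2| ≤ κ := fun z hz j =>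
    h.bound_deriv j z.1 z.2 hz.2
  have hqb : ∀ z ∈ domain L, ∀ j, |spaceDeriv γ c₀ U α v p j z| ≤ 2 * C * κ := fun z hz j =>
    h.abs_spaceDeriv_le hS hκ hκ0 hC j hz
  have hdist : ∀ z ∈ domain L, |soundField γ c₀ v z - c₀| ≤ (γ - 1) / 2 * κ := fun z hz => by
    rw [soundField, add_sub_cancel_left]
    exact abs_soundPart_le hγ (hb z hz)
  have hI : ∀ z ∈ domain L, soundField γ c₀ v z ∈ Icc (c₀ / 2) (3 * c₀ / 2) := fun z hz => by
    have h1 := abs_le.1 (hdist z hz)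
    have h2 : (γ - 1) / 2 * κ ≤ (γ - 1) / 2 * R := mul_le_mul_of_nonneg_left hκ (by positivity)
    constructor <;> linarith [h1.1, h1.2]
  have hpos : ∀ z ∈ domain L, 0 < soundField γ c₀ v z := fun z hz => by
    linarith [(hI z hz).1, hc₀]
  have hρ : c1Norm L (fun z => densityOf a γ (soundField γ c₀ v z) - ρ₀) ≤
      ENNReal.ofReal (K * ((γ - 1) / 2 * κ) + K * ((γ - 1) / 2 * κ) +
        K * ((γ - 1) / 2 * (2 * C * κ))) := by
    have hpart := fun z (hz : z ∈ domain L) => ((h.hasPartials_soundField hz).comp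
      (hasDerivAt_densityOf ha hγ (hpos z hz))).sub_const ρ₀
    refine EulerSource.c1Norm_le (by positivity) (by positivity) (by positivity) (fun z hz => ?_)
      (fun z hz => ?_) (fun z hz => ?_)
    · rw [← hρ₀]
      exact (hK2 _ (hI z hz)).trans (mul_le_mul_of_nonneg_left (hdist z hz) hK)
    · rw [(hpart z hz).dt_eq hz, abs_mul]
      exact mul_le_mul (hK1 _ (hI z hz)) (abs_soundPart_le hγ (hpb z hz)) (abs_nonneg _) hK
    · rw [(hpart z hz).dx_eq hL hz, abs_mul]
      exact mul_le_mul (hK1 _ (hI z hz)) (abs_soundPart_le hγ (hqb z hz)) (abs_nonneg _) hK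
  have hu : c1Norm L (fun z => velocityField U v z - U z.1) ≤
      ENNReal.ofReal (κ + κ + 2 * C * κ) := by
    have e : (fun z => velocityField U v z - U z.1)
        = fun z => velocityPart fun j => v j z.1 z.2 := by
      funext z
      rw [velocityField, add_sub_cancel_left]
    rw [e]
    refine EulerSource.c1Norm_le hκ0 hκ0 (by positivity) (fun z hz => ?_)
      (fun z hz => ?_) (fun z hz => ?_)
    · exact abs_velocityPart_le (hb z hz)
    · rw [(h.hasPartials_velocityPart hz).dt_eq hz]
      exact abs_velocityPart_le (hpb z hz)
    · rw [(h.hasPartials_velocityPart hz).dx_eq hL hz]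
      exact abs_velocityPart_le (hqb z hz)
  refine (add_le_add hρ hu).trans ?_
  rw [← ENNReal.ofReal_add (by positivity) (by positivity)]
  exact ENNReal.ofReal_le_ofReal (le_of_eq (by ring))

end IsClassicalSolution

end

end EulerSource
end

noncomputable section
namespace EulerSource
open Filter Topology

/-! ### The periodic supersonic flow -/

/-- `Λ` is the sum of the three nonnegative lower bounds required of it. It depends only on `C` and
`L`, so it is fixed before the data. -/
theorem admissible_of_le {L R C κ Λ : ℝ} (hL : 0 ≤ L) (hR : R ≤ 1) (hC : 1 ≤ C) (hκ : 0 ≤ κ)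
    (hκR : κ * Real.exp (Λ * L) ≤ R)
    (hΛ : Λ = 4 * C * Real.exp (2 * C * L) +
      2 * (Real.exp (2 * C * L) * C + 2 * C * C * Real.exp (2 * C * L) * L + C) +
      2 * (C * Real.exp (2 * C * L) ^ 3 * (1 + 2 * C * L) + C * Real.exp (2 * C * L) ^ 2)) :
    Admissible L R C κ Λ := by
  have hC0 : 0 ≤ C := zero_le_one.trans hC
  have h1 : 0 ≤ 4 * C * Real.exp (2 * C * L) := by positivity
  have h2 : 0 ≤ 2 * (Real.exp (2 * C * L) * C + 2 * C * C * Real.exp (2 * C * L) * L + C) := by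
    positivity
  have h3 : 0 ≤ 2 * (C * Real.exp (2 * C * L) ^ 3 * (1 + 2 * C * L) +
    C * Real.exp (2 * C * L) ^ 2) := by positivity
  exact ⟨hL, hR, hC, hκ, hκR, by linarith, by linarith, by linarith⟩

end EulerSource
end

theorem theorem1p1
    (a γ L P : ℝ) (ha : 0 < a) (hγ : 1 < γ) (hL : 0 < L) (hP : 0 < P)
    (α : ℝ → ℝ) (hα : ContDiff ℝ 2 α) (hαP : Function.Periodic α P)
    (hα_nonneg : ∀ t : ℝ, 0 ≤ t → 0 ≤ ∫ s in (0 : ℝ)..t, α s)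
    (hα_mean : ∫ s in (0 : ℝ)..P, α s = 0)
    (ρ₀ u₀ : ℝ) (hρ₀ : 0 < ρ₀)
    (hsupersonic : Real.sqrt (a * γ) * ρ₀ ^ ((γ - 1) / 2) < u₀) :
    ∃ ε₀ T₀ C₀ : ℝ, 0 < ε₀ ∧ 0 < T₀ ∧ 0 < C₀ ∧
      ∀ ε : ℝ, 0 ≤ ε → ε ≤ ε₀ →
      ∀ ρl ul : ℝ → ℝ,
        -- periodic boundary data that are `C¹` (as `H²` functions are) also across the period
        Function.Periodic ρl P → Function.Periodic ul P →
        ContDiff ℝ 1 ρl → ContDiff ℝ 1 ul →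
        -- compatibility with the initial data and the equations at the corner `(0, 0)`
        ρl 0 = ρ₀ → ul 0 = u₀ → deriv ρl 0 = 0 → deriv ul 0 = α 0 * u₀ →
        EulerSource.h2Norm P (fun t => ρl t - ρ₀)
          + EulerSource.h2Norm P (fun t => ul t - EulerSource.backgroundVelocity α u₀ t)
          ≤ ENNReal.ofReal ε →
        ∃ ρ u : ℝ × ℝ → ℝ,
          EulerSource.IsSolution a γ L α ρ₀ u₀ ρl ul ρ u ∧
          (∀ ρ' u' : ℝ × ℝ → ℝ, EulerSource.IsSolution a γ L α ρ₀ u₀ ρl ul ρ' u' →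
            ∀ z ∈ EulerSource.domain L, ρ' z = ρ z ∧ u' z = u z) ∧
          (∀ t x : ℝ, T₀ < t → x ∈ Set.Icc 0 L →
            ρ (t + P, x) = ρ (t, x) ∧ u (t + P, x) = u (t, x)) ∧
          EulerSource.c1Norm L (fun z => ρ z - ρ₀)
            + EulerSource.c1Norm L (fun z => u z - EulerSource.backgroundVelocity α u₀ z.1)
            ≤ ENNReal.ofReal (C₀ * ε) := by
  have hγ1 : 0 < γ - 1 := by linarith
  have hαc : Continuous α := hα.continuous
  set c₀ := EulerSource.soundSpeed a γ ρ₀ with hc₀_def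
  set U := EulerSource.backgroundVelocity α u₀ with hU_def
  have hc₀ : 0 < c₀ := EulerSource.soundSpeed_pos ha hγ hρ₀
  have hcu : c₀ < u₀ := hsupersonic
  have hu₀ : 0 ≤ u₀ := (hc₀.trans hcu).le
  have hρc : EulerSource.densityOf a γ c₀ = ρ₀ := EulerSource.densityOf_soundSpeed ha hγ hρ₀
  have hUP : Function.Periodic U P := EulerSource.periodic_backgroundVelocity hαc hαP hα_mean
  have hUge : ∀ t, u₀ ≤ U t :=
    EulerSource.le_backgroundVelocity hP hαc hαP hα_mean hα_nonneg hu₀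
  have hUd : ∀ t, HasDerivAt U (α t * U t) t := EulerSource.hasDerivAt_backgroundVelocity hαc
  have hUc : ContDiff ℝ 2 U := EulerSource.contDiff_backgroundVelocity hα
  have hU0 : U 0 = u₀ := by simp [hU_def, EulerSource.backgroundVelocity]
  have hw : 0 < 1 + (γ - 1) / 2 := by positivity
  -- Within radius `R` both speeds keep half of the supersonic gap and the sound speed stays at
  -- least `c₀/2`.
  set R := min 1 (min ((u₀ - c₀) / 2) (c₀ / 2) / (1 + (γ - 1) / 2)) with hR_def
  have hR : 0 < R := lt_min one_pos (div_pos (lt_min (by linarith) (by linarith)) hw)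
  have hR1 : R ≤ 1 := min_le_left _ _
  have hRm : R * (1 + (γ - 1) / 2) ≤ min ((u₀ - c₀) / 2) (c₀ / 2) :=
    (le_div_iff₀ hw).1 (min_le_right _ _)
  have hR2 : R * (1 + (γ - 1) / 2) ≤ (u₀ - c₀) / 2 := hRm.trans (min_le_left _ _)
  have hR3 : (γ - 1) / 2 * R ≤ c₀ / 2 := by linarith [hRm.trans (min_le_right _ _)]
  obtain ⟨C, hC, hS⟩ := EulerSource.exists_isSystem hγ hP hα hαP hUc hUP hUge hc₀ hcu hR hR1 hR2
  obtain ⟨K₁, hK₁, hdatum⟩ := EulerSource.exists_isDatum (a := a) (P := P) hγ hρ₀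
  obtain ⟨K₂, hK₂, hdens, hdens'⟩ := EulerSource.exists_densityOf_bound ha hγ hc₀
  have hC0 : 0 < C := one_pos.trans_le hC
  obtain ⟨Λ, hΛ⟩ : ∃ Λ, Λ = 4 * C * Real.exp (2 * C * L) +
      2 * (Real.exp (2 * C * L) * C + 2 * C * C * Real.exp (2 * C * L) * L + C) +
      2 * (C * Real.exp (2 * C * L) ^ 3 * (1 + 2 * C * L) + C * Real.exp (2 * C * L) ^ 2) :=
    ⟨_, rfl⟩
  obtain ⟨K, hK⟩ : ∃ K, K = 2 + √P + P * √P := ⟨_, rfl⟩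
  have hKpos : 0 < K := by rw [hK]; positivity
  obtain ⟨W, hW⟩ : ∃ W, W = 2 * Real.exp (2 * C * L) * (K₁ * K) * Real.exp (Λ * L) := ⟨_, rfl⟩
  have hWpos : 0 < W := by rw [hW]; positivity
  -- `W ε` is the final size of `v`, to be kept below `R`; `K ε` bounds the boundary perturbation,
  -- to be kept below `ρ₀/2`. `C L` is the longest crossing time of a characteristic.
  refine ⟨min (R / W) (ρ₀ / 2 / K), C * L, (K₂ * ((γ - 1) / 2) + 1) * (2 + 2 * C) * W,
    lt_min (by positivity) (by positivity), by positivity, by positivity, ?_⟩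
  intro ε hε hεle ρl ul hρP hulP hρ1 hul1 hρl0 hul0 hρl0' hul0' hnorm
  have hεW : W * ε ≤ R := by
    rw [mul_comm]; exact (le_div_iff₀ hWpos).1 (hεle.trans (min_le_left _ _))
  have hεK : K * ε ≤ ρ₀ / 2 := by
    rw [mul_comm]; exact (le_div_iff₀ hKpos).1 (hεle.trans (min_le_right _ _))
  have hr := EulerSource.isRestPerturbation_of_h2Norm hP hε (hρ1.sub contDiff_const)
    (f := fun t => ρl t - ρ₀) (fun t => by simp only [hρP t]) (by simp [hρl0])
    (by rw [deriv_sub_const, hρl0']) (le_self_add.trans hnorm)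
  have hw' := EulerSource.isRestPerturbation_of_h2Norm hP hε
    (hul1.sub (hUc.of_le one_le_two))
    (f := fun t => ul t - U t) (fun t => by simp only [hulP t, hUP t]) (by simp [hul0, hU0])
    (by rw [deriv_fun_sub (hul1.differentiable one_ne_zero 0) (hUd 0).differentiableAt, hul0',
      (hUd 0).deriv, hU0, sub_self])
    (le_add_self.trans hnorm)
  rw [← hK] at hr hw'
  obtain ⟨M₀, hg⟩ := hdatum _ _ _ _ _ hεK hr hw'
  set r : ℝ → ℝ := fun t => if t ≤ 0 then 0 else ρl t - ρ₀ with hr_def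
  set w : ℝ → ℝ := fun t => if t ≤ 0 then 0 else ul t - U t with hw_def
  have hrt : ∀ t, 0 ≤ t → ρ₀ + r t = ρl t := fun t ht => by
    rcases ht.eq_or_lt with rfl | ht
    · simp [hr_def, hρl0]
    · simp [hr_def, ht.not_ge]
  have hwt : ∀ t, 0 ≤ t → U t + w t = ul t := fun t ht => by
    rcases ht.eq_or_lt with rfl | ht
    · simp [hw_def, hul0, hU0]
    · simp [hw_def, ht.not_ge]
  have hκ' : 2 * Real.exp (2 * C * L) * (K₁ * (K * ε)) * Real.exp (Λ * L) = W * ε := by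
    rw [hW]; ring
  have hA : EulerSource.Admissible L R C (2 * Real.exp (2 * C * L) * (K₁ * (K * ε))) Λ :=
    EulerSource.admissible_of_le hL.le hR1 hC (by positivity) (hκ'.trans_le hεW) hΛ
  -- `κ` is the smallest value the datum allows, hence `le_rfl`; this makes the size of the solution
  -- exactly `W ε`.
  obtain ⟨v, p, h⟩ := EulerSource.exists_isClassicalSolution hA hS hg le_rfl
  rw [hκ'] at h
  have hvR : ∀ z ∈ EulerSource.domain L, ∀ j, |v j z.1 z.2| ≤ R := fun z hz j =>
    (h.bound j z.1 z.2 hz.2).trans hεW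
  have hsp : ∀ i, ∀ z ∈ EulerSource.domain L,
      0 < EulerSource.charSpeed γ c₀ U i z.1 fun j => v j z.1 z.2 := fun i z hz =>
    (by linarith : 0 < (u₀ - c₀) / 2).trans_le
      (EulerSource.charSpeed_ge hγ hUge hc₀ hR2 i z.1 (hvR z hz))
  have hcpos : ∀ z ∈ EulerSource.domain L, 0 < EulerSource.soundField γ c₀ v z := fun z hz => by
    have := (abs_le.1 (EulerSource.abs_soundPart_le hγ (hvR z hz))).1
    rw [EulerSource.soundField]
    linarith
  have hbd : ∀ t, 0 ≤ t →
      EulerSource.densityOf a γ (EulerSource.soundField γ c₀ v (t, 0)) = ρl t ∧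
      EulerSource.velocityField U v (t, 0) = ul t := by
    intro t ht
    have hρpos : 0 < ρl t := by
      have := (abs_le.1 (hr.bound t)).1
      rw [← hrt t ht]
      linarith
    constructor
    · have e : EulerSource.soundField γ c₀ v (t, 0) = EulerSource.soundSpeed a γ (ρl t) := by
        simp only [EulerSource.soundField, EulerSource.soundPart, h.boundary,
          EulerSource.boundaryDatum, EulerSource.familySign, hrt t ht]
        simp only [Bool.false_eq_true, if_false, if_true, ← hc₀_def]
        field_simp
        ring
      rw [e, EulerSource.densityOf_soundSpeed ha hγ hρpos]
    · rw [← hwt t ht]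
      simp only [EulerSource.velocityField, EulerSource.velocityPart, h.boundary,
        EulerSource.boundaryDatum, EulerSource.familySign, Bool.false_eq_true, if_false, if_true]
      ring
  have hsol := h.isSolution ha hγ hL hUd hαc hU0 hρc hsp hcpos hbd
  refine ⟨_, _, hsol, fun ρ' u' h' => ?_, fun t x ht hx => ?_, ?_⟩
  · refine hsol.eq_of_supersonic ha hγ hL hαc h' (fun z hz =>
      EulerSource.densityOf_pos ha hγ (hcpos z hz)) fun z hz => ?_
    rw [EulerSource.soundSpeed_densityOf ha hγ (hcpos z hz)]
    -- Positivity of the slower speed `u - c` is supersonicity.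
    have := hsp false z hz
    simp only [EulerSource.charSpeed, EulerSource.familySign, Bool.false_eq_true, if_false] at this
    rw [EulerSource.velocityField, EulerSource.soundField]
    linarith
  · have hv : ∀ j, v j (t + P) x = v j t x := fun j =>
      h.periodic j t x hx ((mul_le_mul_of_nonneg_left hx.2 hC0.le).trans_lt ht)
    simp only [EulerSource.soundField, EulerSource.velocityField, hv, hUP t, and_self]
  · refine (h.c1Norm_le ha hγ hL hS hεW (by positivity) hC0.le hc₀ hR3 hρc hK₂ hdens
      hdens').trans_eq ?_
    rw [mul_assoc _ W ε]
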